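/- **Setting.** Let $\Omega\subset\mathbb R^2$ be a bounded polygonal domain and let $\Gamma\subset\overline\Omega$ be a union of finitely many simple regular $C^1$ curves $\Gamma_1,\dots,\Gamma_m$ (interfaces; they may be closed, may end on $\partial\Omega$ or inside $\Omega$, and any two of them meet in at most finitely many points). Let $\|\cdot\|_\omega$ denote $L^2$-norms (with respect to area for $\omega\subset\Omega$, to arc length for $\omega\subset\Gamma$), let $(\cdot,\cdot)_\omega$ be the corresponding inner products, and let $\nabla_\tau$ be the tangential gradient on $\Gamma$. Let $$V=\{v\in H^1_0(\Omega): v|_{\Gamma_i}\in H^1(\Gamma_i),\ i=1,\dots,m,\ v|_\Gamma \text{ continuous on } \Gamma\}.$$ For $0<\alpha\le\beta<\infty$ and measurable scalar coefficients $A$ on $\Omega$ and $A_\Gamma$ on $\Gamma$ with values in $[\alpha,\beta]$ almost everywhere, and for $f\in L^2(\Omega)$, $f_\Gamma\in L^2(\Gamma)$, let $$a(u,v)=(A\nabla u,\nabla v)_\Omega+(A_\Gamma\nabla_\tau u,\nabla_\tau v)_\Gamma,\quad F(v)=(f,v)_\Omega+(f_\Gamma,v)_\Gamma,\quad |||v|||=a(v,v)^{1/2},$$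 and let $u\in V$ be the weak solution: $a(u,v)=F(v)$ for all $v\in V$. Let $\mathcal T_H$ be a conforming triangulation of $\Omega$ into closed triangles, $H$ the largest diameter of its elements, and $d_T$ the diameter of the inscribed circle of $T$; suppose $H/d_T\le\gamma$ and $d_{T'}/d_T\le\gamma$ for all $T,T'\in\mathcal T_H$. For a set $\omega$ let $U(\omega)$ be the union of the elements that intersect $\omega$, let $U^0(\omega)=\omega$, $U^k(\omega)=U(U^{k-1}(\omega))$, and $\Gamma_T=\Gamma\cap T$, $U_\Gamma(T)=U(T)\cap\Gamma$. Let $V_H\subset V$ be the space of continuous functions that are affine on each element and vanish on $\partial\Omega$. Let $\mathcal I_H:V\to V_H$ be linear with $\mathcal I_H\mathcal I_H=\mathcal I_H$ and such that, for all $v\in V$ and $T\in\mathcal T_H$, $$\|v-\mathcal I_Hv\|_T+\|v-\mathcal I_Hv\|_{\Gamma_T}\le C_{\mathcal I}H\big(\|\nabla v\|_{U(T)}+\|\nabla_\tau v\|_{U_\Gamma(T)}\big),$$ $$\|\nabla\mathcal I_Hv\|_T+\|\nabla_\tau\mathcal I_Hv\|_{\Gamma_T}\le C_{\mathcal I}\big(\|\nabla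 v\|_{U(T)}+\|\nabla_\tau v\|_{U_\Gamma(T)}\big).$$ Let $(\Gamma^T)_{T\in\mathcal T_H}$ be any distribution of $\Gamma$ among the elements, i.e. disjoint Borel sets $\Gamma^T\subset\Gamma_T$ with union $\Gamma$ (so that parts of $\Gamma$ on a common edge of two elements are counted once; if $\Gamma$ meets the element boundaries only in a set of zero length, then $\Gamma^T=\Gamma_T$ up to such a set). For $k\in\mathbb N$ let $V_{\mathrm f}(U^k(T))=\{v\in V:\mathcal I_Hv=0,\ \operatorname{supp}v\subset U^k(T)\}$. For $v\in V_H$ the localized corrector $\phi_T^k\in V_{\mathrm f}(U^k(T))$ is given by $$(A\nabla\phi_T^k,\nabla w)_{U^k(T)}+(A_\Gamma\nabla_\tau\phi_T^k,\nabla_\tau w)_{\Gamma\cap U^k(T)}=\int_TA\nabla v\cdot\nabla w+\int_{\Gamma^T}A_\Gamma\nabla_\tau v\cdot\nabla_\tau w\quad\text{for all } w\in V_{\mathrm f}(U^k(T)).$$ Put $Q_kv=\sum_{T\in\mathcal T_H}\phi_T^k$ and $V_{\mathrm{ms}}^k=\{Q_kv-v:v\in V_H\}$, and let $u_{\mathrm{ms}}^k\in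 V_{\mathrm{ms}}^k$ be the solution of $a(u_{\mathrm{ms}}^k,v)=F(v)$ for all $v\in V_{\mathrm{ms}}^k$. **Theorem 4.** There are constants $C>0$ and $c>0$, depending only on $\Omega$, $\Gamma$, $\alpha$, $\beta$, $\gamma$ and $C_{\mathcal I}$ (so not on $\mathcal T_H$, $H$, $\mathcal I_H$, $k$, $f$, $f_\Gamma$, nor on $A$, $A_\Gamma$ beyond the bounds $\alpha$, $\beta$), such that for every $k\ge7$ the correctors $\phi_T^k$, the weak solution $u$ and the multiscale solution $u_{\mathrm{ms}}^k$ exist and are unique, and $$|||u-u_{\mathrm{ms}}^k|||\le C\big(H+k^{1/2}e^{-ck}\big)\big(\|f\|_\Omega+\|f_\Gamma\|_\Gamma\big).$$ -/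

import Mathlib

open Set Filter Topology MeasureTheory
open scoped ContDiff ENNReal

noncomputable section

namespace LOD

/-- The Euclidean plane. -/
abbrev Plane := EuclideanSpace ℝ (Fin 2)

/-! ### Domain, interfaces, coarse mesh -/

/-- A (bounded) polygonal domain of the plane: open, connected, equal to the interior of its
closure (no slits), the closure being a finite union of convex polygons. -/
structure IsPolygonalDomain (Ω : Set Plane) : Prop where
  isOpen : IsOpen Ω
  isConnected : IsConnected Ω
  interior_closure : interior (closure Ω) = Ω
  polygonal : ∃ S : Finset (Finset Plane), closure Ω = ⋃ s ∈ S, convexHull ℝ (s : Set Plane)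

/-- Finitely many simple regular curves of class `C¹` in the closure of `Ω`, parametrized by arc
length on `[0, len i]` and possibly closing up at the end point, any two of which meet in finitely
many points.  A curve may end at the boundary or inside the domain (immersed interface), and
corners and intersections are allowed where curves meet. -/
structure Interfaces (Ω : Set Plane) where
  num : ℕ
  len : Fin num → ℝ
  curve : Fin num → ℝ → Plane
  len_pos : ∀ i, 0 < len i
  contDiff : ∀ i, ContDiff ℝ 1 (curve i)
  unit_speed : ∀ i, ∀ t ∈ Icc 0 (len i), ‖deriv (curve i) t‖ = 1
  injOn : ∀ i, InjOn (curve i) (Ico 0 (len i))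
  mem_closure : ∀ i, ∀ t ∈ Icc 0 (len i), curve i t ∈ closure Ω
  finite_inter : ∀ i j, i ≠ j →
    (curve i '' Icc 0 (len i) ∩ curve j '' Icc 0 (len j)).Finite

variable {Ω : Set Plane}

/-- The point set `Γ`, the union of the curves. -/
def Interfaces.carrier (Γ : Interfaces Ω) : Set Plane :=
  ⋃ i, Γ.curve i '' Icc 0 (Γ.len i)

/-- Arc length measure on `Γ`. -/
def Interfaces.length (Γ : Interfaces Ω) : Measure Plane :=
  ∑ i, (volume.restrict (Icc 0 (Γ.len i))).map (Γ.curve i)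

/-- Lebesgue measure on `Ω`. -/
def bulk (Ω : Set Plane) : Measure Plane := volume.restrict Ω

/-- The closed triangle with the given vertices. -/
def hull (s : Finset Plane) : Set Plane := convexHull ℝ (s : Set Plane)

/-- A conforming triangulation of `Ω` by closed nondegenerate triangles, each one given by the set
of its three vertices; two triangles meet exactly in the convex hull of their common vertices. -/
structure Triangulation (Ω : Set Plane) where
  tri : Finset (Finset Plane)
  card_eq : ∀ s ∈ tri, s.card = 3
  indep : ∀ s ∈ tri, AffineIndependent ℝ ((↑) : s → Plane)
  conforming : ∀ s ∈ tri, ∀ t ∈ tri,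
    hull s ∩ hull t = convexHull ℝ ((s : Set Plane) ∩ (t : Set Plane))
  cover : ⋃ s ∈ tri, hull s = closure Ω

/-- The mesh size `H`, the largest diameter of an element. -/
def Triangulation.meshSize (𝒯 : Triangulation Ω) : ℝ :=
  sSup ((fun s => Metric.diam (hull s)) '' (𝒯.tri : Set (Finset Plane)))

/-- The diameter of the inscribed circle of a triangle. -/
def inDiam (s : Finset Plane) : ℝ :=
  sSup {d : ℝ | 0 ≤ d ∧ ∃ x, Metric.closedBall x (d / 2) ⊆ hull s}

/-- Shape regularity and quasi uniformity with constant `γ`. -/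
def Triangulation.IsRegular (𝒯 : Triangulation Ω) (γ : ℝ) : Prop :=
  (∀ s ∈ 𝒯.tri, 𝒯.meshSize / inDiam s ≤ γ) ∧
  (∀ s ∈ 𝒯.tri, ∀ t ∈ 𝒯.tri, inDiam t / inDiam s ≤ γ)

/-- The union of all elements that intersect `S`. -/
def Triangulation.nbhd (𝒯 : Triangulation Ω) (S : Set Plane) : Set Plane :=
  ⋃ s ∈ {s | s ∈ 𝒯.tri ∧ (hull s ∩ S).Nonempty}, hull s

/-- The patch `U^k(T)`. -/
def Triangulation.patch (𝒯 : Triangulation Ω) (k : ℕ) (s : Finset Plane) : Set Plane :=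
  𝒯.nbhd^[k] (hull s)

/-- A distribution of `Γ` among the elements: disjoint Borel sets `P T ⊆ Γ ∩ T` with union `Γ`.
If `Γ` meets the element boundaries in a null set only, then `P T` is `Γ ∩ T` up to a null set; a
part of `Γ` that runs along a common edge of two elements is attributed to only one of them. -/
structure IsDistribution (Γ : Interfaces Ω) (𝒯 : Triangulation Ω)
    (P : Finset Plane → Set Plane) : Prop where
  measurable : ∀ s ∈ 𝒯.tri, MeasurableSet (P s)
  subset : ∀ s ∈ 𝒯.tri, P s ⊆ Γ.carrier ∩ hull s
  disjoint : ∀ s ∈ 𝒯.tri, ∀ t ∈ 𝒯.tri, s ≠ t → Disjoint (P s) (P t)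
  cover : ⋃ s ∈ 𝒯.tri, P s = Γ.carrier

/-! ### The energy space -/

/-- `v ∈ H¹₀(Ω)` has the weak gradient `G` and the trace `g` on `Γ`: in the respective `L²` norms,
`v`, `G`, `g` are the limits of `φₙ`, `∇φₙ` and `φₙ` on `Γ` for smooth functions `φₙ` with compact
support in `Ω`. -/
def HasGradientAndTrace (Γ : Interfaces Ω) (v : Plane → ℝ) (G : Plane → Plane)
    (g : Plane → ℝ) : Prop :=
  ∃ φ : ℕ → Plane → ℝ,
    (∀ n, ContDiff ℝ ∞ (φ n) ∧ HasCompactSupport (φ n) ∧ tsupport (φ n) ⊆ Ω) ∧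
    Tendsto (fun n => eLpNorm (fun x => φ n x - v x) 2 (bulk Ω)) atTop (𝓝 0) ∧
    Tendsto (fun n => eLpNorm (fun x => gradient (φ n) x - G x) 2 (bulk Ω)) atTop (𝓝 0) ∧
    Tendsto (fun n => eLpNorm (fun x => φ n x - g x) 2 Γ.length) atTop (𝓝 0)

/-- `g` agrees almost everywhere on `Γ` with a function that is continuous on `Γ` and absolutely
continuous along each curve, and `D` is its tangential gradient (a tangential vector field). -/
def HasTangentialGradient (Γ : Interfaces Ω) (g : Plane → ℝ) (D : Plane → Plane) : Prop :=
  ∃ h : Plane → ℝ, ContinuousOn h Γ.carrier ∧ g =ᵐ[Γ.length] h ∧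
    ∀ i,
      (∀ t ∈ Icc 0 (Γ.len i), h (Γ.curve i t) =
        h (Γ.curve i 0) + ∫ s in (0 : ℝ)..t, inner ℝ (D (Γ.curve i s)) (deriv (Γ.curve i) s)) ∧
      ∀ᵐ s ∂(volume.restrict (Icc 0 (Γ.len i))), D (Γ.curve i s) =
        (inner ℝ (D (Γ.curve i s)) (deriv (Γ.curve i) s) : ℝ) • deriv (Γ.curve i) s

/-- `L²(Ω) × L²(Ω)² × L²(Γ) × L²(Γ)²`. -/
abbrev Ambient (Γ : Interfaces Ω) : Type :=
  Lp ℝ 2 (bulk Ω) × Lp Plane 2 (bulk Ω) × Lp ℝ 2 Γ.length × Lp Plane 2 Γ.length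

theorem HasGradientAndTrace.add {Γ : Interfaces Ω} {v w : Lp ℝ 2 (bulk Ω)}
    {G K : Lp Plane 2 (bulk Ω)} {g k : Lp ℝ 2 Γ.length}
    (h₁ : HasGradientAndTrace Γ v G g) (h₂ : HasGradientAndTrace Γ w K k) :
    HasGradientAndTrace Γ ⇑(v + w) ⇑(G + K) ⇑(g + k) := by
  obtain ⟨φ, hφ, a₁, a₂, a₃⟩ := h₁
  obtain ⟨ψ, hψ, b₁, b₂, b₃⟩ := h₂
  have key : ∀ {F : Type} [NormedAddCommGroup F] {μ : Measure Plane}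
      (p q r : ℕ → Plane → F) (x y : Lp F 2 μ),
      (∀ n, Continuous (p n)) → (∀ n, Continuous (q n)) → (∀ n, r n = p n + q n) →
      (∀ n, AEStronglyMeasurable (p n) μ) → (∀ n, AEStronglyMeasurable (q n) μ) →
      Tendsto (fun n => eLpNorm (fun z => p n z - x z) 2 μ) atTop (𝓝 0) →
      Tendsto (fun n => eLpNorm (fun z => q n z - y z) 2 μ) atTop (𝓝 0) →
      Tendsto (fun n => eLpNorm (fun z => r n z - (x + y : Lp F 2 μ) z) 2 μ) atTop (𝓝 0) := by
    intro F _ μ p q r x y hp hq hr mp mq hx hy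
    refine tendsto_of_tendsto_of_tendsto_of_le_of_le tendsto_const_nhds
      (by simpa using hx.add hy) (fun n => zero_le) (fun n => ?_)
    have e : (fun z => r n z - (x + y : Lp F 2 μ) z) =ᵐ[μ]
        (fun z => p n z - x z) + (fun z => q n z - y z) := by
      filter_upwards [Lp.coeFn_add x y] with z hz
      simp only [hz, hr, Pi.add_apply]
      abel
    rw [eLpNorm_congr_ae e]
    exact eLpNorm_add_le ((mp n).sub (Lp.aestronglyMeasurable x))
      ((mq n).sub (Lp.aestronglyMeasurable y)) (by norm_num)
  have cg : ∀ f : Plane → ℝ, ContDiff ℝ ∞ f → Continuous (gradient f) := fun f hf =>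
    (InnerProductSpace.toDual ℝ Plane).symm.continuous.comp (hf.continuous_fderiv (by simp))
  have cφ := fun n => (hφ n).1.continuous
  have cψ := fun n => (hψ n).1.continuous
  have gφ := fun n => cg _ (hφ n).1
  have gψ := fun n => cg _ (hψ n).1
  refine ⟨fun n => φ n + ψ n, fun n => ⟨(hφ n).1.add (hψ n).1, (hφ n).2.1.add (hψ n).2.1,
    (tsupport_add _ _).trans (union_subset (hφ n).2.2 (hψ n).2.2)⟩, ?_, ?_, ?_⟩
  · exact key φ ψ _ v w cφ cψ (fun _ => rfl) (fun n => (cφ n).aestronglyMeasurable)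
      (fun n => (cψ n).aestronglyMeasurable) a₁ b₁
  · refine key _ _ _ G K gφ gψ (fun n => ?_) (fun n => (gφ n).aestronglyMeasurable)
      (fun n => (gψ n).aestronglyMeasurable) a₂ b₂
    funext z
    simp only [gradient, Pi.add_apply]
    rw [fderiv_add ((hφ n).1.differentiable (by simp) z) ((hψ n).1.differentiable (by simp) z),
      map_add]
  · exact key φ ψ _ g k cφ cψ (fun _ => rfl) (fun n => (cφ n).aestronglyMeasurable)
      (fun n => (cψ n).aestronglyMeasurable) a₃ b₃

theorem HasGradientAndTrace.smul {Γ : Interfaces Ω} (c : ℝ) {v : Lp ℝ 2 (bulk Ω)}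
    {G : Lp Plane 2 (bulk Ω)} {g : Lp ℝ 2 Γ.length} (h : HasGradientAndTrace Γ v G g) :
    HasGradientAndTrace Γ ⇑(c • v) ⇑(c • G) ⇑(c • g) := by
  obtain ⟨φ, hφ, a₁, a₂, a₃⟩ := h
  have key : ∀ {F : Type} [NormedAddCommGroup F] [NormedSpace ℝ F] {μ : Measure Plane}
      (p r : ℕ → Plane → F) (x : Lp F 2 μ), (∀ n, r n = c • p n) →
      Tendsto (fun n => eLpNorm (fun z => p n z - x z) 2 μ) atTop (𝓝 0) →
      Tendsto (fun n => eLpNorm (fun z => r n z - (c • x : Lp F 2 μ) z) 2 μ) atTop (𝓝 0) := by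
    intro F _ _ μ p r x hr hx
    have e : ∀ n, eLpNorm (fun z => r n z - (c • x : Lp F 2 μ) z) 2 μ =
        ‖c‖ₑ * eLpNorm (fun z => p n z - x z) 2 μ := by
      intro n
      rw [← eLpNorm_const_smul]
      refine eLpNorm_congr_ae ?_
      filter_upwards [Lp.coeFn_smul c x] with z hz
      simp only [hz, hr, Pi.smul_apply, smul_sub]
    simp only [e]
    simpa using ENNReal.Tendsto.const_mul hx (Or.inr enorm_ne_top)
  refine ⟨fun n => c • φ n, fun n => ⟨contDiff_const.smul (hφ n).1, ?_, ?_⟩, ?_, ?_, ?_⟩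
  · exact (hφ n).2.1.smul_left (f := fun _ => c)
  · exact (closure_mono (Function.support_const_smul_subset c (φ n))).trans (hφ n).2.2
  · exact key φ _ v (fun _ => rfl) a₁
  · refine key _ _ G (fun n => ?_) a₂
    funext z
    simp only [gradient, Pi.smul_apply]
    rw [fderiv_const_smul ((hφ n).1.differentiable (by simp) z), map_smulₛₗ]
    simp
  · exact key φ _ g (fun _ => rfl) a₃

theorem Interfaces.map_le_length (Γ : Interfaces Ω) (i : Fin Γ.num) :
    (volume.restrict (Icc 0 (Γ.len i))).map (Γ.curve i) ≤ Γ.length :=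
  Finset.single_le_sum
    (f := fun i => (volume.restrict (Icc 0 (Γ.len i))).map (Γ.curve i))
    (fun _ _ => Measure.zero_le _) (Finset.mem_univ i)

theorem Interfaces.ae_curve (Γ : Interfaces Ω) (i : Fin Γ.num) {p : Plane → Prop}
    (h : ∀ᵐ x ∂Γ.length, p x) :
    ∀ᵐ s ∂(volume.restrict (Icc 0 (Γ.len i))), p (Γ.curve i s) :=
  ae_of_ae_map (Γ.contDiff i).continuous.aemeasurable
    (Measure.absolutelyContinuous_of_le (Γ.map_le_length i) h)

theorem Interfaces.integrable_inner (Γ : Interfaces Ω) (i : Fin Γ.num) (D : Lp Plane 2 Γ.length) :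
    IntegrableOn (fun s => (inner ℝ (D (Γ.curve i s)) (deriv (Γ.curve i) s) : ℝ))
      (Icc 0 (Γ.len i)) volume := by
  have h₁ : MemLp (fun s => D (Γ.curve i s)) 2 (volume.restrict (Icc 0 (Γ.len i))) :=
    ((Lp.memLp D).mono_measure (Γ.map_le_length i)).comp_of_map
      (Γ.contDiff i).continuous.aemeasurable
  have h₂ : Integrable (fun s => D (Γ.curve i s)) (volume.restrict (Icc 0 (Γ.len i))) :=
    h₁.integrable (by norm_num)
  refine h₂.norm.mono' ?_ ?_
  · exact h₁.aestronglyMeasurable.inner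
      ((Γ.contDiff i).continuous_deriv le_rfl).aestronglyMeasurable
  · filter_upwards [ae_restrict_mem measurableSet_Icc] with s hs
    calc ‖(inner ℝ (D (Γ.curve i s)) (deriv (Γ.curve i) s) : ℝ)‖
        ≤ ‖D (Γ.curve i s)‖ * ‖deriv (Γ.curve i) s‖ := norm_inner_le_norm _ _
      _ = ‖D (Γ.curve i s)‖ := by rw [Γ.unit_speed i s hs, mul_one]

theorem HasTangentialGradient.add {Γ : Interfaces Ω} {g k : Lp ℝ 2 Γ.length}
    {D B : Lp Plane 2 Γ.length} (h₁ : HasTangentialGradient Γ g D)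
    (h₂ : HasTangentialGradient Γ k B) : HasTangentialGradient Γ ⇑(g + k) ⇑(D + B) := by
  obtain ⟨p, pc, pe, hp⟩ := h₁
  obtain ⟨q, qc, qe, hq⟩ := h₂
  refine ⟨p + q, pc.add qc, ?_, fun i => ⟨fun t ht => ?_, ?_⟩⟩
  · filter_upwards [pe, qe, Lp.coeFn_add g k] with z h₁ h₂ h₃
    rw [h₃, Pi.add_apply, Pi.add_apply, h₁, h₂]
  · have ii : ∀ D : Lp Plane 2 Γ.length, IntervalIntegrable
        (fun s => (inner ℝ (D (Γ.curve i s)) (deriv (Γ.curve i) s) : ℝ)) volume 0 t := fun D =>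
      (intervalIntegrable_iff_integrableOn_Icc_of_le ht.1).2
        ((Γ.integrable_inner i D).mono_set (Icc_subset_Icc_right ht.2))
    have e : ∫ s in (0 : ℝ)..t, (inner ℝ ((D + B : Lp Plane 2 Γ.length) (Γ.curve i s))
        (deriv (Γ.curve i) s) : ℝ) =
        ∫ s in (0 : ℝ)..t, ((inner ℝ (D (Γ.curve i s)) (deriv (Γ.curve i) s) : ℝ) +
          (inner ℝ (B (Γ.curve i s)) (deriv (Γ.curve i) s) : ℝ)) := by
      refine intervalIntegral.integral_congr_ae ?_
      have := (ae_restrict_iff' measurableSet_Icc).1 (Γ.ae_curve i (Lp.coeFn_add D B))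
      filter_upwards [this] with s hs hst
      rw [uIoc_of_le ht.1] at hst
      rw [hs ⟨hst.1.le, hst.2.trans ht.2⟩, Pi.add_apply, inner_add_left]
    rw [e, intervalIntegral.integral_add (ii D) (ii B)]
    simp only [Pi.add_apply, (hp i).1 t ht, (hq i).1 t ht]
    ring
  · filter_upwards [(hp i).2, (hq i).2, Γ.ae_curve i (Lp.coeFn_add D B)] with s h₁ h₂ h₃
    rw [h₃, Pi.add_apply, inner_add_left, add_smul, ← h₁, ← h₂]

theorem HasTangentialGradient.smul {Γ : Interfaces Ω} (c : ℝ) {g : Lp ℝ 2 Γ.length}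
    {D : Lp Plane 2 Γ.length} (h₁ : HasTangentialGradient Γ g D) :
    HasTangentialGradient Γ ⇑(c • g) ⇑(c • D) := by
  obtain ⟨p, pc, pe, hp⟩ := h₁
  refine ⟨c • p, pc.const_smul c, ?_, fun i => ⟨fun t ht => ?_, ?_⟩⟩
  · filter_upwards [pe, Lp.coeFn_smul c g] with z h₁ h₃
    simp [h₁, h₃]
  · have e : ∫ s in (0 : ℝ)..t, (inner ℝ ((c • D : Lp Plane 2 Γ.length) (Γ.curve i s))
        (deriv (Γ.curve i) s) : ℝ) =
        ∫ s in (0 : ℝ)..t, c * (inner ℝ (D (Γ.curve i s)) (deriv (Γ.curve i) s) : ℝ) := by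
      refine intervalIntegral.integral_congr_ae ?_
      have := (ae_restrict_iff' measurableSet_Icc).1 (Γ.ae_curve i (Lp.coeFn_smul c D))
      filter_upwards [this] with s hs hst
      rw [uIoc_of_le ht.1] at hst
      rw [hs ⟨hst.1.le, hst.2.trans ht.2⟩, Pi.smul_apply, real_inner_smul_left]
    rw [e, intervalIntegral.integral_const_mul]
    simp only [Pi.smul_apply, (hp i).1 t ht, smul_eq_mul]
    ring
  · filter_upwards [(hp i).2, Γ.ae_curve i (Lp.coeFn_smul c D)] with s h₁ h₃
    rw [h₃, Pi.smul_apply, real_inner_smul_left, mul_smul, ← h₁]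

/-- The space `V` of the functions in `H¹₀(Ω)` whose trace on `Γ` is continuous on `Γ` and `H¹`
along each curve.  A function `v` is recorded together with its gradient, its trace on `Γ` and the
tangential gradient of the trace, all of which it determines. -/
def energySpace (Γ : Interfaces Ω) : Submodule ℝ (Ambient Γ) where
  carrier := {w | HasGradientAndTrace Γ w.1 w.2.1 w.2.2.1 ∧
    HasTangentialGradient Γ w.2.2.1 w.2.2.2}
  add_mem' := fun h₁ h₂ => ⟨h₁.1.add h₂.1, h₁.2.add h₂.2⟩
  zero_mem' := by
    have z : ∀ {F : Type} [NormedAddCommGroup F] {μ : Measure Plane},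
        eLpNorm (fun x => (0 : F) - (0 : Lp F 2 μ) x) 2 μ = 0 := by
      intro F _ μ
      rw [← eLpNorm_zero (ε := F) (α := Plane) (p := 2) (μ := μ)]
      refine eLpNorm_congr_ae ?_
      filter_upwards [Lp.coeFn_zero F 2 μ] with x hx
      rw [hx]
      simp
    refine ⟨⟨fun _ => 0, fun _ => ⟨contDiff_const, HasCompactSupport.zero, by simp⟩,
      ?_, ?_, ?_⟩, ?_⟩
    · exact tendsto_const_nhds.congr (fun _ => z.symm)
    · have : gradient (0 : Plane → ℝ) = fun _ => 0 := by
        funext x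
        simp [gradient]
      refine tendsto_const_nhds.congr (fun _ => ?_)
      rw [this]
      exact z.symm
    · exact tendsto_const_nhds.congr (fun _ => z.symm)
    · have h := Lp.coeFn_zero Plane 2 Γ.length
      refine ⟨0, continuousOn_const, Lp.coeFn_zero _ _ _, fun i => ⟨fun t ht => ?_, ?_⟩⟩
      · simp only [Pi.zero_apply, zero_add]
        symm
        refine intervalIntegral.integral_zero_ae ?_
        filter_upwards [(ae_restrict_iff' measurableSet_Icc).1 (Γ.ae_curve i h)] with s hs hst
        rw [uIoc_of_le ht.1] at hst
        have := hs ⟨hst.1.le, hst.2.trans ht.2⟩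
        simp only [Pi.zero_apply] at this
        change (inner ℝ ((0 : Lp Plane 2 Γ.length) (Γ.curve i s)) _ : ℝ) = 0
        rw [this, inner_zero_left]
      · filter_upwards [Γ.ae_curve i h] with s hs
        simp only [Pi.zero_apply] at hs
        change ((0 : Lp Plane 2 Γ.length) (Γ.curve i s)) =
          (inner ℝ ((0 : Lp Plane 2 Γ.length) (Γ.curve i s)) _ : ℝ) • _
        rw [hs, inner_zero_left, zero_smul]
  smul_mem' := fun c _ h => ⟨h.1.smul c, h.2.smul c⟩

variable {Γ : Interfaces Ω}

/-- `v` as a function on `Ω`. -/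
def val (v : energySpace Γ) : Lp ℝ 2 (bulk Ω) := v.1.1

/-- The gradient `∇v` on `Ω`. -/
def grad (v : energySpace Γ) : Lp Plane 2 (bulk Ω) := v.1.2.1

/-- The trace of `v` on `Γ`. -/
def trace (v : energySpace Γ) : Lp ℝ 2 Γ.length := v.1.2.2.1

/-- The tangential gradient of `v` on `Γ`. -/
def tgrad (v : energySpace Γ) : Lp Plane 2 Γ.length := v.1.2.2.2

/-- The `L²` norm of `F` over the set `S`, with respect to `μ`. -/
def l2norm {F : Type*} [NormedAddCommGroup F] (μ : Measure Plane) (S : Set Plane)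
    (f : Plane → F) : ℝ :=
  Real.sqrt (∫ x in S, ‖f x‖ ^ 2 ∂μ)

/-! ### The variational problem -/

/-- The coefficients `A` on `Ω` and `B` on `Γ` are measurable with values in `[α, β]`
almost everywhere. -/
structure IsPermeability (Γ : Interfaces Ω) (A B : Plane → ℝ) (α β : ℝ) : Prop where
  bulk_measurable : AEStronglyMeasurable A (bulk Ω)
  interface_measurable : AEStronglyMeasurable B Γ.length
  bulk_bounds : ∀ᵐ x ∂(bulk Ω), α ≤ A x ∧ A x ≤ β
  interface_bounds : ∀ᵐ x ∂Γ.length, α ≤ B x ∧ B x ≤ β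

/-- `∫_S A ∇v · ∇w + ∫_(Γ ∩ S') B ∇_τ v · ∇_τ w`. -/
def formOn (A B : Plane → ℝ) (S S' : Set Plane) (v w : energySpace Γ) : ℝ :=
  (∫ x in S, A x * inner ℝ (grad v x) (grad w x) ∂(bulk Ω)) +
    ∫ x in S', B x * inner ℝ (tgrad v x) (tgrad w x) ∂Γ.length

/-- The bilinear form `a`. -/
def form (A B : Plane → ℝ) (v w : energySpace Γ) : ℝ := formOn A B univ univ v w

/-- The energy norm. -/
def energyNorm (A B : Plane → ℝ) (v : energySpace Γ) : ℝ := Real.sqrt (form A B v v)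

/-- The right-hand side `F`. -/
def load (f : Lp ℝ 2 (bulk Ω)) (fΓ : Lp ℝ 2 Γ.length) (v : energySpace Γ) : ℝ :=
  (∫ x, f x * val v x ∂(bulk Ω)) + ∫ x, fΓ x * trace v x ∂Γ.length

/-- `u ∈ V` solves the weak form of the problem. -/
def IsWeakSolution (A B : Plane → ℝ) (f : Lp ℝ 2 (bulk Ω)) (fΓ : Lp ℝ 2 Γ.length)
    (u : energySpace Γ) : Prop :=
  ∀ v : energySpace Γ, form A B u v = load f fΓ v

/-! ### The coarse space and the interpolation operator -/

/-- Functions that are continuous on the closure of `Ω`, affine on each element, and zero on the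
boundary of `Ω`. -/
def IsPiecewiseAffine (𝒯 : Triangulation Ω) (p : Plane → ℝ) : Prop :=
  ContinuousOn p (closure Ω) ∧ (∀ x ∈ frontier Ω, p x = 0) ∧
    ∀ s ∈ 𝒯.tri, ∃ (b : Plane) (c : ℝ), ∀ x ∈ hull s, p x = inner ℝ b x + c

/-- The coarse finite element space `V_H`, as a subspace of `V`. -/
def coarseSpace (Γ : Interfaces Ω) (𝒯 : Triangulation Ω) : Submodule ℝ (energySpace Γ) where
  carrier := {v | ∃ p, IsPiecewiseAffine 𝒯 p ∧ val v =ᵐ[bulk Ω] p}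
  add_mem' := by
    rintro v w ⟨p, ⟨p₁, p₂, p₃⟩, hp⟩ ⟨q, ⟨q₁, q₂, q₃⟩, hq⟩
    refine ⟨p + q, ⟨p₁.add q₁, fun x hx => by simp [p₂ x hx, q₂ x hx], fun s hs => ?_⟩, ?_⟩
    · obtain ⟨b, c, h⟩ := p₃ s hs
      obtain ⟨b', c', h'⟩ := q₃ s hs
      refine ⟨b + b', c + c', fun x hx => ?_⟩
      rw [Pi.add_apply, h x hx, h' x hx, inner_add_left]
      ring
    · exact (Lp.coeFn_add (val v) (val w)).trans (hp.add hq)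
  zero_mem' := ⟨0, ⟨continuousOn_const, fun _ _ => rfl, fun s _ => ⟨0, 0, by simp⟩⟩,
    Lp.coeFn_zero _ _ _⟩
  smul_mem' := by
    rintro a v ⟨p, ⟨p₁, p₂, p₃⟩, hp⟩
    refine ⟨a • p, ⟨p₁.const_smul a, fun x hx => by simp [p₂ x hx], fun s hs => ?_⟩, ?_⟩
    · obtain ⟨b, c, h⟩ := p₃ s hs
      refine ⟨a • b, a * c, fun x hx => ?_⟩
      rw [Pi.smul_apply, h x hx, real_inner_smul_left, smul_eq_mul]
      ring
    · exact (Lp.coeFn_smul a (val v)).trans (hp.const_smul a)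

/-- The linear operator `I : V → V_H` is idempotent and satisfies, on each element, the
interpolation error bound and the `H¹` stability bound with constant `C`. -/
structure IsInterpolation (𝒯 : Triangulation Ω) (C : ℝ)
    (I : energySpace Γ →ₗ[ℝ] coarseSpace Γ 𝒯) : Prop where
  idempotent : ∀ v, I (I v) = I v
  error_bound : ∀ v : energySpace Γ, ∀ s ∈ 𝒯.tri,
    l2norm (bulk Ω) (hull s) (val (v - (I v : energySpace Γ))) + l2norm Γ.length (hull s) (trace (v - (I v : energySpace Γ))) ≤
      C * 𝒯.meshSize * (l2norm (bulk Ω) (𝒯.nbhd (hull s)) (grad v) +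
        l2norm Γ.length (𝒯.nbhd (hull s)) (tgrad v))
  stability : ∀ v : energySpace Γ, ∀ s ∈ 𝒯.tri,
    l2norm (bulk Ω) (hull s) (grad (I v : energySpace Γ)) +
      l2norm Γ.length (hull s) (tgrad (I v : energySpace Γ)) ≤
      C * (l2norm (bulk Ω) (𝒯.nbhd (hull s)) (grad v) +
        l2norm Γ.length (𝒯.nbhd (hull s)) (tgrad v))

/-! ### The localized multiscale method -/

variable {𝒯 : Triangulation Ω}

/-- `v` is in the kernel of `I` and supported in `S`. -/
def IsFine (I : energySpace Γ →ₗ[ℝ] coarseSpace Γ 𝒯) (S : Set Plane) (v : energySpace Γ) : Prop :=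
  I v = 0 ∧ (∀ᵐ x ∂(bulk Ω), x ∉ S → val v x = 0) ∧ ∀ᵐ x ∂Γ.length, x ∉ S → trace v x = 0

/-- `φ` is the localized corrector of `v` for the element `T` and the patch size `k`. -/
def IsCorrector (A B : Plane → ℝ) (P : Finset Plane → Set Plane)
    (I : energySpace Γ →ₗ[ℝ] coarseSpace Γ 𝒯) (k : ℕ) (v : energySpace Γ) (T : Finset Plane)
    (φ : energySpace Γ) : Prop :=
  IsFine I (𝒯.patch k T) φ ∧ ∀ w, IsFine I (𝒯.patch k T) w →
    formOn A B (𝒯.patch k T) (𝒯.patch k T) φ w = formOn A B (hull T) (P T) v w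

/-- The localized multiscale space, consisting of the functions `Q_k v - v` with `v ∈ V_H`, where
`Q_k v` is the sum of the localized correctors of `v`. -/
def multiscaleSpace (A B : Plane → ℝ) (P : Finset Plane → Set Plane)
    (I : energySpace Γ →ₗ[ℝ] coarseSpace Γ 𝒯) (k : ℕ) : Set (energySpace Γ) :=
  {z | ∃ v ∈ coarseSpace Γ 𝒯, ∃ φ : Finset Plane → energySpace Γ,
    (∀ T ∈ 𝒯.tri, IsCorrector A B P I k v T (φ T)) ∧ z = ∑ T ∈ 𝒯.tri, φ T - v}

/-- `z` is the Galerkin solution in the localized multiscale space. -/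
def IsMultiscaleSolution (A B : Plane → ℝ) (P : Finset Plane → Set Plane)
    (I : energySpace Γ →ₗ[ℝ] coarseSpace Γ 𝒯) (k : ℕ) (f : Lp ℝ 2 (bulk Ω))
    (fΓ : Lp ℝ 2 Γ.length) (z : energySpace Γ) : Prop :=
  z ∈ multiscaleSpace A B P I k ∧
    ∀ w ∈ multiscaleSpace A B P I k, form A B z w = load f fΓ w

end LOD

end

/-!
The space of the functions that the interpolation `I` maps to zero contains everything the coarse
space does not see.  If the energy product of `V` is split into the kernel of `I` and its
orthogonal complement, then the complement consists of the functions `v - Q v`, where `Q v` is the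
sum over the elements of the correctors of `v` on the whole kernel, and the Galerkin error in the
complement lies in the kernel; testing the equation with it, the interpolation error bound yields
the order of the mesh size (`MeshData.ideal_error_le`).  Replacing the correctors by localized ones
perturbs the method by an amount that decays exponentially in the number of layers of the patches
(`LocalSetting.sum_localization_error`), and Galerkin solutions are quasi-optimal, so that the two
errors add up (`MeshData.energy_error_le`).

The decay has an algebraic proof, in which the mesh only appears as a graph.  An element of the
kernel of `I` is multiplied by a piecewise affine cut-off function that vanishes near `T`; the
interpolation of the product is subtracted in order to return to the kernel, and the result tests
the corrector equation.  It follows that the energy outside a ball of elements is bounded by a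
multiple of the energy in a ring around it, so that it decreases by a fixed factor whenever the
ball grows by a fixed number of layers.  The number of elements in a ball grows quadratically only,
since the elements are comparable in size; the square root of this number is absorbed by the
exponential.  The gradient of the cut-off function is of the order of the inverse mesh size and the
function itself, being its own interpolation error, is of the order of the mesh size times its
gradient, which is why no constant depends on the mesh.  `LocalSetting` collects what this argument
needs, and `MeshData.localSetting` shows that the mesh and the interpolation provide it.

Three analytic facts about the energy space are involved.  It is complete, since `L²` limits of
traces that are absolutely continuous along the curves are so again (`isClosed_energySpace`), and
the gradient controls the function and its trace (`exists_poincare`).  A function that vanishes on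
an open set has vanishing gradients there (`ae_grad_eq_zero`, `ae_tgrad_eq_zero`), so that a
corrector supported in a patch has no energy outside.  Finally the space is closed under
multiplication by functions that are Lipschitz in the inner metric of the domain, with the expected
product rules (`HasGradientAndTrace.mul`, `HasTangentialGradient.mul`).
-/

/-! ### Riesz representation for forms that are complete in their energy norm -/

namespace LOD

/-- A submodule is complete for the energy of a bilinear form if every sequence in it that is
Cauchy in energy converges in energy to one of its elements. -/
def EnergyComplete {V : Type*} [AddCommGroup V] [Module ℝ V] (A : V →ₗ[ℝ] V →ₗ[ℝ] ℝ)
    (W : Submodule ℝ V) : Prop :=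
  ∀ u : ℕ → V, (∀ n, u n ∈ W) →
    (∀ ε > 0, ∃ N, ∀ m ≥ N, ∀ n ≥ N, A (u m - u n) (u m - u n) < ε) →
    ∃ x ∈ W, Tendsto (fun n => A (u n - x) (u n - x)) atTop (𝓝 0)

theorem exists_riesz {V : Type*} [AddCommGroup V] [Module ℝ V] (A : V →ₗ[ℝ] V →ₗ[ℝ] ℝ)
    (W : Submodule ℝ V) (symm : ∀ v w, A v w = A w v) (nonneg : ∀ v, 0 ≤ A v v)
    (definite : ∀ v ∈ W, A v v = 0 → v = 0) (complete : EnergyComplete A W)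
    (L : V →ₗ[ℝ] ℝ) (c : ℝ) (hL : ∀ w ∈ W, |L w| ≤ c * √(A w w)) :
    ∃ u ∈ W, ∀ w ∈ W, A u w = L w := by
  let core : InnerProductSpace.Core ℝ W :=
    { inner := fun v w => A v w
      conj_inner_symm := fun v w => by simp [symm]
      re_inner_nonneg := fun v => by simpa using nonneg v
      add_left := fun u v w => by simp
      smul_left := fun u v r => by simp
      definite := fun v hv => Subtype.ext (definite v v.2 hv) }
  let _ := core.toNormedAddCommGroup
  let _ : InnerProductSpace ℝ W := InnerProductSpace.ofCore core.toCore
  have hn : ∀ v : W, ‖v‖ = √(A v v) := fun v => by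
    rw [@norm_eq_sqrt_real_inner]; rfl
  have hsq : ∀ v : W, A v v = ‖v‖ ^ 2 := fun v => by
    rw [hn, Real.sq_sqrt (nonneg _)]
  have : CompleteSpace W := by
    refine Metric.complete_of_cauchySeq_tendsto fun u hu => ?_
    rw [Metric.cauchySeq_iff] at hu
    obtain ⟨x, hx, hlim⟩ := complete (fun n => u n) (fun n => (u n).2) (fun ε hε => by
      obtain ⟨N, hN⟩ := hu (√ε) (Real.sqrt_pos.2 hε)
      refine ⟨N, fun m hm n hn' => ?_⟩
      have := hN m hm n hn'
      rw [dist_eq_norm] at this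
      have h2 := hsq (u m - u n)
      simp only [Submodule.coe_sub] at h2
      rw [h2]
      calc ‖u m - u n‖ ^ 2 < √ε ^ 2 := by gcongr
        _ = ε := Real.sq_sqrt hε.le)
    refine ⟨⟨x, hx⟩, ?_⟩
    rw [tendsto_iff_norm_sub_tendsto_zero]
    have h3 : ∀ n, ‖u n - ⟨x, hx⟩‖ = √(A (u n - x) (u n - x)) := fun n => by
      rw [hn]; rfl
    simp only [h3]
    have h4 := (Real.continuous_sqrt.tendsto 0).comp hlim
    rw [Real.sqrt_zero] at h4
    exact h4
  let ℓ : StrongDual ℝ W := (L.comp W.subtype).mkContinuous c (fun w => by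
    simpa [hn] using hL w w.2)
  refine ⟨((InnerProductSpace.toDual ℝ W).symm ℓ : W), Subtype.mem _, fun w hw => ?_⟩
  have := InnerProductSpace.toDual_symm_apply (𝕜 := ℝ) (x := (⟨w, hw⟩ : W)) (y := ℓ)
  exact this

theorem abs_form_le {V : Type*} [AddCommGroup V] [Module ℝ V] (A : V →ₗ[ℝ] V →ₗ[ℝ] ℝ)
    (symm : ∀ v w, A v w = A w v) (nonneg : ∀ v, 0 ≤ A v v) (v w : V) :
    |A v w| ≤ √(A v v) * √(A w w) := by
  have h : A v w ^ 2 ≤ A v v * A w w := by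
    by_cases h0 : A w w = 0
    · have h1 : ∀ t : ℝ, 0 ≤ A v v + 2 * t * A v w := fun t => by
        have := nonneg (v + t • w)
        simp only [map_add, LinearMap.add_apply, map_smul, LinearMap.smul_apply, smul_eq_mul, h0,
          symm w v] at this
        linarith
      have : A v w = 0 := by
        by_contra hne
        have := h1 (-(A v v + 1) / (2 * A v w))
        field_simp at this
        linarith
      simp [this, h0]
    · have hp : 0 < A w w := lt_of_le_of_ne (nonneg w) (Ne.symm h0)
      have := nonneg (v - (A v w / A w w) • w)
      simp only [map_sub, LinearMap.sub_apply, map_smul, LinearMap.smul_apply, smul_eq_mul,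
        symm w v] at this
      field_simp at this
      nlinarith
  rw [← Real.sqrt_mul (nonneg v)]
  exact Real.abs_le_sqrt h

theorem form_sub_le {V : Type*} [AddCommGroup V] [Module ℝ V] (A : V →ₗ[ℝ] V →ₗ[ℝ] ℝ)
    (nonneg : ∀ v, 0 ≤ A v v) (v w : V) :
    A (v - w) (v - w) ≤ 2 * A v v + 2 * A w w := by
  have := nonneg (v + w)
  simp only [map_add, map_sub, LinearMap.add_apply, LinearMap.sub_apply] at *
  linarith

theorem abs_form_le_half {V : Type*} [AddCommGroup V] [Module ℝ V] (A : V →ₗ[ℝ] V →ₗ[ℝ] ℝ)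
    (symm : ∀ v w, A v w = A w v) (nonneg : ∀ v, 0 ≤ A v v) (v w : V) :
    |A v w| ≤ A v v + A w w := by
  have h1 := nonneg (v + w)
  have h2 := nonneg (v - w)
  have := nonneg v
  have := nonneg w
  simp only [map_add, map_sub, LinearMap.add_apply, LinearMap.sub_apply, symm w v] at *
  rw [abs_le]; constructor <;> linarith

/-- A Galerkin solution minimizes the energy distance over its trial space. -/
theorem galerkin_le {V : Type*} [AddCommGroup V] [Module ℝ V] (A : V →ₗ[ℝ] V →ₗ[ℝ] ℝ)
    (symm : ∀ v w, A v w = A w v) (nonneg : ∀ v, 0 ≤ A v v) (u x w : V)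
    (orth : A (u - x) (x - w) = 0) :
    A (u - x) (u - x) ≤ A (u - w) (u - w) := by
  have h : u - w = (u - x) + (x - w) := by abel
  have := nonneg (x - w)
  rw [h]
  generalize u - x = p at *
  generalize x - w = q at *
  simp only [map_add, LinearMap.add_apply, symm q p, orth]
  linarith

/-! ### Neighbourhoods in a finite graph -/

/-- The elements that can be reached from `t` in at most `n` steps along the relation `r`. -/
noncomputable def graphBall {ι : Type*} [Fintype ι] (r : ι → ι → Prop) : ℕ → ι → Finset ι
  | 0, t => {t}
  | n + 1, t => by
      classical exact Finset.univ.filter fun s => ∃ u ∈ graphBall r n t, r s u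

section graphBall

variable {ι : Type*} [Fintype ι] {r : ι → ι → Prop}

theorem mem_graphBall_succ {n : ℕ} {s t : ι} :
    s ∈ graphBall r (n + 1) t ↔ ∃ u ∈ graphBall r n t, r s u := by
  simp [graphBall]

theorem mem_graphBall_zero {s t : ι} : s ∈ graphBall r 0 t ↔ s = t := by
  simp [graphBall]

theorem graphBall_mono (refl : ∀ t, r t t) {m n : ℕ} (h : m ≤ n) {s t : ι}
    (hs : s ∈ graphBall r m t) : s ∈ graphBall r n t := by
  induction h with
  | refl => exact hs
  | step _ ih => exact mem_graphBall_succ.2 ⟨s, ih, refl s⟩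

theorem self_mem_graphBall (refl : ∀ t, r t t) (n : ℕ) (t : ι) : t ∈ graphBall r n t :=
  graphBall_mono refl (Nat.zero_le n) (mem_graphBall_zero.2 rfl)

theorem graphBall_trans {m n : ℕ} {s t u : ι} (hs : s ∈ graphBall r m t)
    (hu : u ∈ graphBall r n s) : u ∈ graphBall r (m + n) t := by
  induction n generalizing u with
  | zero => rw [mem_graphBall_zero] at hu; subst hu; exact hs
  | succ n ih =>
    obtain ⟨x, hx, hr⟩ := mem_graphBall_succ.1 hu
    exact mem_graphBall_succ.2 ⟨x, ih hx, hr⟩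

theorem mem_graphBall_one {s t : ι} : s ∈ graphBall r 1 t ↔ r s t := by
  rw [mem_graphBall_succ]; simp [mem_graphBall_zero]

theorem graphBall_symm (symm : ∀ s t, r s t → r t s) {n : ℕ} {s t : ι}
    (hs : s ∈ graphBall r n t) : t ∈ graphBall r n s := by
  induction n generalizing s with
  | zero => rw [mem_graphBall_zero] at *; exact hs.symm
  | succ n ih =>
    obtain ⟨x, hx, hr⟩ := mem_graphBall_succ.1 hs
    have := graphBall_trans (mem_graphBall_one.2 (symm _ _ hr)) (ih hx)
    rwa [add_comm] at this

/-- Summing over neighbourhoods of the members of a set counts no index more often than the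
neighbourhoods have members. -/
theorem sum_graphBall_le [DecidableEq ι] (symm : ∀ s t, r s t → r t s) (n : ℕ) (N : ℝ)
    (hN : ∀ t, ((graphBall r n t).card : ℝ) ≤ N) (S S' : Finset ι)
    (hS : ∀ t ∈ S, ∀ s ∈ graphBall r n t, s ∈ S') (f : ι → ℝ) (hf : ∀ t, 0 ≤ f t) :
    ∑ t ∈ S, ∑ s ∈ graphBall r n t, f s ≤ N * ∑ s ∈ S', f s := by
  have h1 : ∑ t ∈ S, ∑ s ∈ graphBall r n t, f s
      = ∑ s ∈ S', ∑ t ∈ S.filter (fun t => s ∈ graphBall r n t), f s := by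
    refine Finset.sum_comm' fun t s => ?_
    simp only [Finset.mem_filter]
    exact ⟨fun h => ⟨h, hS t h.1 s h.2⟩, fun h => h.1⟩
  rw [h1, Finset.mul_sum]
  refine Finset.sum_le_sum fun s _ => ?_
  rw [Finset.sum_const, nsmul_eq_mul]
  refine mul_le_mul_of_nonneg_right ((Nat.cast_le.2 (Finset.card_le_card ?_)).trans (hN s)) (hf s)
  intro t ht
  exact graphBall_symm symm (Finset.mem_filter.1 ht).2

attribute [irreducible] graphBall

end graphBall

end LOD

/-! ### Exponential decay of correctors in an abstract localized setting -/

namespace LOD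

open scoped Classical in
/-- What the localization argument uses of the mesh, the energy and the interpolation: a form that
is a finite sum of local forms `a t`, the subspaces `Z t` of the vectors that vanish on the element
`t`, an idempotent operator `I` which is local and stable up to two layers of elements, the
existence of cut-offs of elements of the kernel of `I`, and the subspaces `S k t` of those elements
of the kernel that are supported in the `k`-th patch around `t`.  The local forms are
attributed to disjoint parts of the domain, which is why support in the `k`-th patch gives
vanishing local energy only outside the `k + 1`-st one. -/
structure LocalSetting (V ι : Type*) [AddCommGroup V] [Module ℝ V] [Fintype ι] where
  r : ι → ι → Prop
  refl : ∀ t, r t t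
  symm : ∀ s t, r s t → r t s
  a : ι → V →ₗ[ℝ] V →ₗ[ℝ] ℝ
  a_symm : ∀ t v w, a t v w = a t w v
  a_nonneg : ∀ t v, 0 ≤ a t v v
  Z : ι → Submodule ℝ V
  a_eq_zero : ∀ t, ∀ v ∈ Z t, ∀ w, a t v w = 0
  I : V →ₗ[ℝ] V
  I_idem : ∀ v, I (I v) = I v
  K : ℝ
  K_nonneg : 0 ≤ K
  I_bound : ∀ v t, a t (I v) (I v) ≤ K * ∑ s ∈ graphBall r 2 t, a s v v
  I_local : ∀ v t, (∀ s ∈ graphBall r 2 t, v ∈ Z s) → I v ∈ Z t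
  cutoff : ∀ (F : Finset ι) (v : V), I v = 0 → ∃ w, (∀ t ∈ F, w ∈ Z t) ∧
    (∀ t, (∀ s ∈ F, ¬ r t s) → v - w ∈ Z t) ∧
    ∀ t, a t w w ≤ K * ∑ s ∈ graphBall r 2 t, a s v v
  S : ℕ → ι → Submodule ℝ V
  S_ker : ∀ k t, ∀ v ∈ S k t, I v = 0
  mem_S : ∀ k t v, I v = 0 → (∀ s ∉ graphBall r k t, v ∈ Z s) → v ∈ S k t
  S_far : ∀ k t, ∀ v ∈ S k t, ∀ s ∉ graphBall r (k + 1) t, ∀ w, a s v w = 0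
  M : ℝ
  card_le : ∀ n t, ((graphBall r n t).card : ℝ) ≤ M * (n + 2) ^ 2

namespace LocalSetting

variable {V ι : Type*} [AddCommGroup V] [Module ℝ V] [Fintype ι] (D : LocalSetting V ι)

/-- The sum of the local forms. -/
noncomputable def total : V →ₗ[ℝ] V →ₗ[ℝ] ℝ := ∑ t, D.a t

theorem total_apply (v w : V) : D.total v w = ∑ t, D.a t v w := by
  simp [total, LinearMap.sum_apply]

theorem total_symm (v w : V) : D.total v w = D.total w v := by
  simp only [total_apply]
  exact Finset.sum_congr rfl fun t _ => D.a_symm t v w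

theorem total_nonneg (v : V) : 0 ≤ D.total v v := by
  rw [total_apply]
  exact Finset.sum_nonneg fun t _ => D.a_nonneg t v

theorem a_eq_zero' {t : ι} {w : V} (hw : w ∈ D.Z t) (v : V) : D.a t v w = 0 := by
  rw [D.a_symm, D.a_eq_zero t w hw]

/-- The constant in the stability bound of corrected cut-offs. -/
noncomputable def cutConst : ℝ := 2 * D.K + 2 * D.K * (D.K * (D.M * 4 ^ 2))

open scoped Classical in
/-- Multiplying by a cut-off function leaves the kernel of `I`; subtracting the interpolant of the
product leads back to it and spoils the support by two layers only. -/
theorem exists_corrected_cutoff (m n : ℕ) (hn : m + 5 ≤ n) (T : ι) (v : V) (hv : D.I v = 0) :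
    ∃ w, D.I w = 0 ∧ (∀ t ∈ graphBall D.r m T, w ∈ D.Z t) ∧
      (∀ t ∉ graphBall D.r n T, v - w ∈ D.Z t) ∧
      ∀ t, D.a t w w ≤ D.cutConst * ∑ s ∈ graphBall D.r 4 t, D.a s v v := by
  obtain ⟨w, h0, h1, hb⟩ := D.cutoff (graphBall D.r (m + 2) T) v hv
  refine ⟨w - D.I w, by rw [map_sub, D.I_idem, sub_self], fun t ht => ?_, fun t ht => ?_,
    fun t => ?_⟩
  · refine Submodule.sub_mem _ (h0 t (graphBall_mono D.refl (by omega) ht)) ?_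
    exact D.I_local w t fun s hs => h0 s (graphBall_trans ht hs)
  · have key : ∀ s ∈ graphBall D.r 2 t, v - w ∈ D.Z s := fun s hs => by
      refine h1 s fun x hx hr => ht ?_
      have hs' : s ∈ graphBall D.r (m + 3) T := mem_graphBall_succ.2 ⟨x, hx, hr⟩
      have hs'' : t ∈ graphBall D.r (m + 3 + 2) T :=
        graphBall_trans hs' (graphBall_symm D.symm hs)
      exact graphBall_mono D.refl (by omega) hs''
    have e : v - (w - D.I w) = (v - w) - D.I (v - w) := by
      rw [map_sub, hv]; abel
    rw [e]
    exact Submodule.sub_mem _ (key t (self_mem_graphBall D.refl _ _)) (D.I_local _ t key)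
  · have hN : ∀ s, ((graphBall D.r 2 s).card : ℝ) ≤ D.M * 4 ^ 2 := fun s =>
      (D.card_le 2 s).trans_eq (by norm_num)
    have h2 := sum_graphBall_le D.symm 2 _ hN (graphBall D.r 2 t) (graphBall D.r 4 t)
      (fun s hs u hu => graphBall_trans hs hu) (fun s => D.a s v v) (fun s => D.a_nonneg s v)
    have h3 : ∑ s ∈ graphBall D.r 2 t, D.a s w w ≤
        D.K * (D.M * 4 ^ 2 * ∑ s ∈ graphBall D.r 4 t, D.a s v v) := by
      refine (Finset.sum_le_sum fun s _ => hb s).trans ?_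
      rw [← Finset.mul_sum]
      exact mul_le_mul_of_nonneg_left h2 D.K_nonneg
    have h4 : ∑ s ∈ graphBall D.r 2 t, D.a s v v ≤ ∑ s ∈ graphBall D.r 4 t, D.a s v v :=
      Finset.sum_le_sum_of_subset_of_nonneg
        (fun s hs => graphBall_mono D.refl (by norm_num) hs) fun s _ _ => D.a_nonneg s v
    have h5 := form_sub_le (D.a t) (D.a_nonneg t) w (D.I w)
    have h6 := D.I_bound w t
    have h7 := mul_le_mul_of_nonneg_left h3 D.K_nonneg
    have h8 := (hb t).trans (mul_le_mul_of_nonneg_left h4 D.K_nonneg)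
    unfold cutConst
    linarith

theorem M_nonneg (t : ι) : 0 ≤ D.M := by
  have := (Nat.cast_nonneg _).trans (D.card_le 0 t)
  norm_num at this
  linarith

theorem cutConst_nonneg (t : ι) : 0 ≤ D.cutConst := by
  have := D.M_nonneg t
  have := D.K_nonneg
  unfold cutConst
  positivity

open scoped Classical in
/-- The energy of `v` outside the `j`-th patch around `T`. -/
noncomputable def tail (T : ι) (v : V) (j : ℕ) : ℝ :=
  ∑ t ∈ Finset.univ \ graphBall D.r j T, D.a t v v

theorem tail_nonneg (T : ι) (v : V) (j : ℕ) : 0 ≤ D.tail T v j :=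
  Finset.sum_nonneg fun t _ => D.a_nonneg t v

theorem tail_le_total (T : ι) (v : V) (j : ℕ) : D.tail T v j ≤ D.total v v := by
  rw [total_apply]
  exact Finset.sum_le_sum_of_subset_of_nonneg (Finset.subset_univ _) fun t _ _ => D.a_nonneg t v

theorem tail_anti (T : ι) (v : V) {i j : ℕ} (h : i ≤ j) : D.tail T v j ≤ D.tail T v i := by
  classical
  exact Finset.sum_le_sum_of_subset_of_nonneg
    (Finset.sdiff_subset_sdiff le_rfl fun _ hs => graphBall_mono D.refl h hs)
    fun t _ _ => D.a_nonneg t v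

/-- The constant in the comparison of consecutive tails. -/
noncomputable def ringConst : ℝ := 1 + D.cutConst * (D.M * 6 ^ 2)

theorem ringConst_pos (t : ι) : 0 < D.ringConst := by
  have := D.M_nonneg t
  have := D.cutConst_nonneg t
  unfold ringConst
  positivity

open scoped Classical in
theorem sum_cut_le (S S' : Finset ι) (hS : ∀ t ∈ S, ∀ s ∈ graphBall D.r 4 t, s ∈ S')
    (T : ι) (v w : V) (hw : ∀ t, D.a t w w ≤ D.cutConst * ∑ s ∈ graphBall D.r 4 t, D.a s v v) :
    ∑ t ∈ S, D.a t w w ≤ D.cutConst * (D.M * 6 ^ 2) * ∑ s ∈ S', D.a s v v := by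
  have h2 := sum_graphBall_le D.symm 4 (D.M * 6 ^ 2)
    (fun s => (D.card_le 4 s).trans_eq (by norm_num)) S S' hS (fun s => D.a s v v)
    (fun s => D.a_nonneg s v)
  refine (Finset.sum_le_sum fun t _ => hw t).trans ?_
  rw [← Finset.mul_sum, mul_assoc]
  exact mul_le_mul_of_nonneg_left h2 (D.cutConst_nonneg T)

open scoped Classical in
/-- Caccioppoli type estimate: if `φ` is orthogonal to all fine vectors vanishing on `T`, its
energy far from `T` is controlled by its energy on a ring of thirteen layers. -/
theorem tail_succ_le (T : ι) (φ : V) (hφ : D.I φ = 0)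
    (orth : ∀ w, D.I w = 0 → w ∈ D.Z T → D.total φ w = 0) (j : ℕ) :
    D.tail T φ (j + 13) ≤ D.ringConst * (D.tail T φ j - D.tail T φ (j + 13)) := by
  obtain ⟨w, hw, h0, h1, hb⟩ := D.exists_corrected_cutoff (j + 4) (j + 9) le_rfl T φ hφ
  have hA := orth w hw (h0 T (self_mem_graphBall D.refl _ _))
  have sub : graphBall D.r (j + 4) T ⊆ graphBall D.r (j + 9) T := fun _ hs =>
    graphBall_mono D.refl (by omega) hs
  have sub' : graphBall D.r j T ⊆ graphBall D.r (j + 13) T := fun _ hs =>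
    graphBall_mono D.refl (by omega) hs
  rw [total_apply, ← Finset.sum_sdiff (Finset.subset_univ (graphBall D.r (j + 9) T)),
    ← Finset.sum_sdiff sub,
    Finset.sum_eq_zero (s := graphBall D.r (j + 4) T)
      (fun t ht => D.a_eq_zero' (h0 t ht) φ)] at hA
  have hfar : ∑ t ∈ Finset.univ \ graphBall D.r (j + 9) T, D.a t φ w = D.tail T φ (j + 9) := by
    refine Finset.sum_congr rfl fun t ht => ?_
    have := D.a_eq_zero' (h1 t (Finset.mem_sdiff.1 ht).2) φ
    rw [map_sub] at this
    linarith
  set R := graphBall D.r (j + 9) T \ graphBall D.r (j + 4) T with hR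
  set R' := graphBall D.r (j + 13) T \ graphBall D.r j T with hR'
  have hRR : ∀ t ∈ R, ∀ s ∈ graphBall D.r 4 t, s ∈ R' := fun t ht s hs => by
    rw [hR, Finset.mem_sdiff] at ht
    rw [hR', Finset.mem_sdiff]
    have h := graphBall_trans ht.1 hs
    exact ⟨h, fun h => ht.2 (graphBall_trans h (graphBall_symm D.symm hs))⟩
  have hsum := D.sum_cut_le R R' hRR T φ w hb
  have hself : ∑ t ∈ R, D.a t φ φ ≤ ∑ t ∈ R', D.a t φ φ :=
    Finset.sum_le_sum_of_subset_of_nonneg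
      (fun t ht => hRR t ht t (self_mem_graphBall D.refl _ _)) fun t _ _ => D.a_nonneg t φ
  have habs : -∑ t ∈ R, D.a t φ w ≤ ∑ t ∈ R, D.a t φ φ + ∑ t ∈ R, D.a t w w := by
    rw [← Finset.sum_neg_distrib, ← Finset.sum_add_distrib]
    exact Finset.sum_le_sum fun t _ => (neg_le_abs _).trans
      (abs_form_le_half _ (D.a_symm t) (D.a_nonneg t) φ w)
  have hring : ∑ t ∈ R', D.a t φ φ = D.tail T φ j - D.tail T φ (j + 13) := by
    have e : Finset.univ \ graphBall D.r j T =
        (Finset.univ \ graphBall D.r (j + 13) T) ∪ R' := by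
      ext s
      simp only [hR', Finset.mem_sdiff, Finset.mem_univ, true_and, Finset.mem_union]
      constructor
      · intro h; by_cases h' : s ∈ graphBall D.r (j + 13) T <;> simp [h, h']
      · rintro (h | h)
        · exact fun h' => h (sub' h')
        · exact h.2
    have hd : Disjoint (Finset.univ \ graphBall D.r (j + 13) T) R' := by
      rw [Finset.disjoint_left]
      intro s hs hs'
      exact (Finset.mem_sdiff.1 hs).2 (Finset.mem_sdiff.1 hs').1
    unfold tail
    rw [e, Finset.sum_union hd]
    ring
  have hanti := D.tail_anti T φ (show j + 9 ≤ j + 13 by omega)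
  rw [← hring]
  unfold ringConst
  linarith

/-- The decay factor over thirteen layers. -/
noncomputable def rate : ℝ := D.ringConst / (1 + D.ringConst)

theorem rate_nonneg (t : ι) : 0 ≤ D.rate := by
  have := D.ringConst_pos t
  unfold rate
  positivity

theorem tail_le_rate_pow (T : ι) (φ : V) (hφ : D.I φ = 0)
    (orth : ∀ w, D.I w = 0 → w ∈ D.Z T → D.total φ w = 0) (n : ℕ) :
    D.tail T φ (13 * n) ≤ D.rate ^ n * D.total φ φ := by
  induction n with
  | zero => simpa using D.tail_le_total T φ 0
  | succ n ih =>
    have h := D.tail_succ_le T φ hφ orth (13 * n)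
    have hp := D.ringConst_pos T
    have h1 : D.tail T φ (13 * n + 13) ≤ D.rate * D.tail T φ (13 * n) := by
      unfold rate
      rw [div_mul_eq_mul_div, le_div_iff₀ (by positivity)]
      linarith
    rw [show 13 * (n + 1) = 13 * n + 13 by ring, pow_succ']
    refine h1.trans ?_
    rw [mul_assoc]
    exact mul_le_mul_of_nonneg_left ih (D.rate_nonneg T)

/-- The error of localizing one corrector to the `k`-th patch. -/
theorem localization_error (T : ι) (ℓ : V → ℝ) (hℓ : ∀ w ∈ D.Z T, ℓ w = 0) (k : ℕ) (φ ψ : V)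
    (hφ : D.I φ = 0) (hφ' : ∀ w, D.I w = 0 → D.total φ w = ℓ w)
    (hψ : ψ ∈ D.S k T) (hψ' : ∀ w ∈ D.S k T, D.total ψ w = ℓ w) :
    D.total (φ - ψ) (φ - ψ) ≤ D.ringConst * (D.rate ^ ((k - 9) / 13) * D.total φ φ) := by
  classical
  have hrc : 1 ≤ D.ringConst := by
    have := D.M_nonneg T
    have := D.cutConst_nonneg T
    have : 0 ≤ D.cutConst * (D.M * 6 ^ 2) := by positivity
    unfold ringConst
    linarith
  have orth : ∀ w ∈ D.S k T, D.total (φ - ψ) w = 0 := fun w hw => by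
    rw [map_sub, LinearMap.sub_apply, hφ' w (D.S_ker k T w hw), hψ' w hw, sub_self]
  have best : ∀ w ∈ D.S k T, D.total (φ - ψ) (φ - ψ) ≤ D.total (φ - w) (φ - w) := fun w hw =>
    galerkin_le _ D.total_symm D.total_nonneg φ ψ w (orth _ (Submodule.sub_mem _ hψ hw))
  by_cases hk : k < 9
  · have h := best 0 (Submodule.zero_mem _)
    rw [sub_zero] at h
    rw [show (k - 9) / 13 = 0 by omega, pow_zero, one_mul]
    exact h.trans (le_mul_of_one_le_left (D.total_nonneg φ) hrc)
  · obtain ⟨j, rfl⟩ : ∃ j, k = j + 9 := ⟨k - 9, by omega⟩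
    obtain ⟨ζ, hζ, h0, h1, hb⟩ := D.exists_corrected_cutoff (j + 4) (j + 9) le_rfl T φ hφ
    have hmem : φ - ζ ∈ D.S (j + 9) T :=
      D.mem_S _ _ _ (by rw [map_sub, hφ, hζ, sub_zero]) h1
    have h := best _ hmem
    rw [sub_sub_cancel] at h
    refine h.trans ?_
    have e : D.total ζ ζ = ∑ t ∈ Finset.univ \ graphBall D.r (j + 4) T, D.a t ζ ζ := by
      rw [total_apply, ← Finset.sum_sdiff (Finset.subset_univ (graphBall D.r (j + 4) T)),
        Finset.sum_eq_zero (s := graphBall D.r (j + 4) T)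
          (fun t ht => D.a_eq_zero t _ (h0 t ht) ζ), add_zero]
    have h2 := D.sum_cut_le (Finset.univ \ graphBall D.r (j + 4) T)
      (Finset.univ \ graphBall D.r j T) (fun t ht s hs => by
        rw [Finset.mem_sdiff] at ht ⊢
        exact ⟨Finset.mem_univ _, fun h =>
          ht.2 (graphBall_trans h (graphBall_symm D.symm hs))⟩) T φ ζ hb
    have h3 : D.tail T φ j ≤ D.rate ^ (j / 13) * D.total φ φ :=
      (D.tail_anti T φ (Nat.mul_div_le j 13)).trans (D.tail_le_rate_pow T φ hφ
        (fun w hw hz => by rw [hφ' w hw, hℓ w hz]) _)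
    rw [e, show j + 9 - 9 = j by omega]
    have h4 : ∑ s ∈ Finset.univ \ graphBall D.r j T, D.a s φ φ = D.tail T φ j := rfl
    rw [h4] at h2
    refine h2.trans ?_
    have h5 : D.cutConst * (D.M * 6 ^ 2) ≤ D.ringConst := by unfold ringConst; linarith
    exact mul_le_mul h5 h3 (D.tail_nonneg _ _ _) (by linarith)

open scoped Classical in
/-- The sum of all localization errors.  Each single error is tested with a cut-off of the sum
that is supported near the element, and the patches overlap only polynomially often. -/
theorem sum_localization_error (T₀ : ι) (v : V) (k : ℕ) (φ ψ : ι → V)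
    (hφ : ∀ T, D.I (φ T) = 0) (hφ' : ∀ T w, D.I w = 0 → D.total (φ T) w = D.a T v w)
    (hψ : ∀ T, ψ T ∈ D.S k T) (hψ' : ∀ T, ∀ w ∈ D.S k T, D.total (ψ T) w = D.a T v w) :
    D.total (∑ T, φ T - ∑ T, ψ T) (∑ T, φ T - ∑ T, ψ T) ≤
      2 * D.ringConst ^ 2 * (D.M * ((k + 10 : ℕ) + 2) ^ 2) * D.rate ^ ((k - 9) / 13) *
        D.total v v := by
  set z := ∑ T, φ T - ∑ T, ψ T with hz
  have hzd : z = ∑ T, (φ T - ψ T) := by rw [hz, Finset.sum_sub_distrib]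
  have hIz : D.I z = 0 := by
    rw [hzd, map_sum]
    exact Finset.sum_eq_zero fun T _ => by rw [map_sub, hφ, D.S_ker k T _ (hψ T), sub_zero]
  set rc := D.ringConst
  have hrc : 0 < rc := D.ringConst_pos T₀
  -- the energy of a corrector is bounded by the local energy of the coarse function
  have hen : ∀ T, D.total (φ T) (φ T) ≤ D.a T v v := fun T => by
    have h1 := hφ' T (φ T) (hφ T)
    have h2 := abs_form_le (D.a T) (D.a_symm T) (D.a_nonneg T) v (φ T)
    have h3 : D.a T (φ T) (φ T) ≤ D.total (φ T) (φ T) := by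
      rw [total_apply]
      exact Finset.single_le_sum (f := fun t => D.a t (φ T) (φ T))
        (fun t _ => D.a_nonneg t _) (Finset.mem_univ T)
    have h4 := Real.sqrt_le_sqrt h3
    have h5 := Real.sq_sqrt (D.total_nonneg (φ T))
    have h6 := Real.sq_sqrt (D.a_nonneg T v)
    have h7 : √(D.total (φ T) (φ T)) ^ 2 ≤ √(D.a T v v) * √(D.total (φ T) (φ T)) := by
      rw [h5]
      exact (h1.trans_le (le_abs_self _)).trans (h2.trans
        (mul_le_mul_of_nonneg_left h4 (Real.sqrt_nonneg _)))
    have h8 : √(D.total (φ T) (φ T)) ≤ √(D.a T v v) := by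
      by_contra hlt
      push Not at hlt
      nlinarith [Real.sqrt_nonneg (D.a T v v)]
    rwa [Real.sqrt_le_sqrt_iff (D.a_nonneg T v)] at h8
  have hd : ∀ T, D.total (φ T - ψ T) (φ T - ψ T) ≤
      rc * (D.rate ^ ((k - 9) / 13) * D.a T v v) := fun T => by
    refine (D.localization_error T (fun w => D.a T v w) (fun w hw => D.a_eq_zero' hw v) k
      (φ T) (ψ T) (hφ T) (hφ' T) (hψ T) (hψ' T)).trans ?_
    have := D.rate_nonneg T₀
    have := hen T
    gcongr
  -- each error sees only the part of `z` near its element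
  have hloc : ∀ T, ∃ x : V, D.total z (φ T - ψ T) = D.total x (φ T - ψ T) ∧
      D.total x x ≤ 2 * rc * ∑ s ∈ graphBall D.r (k + 10) T, D.a s z z := fun T => by
    obtain ⟨ζ, hζ, h0, h1, hb⟩ := D.exists_corrected_cutoff (k + 1) (k + 6) le_rfl T z hIz
    have hza : D.total ζ (φ T - ψ T) = 0 := by
      rw [map_sub, D.total_symm, D.total_symm ζ, hφ' T ζ hζ,
        D.a_eq_zero' (h0 T (self_mem_graphBall D.refl _ _)), total_apply, zero_sub, neg_eq_zero]
      refine Finset.sum_eq_zero fun s _ => ?_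
      by_cases hs : s ∈ graphBall D.r (k + 1) T
      · exact D.a_eq_zero' (h0 s hs) _
      · exact D.S_far k T _ (hψ T) s hs _
    refine ⟨z - ζ, by
      rw [map_sub D.total z ζ, LinearMap.sub_apply, hza, sub_zero], ?_⟩
    have e : D.total (z - ζ) (z - ζ) = ∑ t ∈ graphBall D.r (k + 6) T, D.a t (z - ζ) (z - ζ) := by
      rw [total_apply, ← Finset.sum_sdiff (Finset.subset_univ (graphBall D.r (k + 6) T)),
        Finset.sum_eq_zero (s := Finset.univ \ graphBall D.r (k + 6) T)
          (fun t ht => D.a_eq_zero t _ (h1 t (Finset.mem_sdiff.1 ht).2) _), zero_add]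
    have hS : ∀ t ∈ graphBall D.r (k + 6) T, ∀ s ∈ graphBall D.r 4 t,
        s ∈ graphBall D.r (k + 10) T := fun t ht s hs => by
      have h := graphBall_trans ht hs
      exact h
    have h2 := D.sum_cut_le _ _ hS T z ζ hb
    have h3 : ∑ t ∈ graphBall D.r (k + 6) T, D.a t z z ≤
        ∑ t ∈ graphBall D.r (k + 10) T, D.a t z z :=
      Finset.sum_le_sum_of_subset_of_nonneg
        (fun t ht => graphBall_mono D.refl (by omega) ht) fun t _ _ => D.a_nonneg t z
    rw [e]
    refine (Finset.sum_le_sum fun t _ => form_sub_le (D.a t) (D.a_nonneg t) z ζ).trans ?_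
    rw [Finset.sum_add_distrib, ← Finset.mul_sum, ← Finset.mul_sum]
    have : rc = 1 + D.cutConst * (D.M * 6 ^ 2) := rfl
    rw [this]
    linarith
  choose x hx hxb using hloc
  have h1 : D.total z z = ∑ T, D.total (x T) (φ T - ψ T) := by
    calc D.total z z = D.total z (∑ T, (φ T - ψ T)) := by rw [← hzd]
      _ = ∑ T, D.total z (φ T - ψ T) := map_sum _ _ _
      _ = _ := Finset.sum_congr rfl fun T _ => hx T
  have h2 : D.total z z ≤ ∑ T, √(D.total (x T) (x T)) *
      √(D.total (φ T - ψ T) (φ T - ψ T)) := by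
    rw [h1]
    exact Finset.sum_le_sum fun T _ => (le_abs_self _).trans
      (abs_form_le _ D.total_symm D.total_nonneg _ _)
  have h3 : D.total z z ^ 2 ≤ (∑ T, D.total (x T) (x T)) *
      ∑ T, D.total (φ T - ψ T) (φ T - ψ T) := by
    refine (pow_le_pow_left₀ (D.total_nonneg z) h2 2).trans ?_
    refine (Finset.sum_mul_sq_le_sq_mul_sq _ _ _).trans_eq ?_
    simp only [Real.sq_sqrt (D.total_nonneg _)]
  have h4 : ∑ T, D.total (x T) (x T) ≤
      2 * rc * ((D.M * ((k + 10 : ℕ) + 2) ^ 2) * D.total z z) := by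
    refine (Finset.sum_le_sum fun T _ => hxb T).trans ?_
    rw [← Finset.mul_sum, D.total_apply z z]
    exact mul_le_mul_of_nonneg_left (sum_graphBall_le D.symm (k + 10) _ (D.card_le (k + 10))
      Finset.univ Finset.univ (fun _ _ _ _ => Finset.mem_univ _) (fun s => D.a s z z)
      (fun s => D.a_nonneg s z)) (by positivity)
  have h5 : ∑ T, D.total (φ T - ψ T) (φ T - ψ T) ≤
      rc * (D.rate ^ ((k - 9) / 13) * D.total v v) := by
    refine (Finset.sum_le_sum fun T _ => hd T).trans_eq ?_
    rw [← Finset.mul_sum, ← Finset.mul_sum, D.total_apply v v]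
  have hM := D.M_nonneg T₀
  have hr := D.rate_nonneg T₀
  have hE := D.total_nonneg z
  have hv := D.total_nonneg v
  have h6 : D.total z z * D.total z z ≤ (2 * rc ^ 2 * (D.M * ((k + 10 : ℕ) + 2) ^ 2) *
      D.rate ^ ((k - 9) / 13) * D.total v v) * D.total z z := by
    rw [← sq]
    refine h3.trans ((mul_le_mul h4 h5 (Finset.sum_nonneg fun T _ => D.total_nonneg _)
      (by positivity)).trans_eq ?_)
    ring
  rcases hE.eq_or_lt with h | h
  · rw [← h]; positivity
  · exact le_of_mul_le_mul_right h6 h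

end LocalSetting

end LOD

/-! ### Geometry of regular triangulations -/

namespace LOD

variable {Ω : Set Plane}

theorem isCompact_hull (s : Finset Plane) : IsCompact (hull s) :=
  s.finite_toSet.isCompact_convexHull ℝ

theorem measurableSet_hull (s : Finset Plane) : MeasurableSet (hull s) :=
  (isCompact_hull s).isClosed.measurableSet

theorem isBounded_closure (hΩ : IsPolygonalDomain Ω) : Bornology.IsBounded (closure Ω) := by
  obtain ⟨S, hS⟩ := hΩ.polygonal
  rw [hS]
  exact (Bornology.isBounded_biUnion_finset S).2 fun s _ =>
    (s.finite_toSet.isCompact_convexHull ℝ).isBounded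

/-- The norm of the linear part of an affine function is its oscillation over a triangle, divided
by the diameter of the inscribed circle, at most. -/
theorem norm_mul_le_of_osc {s : Finset Plane} {b : Plane} {c m δ d : ℝ} {x : Plane} (hd : 0 ≤ d)
    (hx : Metric.closedBall x (d / 2) ⊆ hull s)
    (h : ∀ y ∈ hull s, m ≤ inner ℝ b y + c ∧ inner ℝ b y + c ≤ m + δ) : ‖b‖ * d ≤ δ := by
  rcases eq_or_ne b 0 with rfl | hb
  · have := h x (hx (Metric.mem_closedBall_self (by positivity)))
    simp only [norm_zero, zero_mul]
    linarith
  have hb' : 0 < ‖b‖ := norm_pos_iff.2 hb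
  have mem : ∀ ε : ℝ, |ε| = 1 → x + (ε * (d / 2) / ‖b‖) • b ∈ hull s := fun ε hε => by
    apply hx
    rw [Metric.mem_closedBall, dist_eq_norm, add_sub_cancel_left, norm_smul, Real.norm_eq_abs,
      abs_div, abs_mul, hε, abs_norm, abs_of_nonneg (by positivity : 0 ≤ d / 2)]
    rw [one_mul, div_mul_cancel₀ _ hb'.ne']
  have h1 := (h _ (mem 1 (by simp))).2
  have h2 := (h _ (mem (-1) (by simp))).1
  have e : ∀ ε : ℝ, (inner ℝ b (x + (ε * (d / 2) / ‖b‖) • b) : ℝ) =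
      inner ℝ b x + ε * (‖b‖ * d / 2) := fun ε => by
    rw [inner_add_right, real_inner_smul_right, real_inner_self_eq_norm_sq]
    field_simp
  rw [e] at h1 h2
  linarith

namespace Triangulation

variable (𝒯 : Triangulation Ω)

theorem affineSpan_eq_top {s : Finset Plane} (hs : s ∈ 𝒯.tri) :
    affineSpan ℝ (s : Set Plane) = ⊤ := by
  have h := (𝒯.indep s hs).affineSpan_eq_top_iff_card_eq_finrank_add_one
  rw [Subtype.range_coe] at h
  refine h.2 ?_
  simp [𝒯.card_eq s hs]

theorem interior_hull_nonempty {s : Finset Plane} (hs : s ∈ 𝒯.tri) :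
    (interior (hull s)).Nonempty :=
  interior_convexHull_nonempty_iff_affineSpan_eq_top.2 (𝒯.affineSpan_eq_top hs)

theorem hull_nonempty {s : Finset Plane} (hs : s ∈ 𝒯.tri) : (hull s).Nonempty :=
  (𝒯.interior_hull_nonempty hs).mono interior_subset

theorem tri_nonempty (hΩ : IsPolygonalDomain Ω) : 𝒯.tri.Nonempty := by
  obtain ⟨x, hx⟩ := hΩ.isConnected.nonempty
  have := subset_closure hx
  rw [← 𝒯.cover] at this
  obtain ⟨s, hs, -⟩ := mem_iUnion₂.1 this
  exact ⟨s, hs⟩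

theorem hull_subset {s : Finset Plane} (hs : s ∈ 𝒯.tri) : hull s ⊆ closure Ω := by
  rw [← 𝒯.cover]
  exact subset_biUnion_of_mem (u := fun s => hull s) hs

theorem diam_le_meshSize {s : Finset Plane} (hs : s ∈ 𝒯.tri) :
    Metric.diam (hull s) ≤ 𝒯.meshSize :=
  le_csSup (𝒯.tri.finite_toSet.image _).bddAbove ⟨s, hs, rfl⟩

theorem dist_le_meshSize {s : Finset Plane} (hs : s ∈ 𝒯.tri) {x y : Plane} (hx : x ∈ hull s)
    (hy : y ∈ hull s) : dist x y ≤ 𝒯.meshSize :=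
  (Metric.dist_le_diam_of_mem (isCompact_hull s).isBounded hx hy).trans (𝒯.diam_le_meshSize hs)

theorem le_meshSize_of_closedBall {s : Finset Plane} (hs : s ∈ 𝒯.tri) {d : ℝ} (hd : 0 ≤ d)
    {x : Plane} (hx : Metric.closedBall x (d / 2) ⊆ hull s) : d ≤ 𝒯.meshSize := by
  obtain ⟨e, he⟩ : ∃ e : Plane, ‖e‖ = 1 := ⟨EuclideanSpace.single 0 1, by simp⟩
  have mem : ∀ ε : ℝ, |ε| = 1 → x + (ε * (d / 2)) • e ∈ hull s := fun ε hε => by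
    apply hx
    rw [Metric.mem_closedBall, dist_eq_norm, add_sub_cancel_left, norm_smul, he,
      Real.norm_eq_abs, abs_mul, hε, one_mul, mul_one, abs_of_nonneg (by positivity)]
  have h := 𝒯.dist_le_meshSize hs (mem 1 (by simp)) (mem (-1) (by simp))
  rw [dist_eq_norm, add_sub_add_left_eq_sub, ← sub_smul, norm_smul, he, mul_one,
    Real.norm_eq_abs] at h
  have := (le_abs_self _).trans h
  linarith

theorem bddAbove_inDiam {s : Finset Plane} (hs : s ∈ 𝒯.tri) :
    BddAbove {d : ℝ | 0 ≤ d ∧ ∃ x, Metric.closedBall x (d / 2) ⊆ hull s} :=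
  ⟨𝒯.meshSize, fun _ hd => hd.2.elim fun _ hx => 𝒯.le_meshSize_of_closedBall hs hd.1 hx⟩

theorem inDiam_pos {s : Finset Plane} (hs : s ∈ 𝒯.tri) : 0 < inDiam s := by
  obtain ⟨x, hx⟩ := 𝒯.interior_hull_nonempty hs
  obtain ⟨ε, hε, h⟩ := Metric.isOpen_iff.1 isOpen_interior x hx
  have : ε ≤ inDiam s := le_csSup (𝒯.bddAbove_inDiam hs)
    ⟨hε.le, x, (Metric.closedBall_subset_ball (by linarith)).trans (h.trans interior_subset)⟩
  linarith

theorem inDiam_le {s : Finset Plane} (hs : s ∈ 𝒯.tri) : inDiam s ≤ 𝒯.meshSize := by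
  obtain ⟨x, hx⟩ := 𝒯.hull_nonempty hs
  refine csSup_le ⟨0, le_rfl, x, by simpa using hx⟩ fun d hd => ?_
  exact hd.2.elim fun _ hx => 𝒯.le_meshSize_of_closedBall hs hd.1 hx

theorem meshSize_pos (hΩ : IsPolygonalDomain Ω) : 0 < 𝒯.meshSize :=
  (𝒯.tri_nonempty hΩ).elim fun _ hs => (𝒯.inDiam_pos hs).trans_le (𝒯.inDiam_le hs)

variable {𝒯} {γ : ℝ}

theorem IsRegular.meshSize_le (h : 𝒯.IsRegular γ) {s : Finset Plane} (hs : s ∈ 𝒯.tri) :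
    𝒯.meshSize ≤ γ * inDiam s :=
  (div_le_iff₀ (𝒯.inDiam_pos hs)).1 (h.1 s hs)

theorem IsRegular.one_le (h : 𝒯.IsRegular γ) (hΩ : IsPolygonalDomain Ω) : 1 ≤ γ := by
  obtain ⟨s, hs⟩ := 𝒯.tri_nonempty hΩ
  have h1 := h.meshSize_le hs
  have h2 := 𝒯.inDiam_le hs
  have h3 := 𝒯.inDiam_pos hs
  by_contra hlt
  push Not at hlt
  nlinarith

/-- Each element contains a disc whose radius is comparable with the mesh size. -/
theorem IsRegular.exists_closedBall (h : 𝒯.IsRegular γ) (hΩ : IsPolygonalDomain Ω)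
    {s : Finset Plane} (hs : s ∈ 𝒯.tri) :
    ∃ x, Metric.closedBall x (𝒯.meshSize / (4 * γ)) ⊆ hull s := by
  have hγ := h.one_le hΩ
  have h1 := h.meshSize_le hs
  have h2 := 𝒯.inDiam_pos hs
  obtain ⟨x₀, hx₀⟩ := 𝒯.hull_nonempty hs
  obtain ⟨d, ⟨_, x, hx⟩, hlt⟩ := exists_lt_of_lt_csSup (s := {d : ℝ | 0 ≤ d ∧
    ∃ x, Metric.closedBall x (d / 2) ⊆ hull s}) ⟨0, le_rfl, x₀, by simpa using hx₀⟩
    (show inDiam s / 2 < inDiam s by linarith)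
  refine ⟨x, (Metric.closedBall_subset_closedBall ?_).trans hx⟩
  rw [div_le_iff₀ (by positivity)]
  nlinarith

theorem IsRegular.norm_le_of_osc (h : 𝒯.IsRegular γ) (hΩ : IsPolygonalDomain Ω) {s : Finset Plane}
    (hs : s ∈ 𝒯.tri) {b : Plane} {c m δ : ℝ}
    (hb : ∀ y ∈ hull s, m ≤ inner ℝ b y + c ∧ inner ℝ b y + c ≤ m + δ) :
    ‖b‖ ≤ 2 * γ * δ / 𝒯.meshSize := by
  obtain ⟨x, hx⟩ := h.exists_closedBall hΩ hs
  have hH := 𝒯.meshSize_pos hΩ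
  have hγ := h.one_le hΩ
  have h1 := norm_mul_le_of_osc (s := s) (d := 𝒯.meshSize / (2 * γ)) (x := x) (by positivity)
    (by convert hx using 2; field_simp; norm_num) hb
  rw [le_div_iff₀ hH]
  rw [mul_div_assoc', div_le_iff₀ (by positivity)] at h1
  linarith

/-! ### Distinct elements overlap in a null set, and the count of elements in a patch -/

theorem volume_inter_hull {s t : Finset Plane} (hs : s ∈ 𝒯.tri) (ht : t ∈ 𝒯.tri) (hne : s ≠ t) :
    volume (hull s ∩ hull t) = 0 := by
  classical
  rw [𝒯.conforming s hs t ht, ← Finset.coe_inter]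
  have hcard : (s ∩ t).card ≤ 2 := by
    by_contra hlt
    have h1 : s ∩ t = s := Finset.eq_of_subset_of_card_le Finset.inter_subset_left
      (by rw [𝒯.card_eq s hs]; omega)
    have h2 : s ∩ t = t := Finset.eq_of_subset_of_card_le Finset.inter_subset_right
      (by rw [𝒯.card_eq t ht]; omega)
    exact hne (h1.symm.trans h2)
  refine measure_mono_null (convexHull_subset_affineSpan _)
    (Measure.addHaar_affineSubspace volume _ fun htop => ?_)
  have h3 : vectorSpan ℝ ((s ∩ t : Finset Plane) : Set Plane) = ⊤ := by
    rw [← direction_affineSpan, htop, AffineSubspace.direction_top]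
  rcases Nat.eq_zero_or_pos (s ∩ t).card with h0 | hpos
  · rw [Finset.card_eq_zero.1 h0] at htop
    simp at htop
  · have h4 := finrank_vectorSpan_image_finset_le ℝ (id : Plane → Plane) (s ∩ t)
      (n := (s ∩ t).card - 1) (by omega)
    rw [Finset.image_id, h3, finrank_top, finrank_euclideanSpace_fin] at h4
    omega

variable (𝒯) in
/-- The elements that meet, as a relation on the set of elements. -/
def Meets (s t : 𝒯.tri) : Prop := (hull s.1 ∩ hull t.1).Nonempty

theorem Meets.refl (t : 𝒯.tri) : 𝒯.Meets t t := by
  simpa [Meets] using 𝒯.hull_nonempty t.2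

theorem Meets.symm (s t : 𝒯.tri) (h : 𝒯.Meets s t) : 𝒯.Meets t s := by
  rwa [Meets, inter_comm]

theorem nbhd_biUnion (F : Finset 𝒯.tri) : 𝒯.nbhd (⋃ t ∈ F, hull t.1) =
    ⋃ s ∈ {s : 𝒯.tri | ∃ t ∈ F, 𝒯.Meets s t}, hull s.1 := by
  ext x
  simp only [nbhd, mem_ofPred_eq, mem_iUnion, exists_prop, Subtype.exists]
  constructor
  · rintro ⟨s, ⟨hs, y, hy, hy'⟩, hx⟩
    simp only [mem_iUnion, exists_prop] at hy'
    obtain ⟨t, ht, hyt⟩ := hy'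
    exact ⟨s, hs, ⟨t.1, t.2, ht, y, hy, hyt⟩, hx⟩
  · rintro ⟨s, hs, ⟨t, ht, htF, y, hy, hyt⟩, hx⟩
    refine ⟨s, ⟨hs, y, hy, ?_⟩, hx⟩
    simp only [mem_iUnion, exists_prop]
    exact ⟨⟨t, ht⟩, htF, hyt⟩

theorem patch_eq (k : ℕ) (T : 𝒯.tri) :
    𝒯.patch k T.1 = ⋃ s ∈ graphBall 𝒯.Meets k T, hull s.1 := by
  induction k with
  | zero => simp [patch, mem_graphBall_zero]
  | succ k ih =>
    rw [patch, Function.iterate_succ_apply', ← patch, ih, nbhd_biUnion]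
    simp [mem_graphBall_succ]

theorem nbhd_hull_eq (T : 𝒯.tri) :
    𝒯.nbhd (hull T.1) = ⋃ s ∈ graphBall 𝒯.Meets 1 T, hull s.1 :=
  patch_eq 1 T

theorem dist_le_of_mem_graphBall {n : ℕ} {s T : 𝒯.tri} (hs : s ∈ graphBall 𝒯.Meets n T)
    {x y : Plane} (hx : x ∈ hull T.1) (hy : y ∈ hull s.1) : dist y x ≤ (n + 1) * 𝒯.meshSize := by
  induction n generalizing s y with
  | zero =>
    rw [mem_graphBall_zero] at hs
    subst hs
    simpa using 𝒯.dist_le_meshSize s.2 hy hx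
  | succ n ih =>
    obtain ⟨u, hu, z, hz, hz'⟩ := mem_graphBall_succ.1 hs
    have h1 := ih hu hz'
    have h2 := 𝒯.dist_le_meshSize s.2 hy hz
    have := dist_triangle y z x
    push_cast
    linarith

/-- Comparison of areas: the elements of a patch have disjoint interiors, contain discs of radius
comparable with the mesh size, and lie in a disc of radius `(n + 2)` times the mesh size. -/
theorem IsRegular.card_graphBall_le (h : 𝒯.IsRegular γ) (hΩ : IsPolygonalDomain Ω) (n : ℕ)
    (T : 𝒯.tri) : ((graphBall 𝒯.Meets n T).card : ℝ) ≤ 16 * γ ^ 2 * (n + 2) ^ 2 := by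
  have hH := 𝒯.meshSize_pos hΩ
  have hγ := h.one_le hΩ
  obtain ⟨x, hx⟩ := 𝒯.hull_nonempty T.2
  set B := graphBall 𝒯.Meets n T
  set κ := volume (Metric.ball (0 : Plane) 1) with hκ
  have hκ0 : κ ≠ 0 := (Metric.measure_ball_pos volume _ one_pos).ne'
  have hκt : κ ≠ ⊤ := measure_ball_lt_top.ne
  have h1 : volume (⋃ s ∈ B, hull s.1) = ∑ s ∈ B, volume (hull s.1) := by
    refine measure_biUnion_finset₀ (fun s _ t _ hne => ?_)
      fun s _ => (measurableSet_hull s.1).nullMeasurableSet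
    exact volume_inter_hull s.2 t.2 fun e => hne (Subtype.ext e)
  have h2 : volume (⋃ s ∈ B, hull s.1) ≤ ENNReal.ofReal (((n + 1) * 𝒯.meshSize) ^ 2) * κ := by
    have h3 := Measure.addHaar_closedBall (volume : Measure Plane) x
      (r := (n + 1) * 𝒯.meshSize) (by positivity)
    rw [finrank_euclideanSpace_fin] at h3
    rw [← h3]
    refine measure_mono (iUnion₂_subset fun s hs y hy => ?_)
    exact dist_le_of_mem_graphBall hs hx hy
  have h4 : ∀ s ∈ B, ENNReal.ofReal ((𝒯.meshSize / (4 * γ)) ^ 2) * κ ≤ volume (hull s.1) :=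
    fun s _ => by
      obtain ⟨y, hy⟩ := h.exists_closedBall hΩ s.2
      have h3 := Measure.addHaar_closedBall (volume : Measure Plane) y
        (r := 𝒯.meshSize / (4 * γ)) (by positivity)
      rw [finrank_euclideanSpace_fin] at h3
      rw [← h3]
      exact measure_mono hy
  have h5 := (Finset.card_nsmul_le_sum B _ _ h4).trans (h1.symm.trans_le h2)
  rw [nsmul_eq_mul, ← mul_assoc, ENNReal.mul_le_mul_iff_left hκ0 hκt,
    ← ENNReal.ofReal_natCast, ← ENNReal.ofReal_mul (by positivity),
    ENNReal.ofReal_le_ofReal_iff (by positivity), div_pow, mul_div_assoc',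
    div_le_iff₀ (by positivity)] at h5
  have h6 : (B.card : ℝ) ≤ (n + 1) ^ 2 * (4 * γ) ^ 2 := by
    refine le_of_mul_le_mul_right (a := 𝒯.meshSize ^ 2) ?_ (by positivity)
    refine h5.trans_eq (by ring)
  refine h6.trans ?_
  have h7 : ((n : ℝ) + 1) ^ 2 ≤ (n + 2) ^ 2 := by gcongr; norm_num
  nlinarith [mul_le_mul_of_nonneg_left h7 (by positivity : 0 ≤ 16 * γ ^ 2)]

/-! ### Nodal cut-off functions -/

theorem exists_affine (𝒯 : Triangulation Ω) {s : Finset Plane} (hs : s ∈ 𝒯.tri) (f : Plane → ℝ) :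
    ∃ (b : Plane) (c : ℝ), ∀ p ∈ s, inner ℝ b p + c = f p := by
  let Φ : (Plane × ℝ) →ₗ[ℝ] (s → ℝ) :=
    { toFun := fun q p => inner ℝ q.1 p.1 + q.2
      map_add' := fun q q' => by
        funext p
        simp only [Prod.fst_add, Prod.snd_add, inner_add_left, Pi.add_apply]
        ring
      map_smul' := fun r q => by
        funext p
        simp [real_inner_smul_left, mul_add] }
  have hinj : Function.Injective Φ := by
    rw [injective_iff_map_eq_zero]
    rintro ⟨b, c⟩ hq
    have hq' : ∀ p ∈ s, (inner ℝ b p : ℝ) + c = 0 := fun p hp => congrFun hq ⟨p, hp⟩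
    obtain ⟨p, hp⟩ : s.Nonempty := by
      rw [← Finset.card_pos, 𝒯.card_eq s hs]; norm_num
    have hall : ∀ y : Plane, (inner ℝ b (y - p) : ℝ) = 0 := fun y => by
      have hv : y - p ∈ vectorSpan ℝ (s : Set Plane) := by
        rw [← direction_affineSpan, 𝒯.affineSpan_eq_top hs, AffineSubspace.direction_top]
        trivial
      rw [vectorSpan_eq_span_vsub_set_right ℝ (show p ∈ (s : Set Plane) from hp)] at hv
      refine Submodule.span_induction (p := fun z _ => (inner ℝ b z : ℝ) = 0) ?_ ?_ ?_ ?_ hv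
      · rintro _ ⟨x, hx, rfl⟩
        have h1 := hq' x hx
        have h2 := hq' p hp
        simp only [vsub_eq_sub, inner_sub_right]
        linarith
      · simp
      · intro x y _ _ hx hy
        simp [inner_add_right, hx, hy]
      · intro r x _ hx
        simp [real_inner_smul_right, hx]
    have hb : b = 0 := by
      have := hall (p + b)
      rw [add_sub_cancel_left] at this
      exact inner_self_eq_zero.1 this
    have hc := hq' p hp
    simp only [hb, inner_zero_left, zero_add] at hc
    simp [hb, hc]
  have hsurj : Function.Surjective Φ := by
    rw [← LinearMap.injective_iff_surjective_of_finrank_eq_finrank (f := Φ)]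
    · exact hinj
    · simp [𝒯.card_eq s hs]
  obtain ⟨⟨b, c⟩, h⟩ := hsurj (fun p => f p)
  exact ⟨b, c, fun p hp => congrFun h ⟨p, hp⟩⟩

theorem mem_Icc_of_mem_hull {s : Finset Plane} {b : Plane} {c m M : ℝ}
    (h : ∀ p ∈ s, inner ℝ b p + c ∈ Icc m M) {x : Plane} (hx : x ∈ hull s) :
    inner ℝ b x + c ∈ Icc m M := by
  have hconv : Convex ℝ {x : Plane | (inner ℝ b x : ℝ) + c ∈ Icc m M} := by
    have h0 : IsLinearMap ℝ (fun x : Plane => (inner ℝ b x : ℝ)) :=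
      ⟨fun x y => inner_add_right _ _ _, fun r x => real_inner_smul_right _ _ _⟩
    have : {x : Plane | (inner ℝ b x : ℝ) + c ∈ Icc m M} =
        {x | m - c ≤ (inner ℝ b x : ℝ)} ∩ {x | (inner ℝ b x : ℝ) ≤ M - c} := by
      ext y
      simp [le_sub_iff_add_le]
    rw [this]
    exact (convex_halfSpace_ge h0 _).inter (convex_halfSpace_le h0 _)
  exact convexHull_min (fun p hp => h p hp) hconv hx

/-- The continuous, elementwise affine function which vanishes at the vertices of the elements of
`F` and equals one at all other vertices. -/
theorem IsRegular.exists_cutoff (h : 𝒯.IsRegular γ) (hΩ : IsPolygonalDomain Ω)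
    (F : Finset 𝒯.tri) : ∃ (η : Plane → ℝ) (b : 𝒯.tri → Plane) (c : 𝒯.tri → ℝ),
      (∀ s : 𝒯.tri, ∀ x ∈ hull s.1, η x = inner ℝ (b s) x + c s) ∧
      (∀ s : 𝒯.tri, ∀ x ∈ hull s.1, η x ∈ Icc (0 : ℝ) 1) ∧
      (∀ s, ‖b s‖ ≤ 2 * γ / 𝒯.meshSize) ∧
      (∀ s ∈ F, b s = 0 ∧ ∀ x ∈ hull s.1, η x = 0) ∧
      (∀ s, (∀ t ∈ F, ¬ 𝒯.Meets s t) → b s = 0 ∧ ∀ x ∈ hull s.1, η x = 1) := by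
  classical
  let f : Plane → ℝ := fun p => if ∃ t ∈ F, p ∈ t.1 then 0 else 1
  have hf : ∀ p, f p ∈ Icc (0 : ℝ) 1 := fun p => by
    simp only [f]; split_ifs <;> simp
  choose b c hbc using fun s : 𝒯.tri => 𝒯.exists_affine s.2 f
  let η : Plane → ℝ := fun x =>
    if hx : ∃ s : 𝒯.tri, x ∈ hull s.1 then inner ℝ (b hx.choose) x + c hx.choose else 0
  have hη : ∀ s : 𝒯.tri, ∀ x ∈ hull s.1, η x = inner ℝ (b s) x + c s := fun s x hx => by
    have hex : ∃ s : 𝒯.tri, x ∈ hull s.1 := ⟨s, hx⟩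
    have hη' : η x = inner ℝ (b hex.choose) x + c hex.choose := dif_pos hex
    rw [hη']
    set t := hex.choose
    have hmem : x ∈ hull (s.1 ∩ t.1) := by
      have : x ∈ hull s.1 ∩ hull t.1 := ⟨hx, hex.choose_spec⟩
      rw [𝒯.conforming _ s.2 _ t.2] at this
      rwa [hull, Finset.coe_inter]
    have := mem_Icc_of_mem_hull (b := b t - b s) (c := c t - c s) (m := 0) (M := 0)
      (fun p hp => by
        have h1 := hbc s p (Finset.mem_inter.1 hp).1
        have h2 := hbc t p (Finset.mem_inter.1 hp).2
        have : inner ℝ (b t - b s) p + (c t - c s) = 0 := by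
          rw [inner_sub_left]; linarith
        rw [this]; simp) hmem
    rw [Icc_self, mem_singleton_iff, inner_sub_left] at this
    linarith
  have hconst : ∀ (s : 𝒯.tri) (m : ℝ), (∀ p ∈ s.1, f p = m) →
      b s = 0 ∧ ∀ x ∈ hull s.1, η x = m := fun s m hm => by
    have h1 : ∀ x ∈ hull s.1, inner ℝ (b s) x + c s = m := fun x hx => by
      have := mem_Icc_of_mem_hull (m := m) (M := m)
        (fun p hp => by rw [hbc s p hp, hm p hp]; simp) hx
      simpa using this
    refine ⟨?_, fun x hx => (hη s x hx).trans (h1 x hx)⟩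
    have := h.norm_le_of_osc hΩ s.2 (m := m) (δ := 0) (b := b s) (c := c s)
      fun y hy => by rw [h1 y hy]; simp
    simpa using this
  have hrange : ∀ s : 𝒯.tri, ∀ x ∈ hull s.1, inner ℝ (b s) x + c s ∈ Icc (0 : ℝ) 1 :=
    fun s x hx => mem_Icc_of_mem_hull (fun p hp => by rw [hbc s p hp]; exact hf p) hx
  refine ⟨η, b, c, hη, fun s x hx => by rw [hη s x hx]; exact hrange s x hx, fun s => ?_,
    fun s hs => hconst s 0 fun p hp => if_pos ⟨s, hs, hp⟩,
    fun s hs => hconst s 1 fun p hp => if_neg ?_⟩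
  · have := h.norm_le_of_osc hΩ s.2 (m := 0) (δ := 1) (b := b s) (c := c s)
      fun y hy => ⟨(hrange s y hy).1, by simpa using (hrange s y hy).2⟩
    simpa using this
  · rintro ⟨t, ht, hpt⟩
    exact hs t ht ⟨p, subset_convexHull ℝ _ hp, subset_convexHull ℝ _ hpt⟩

end Triangulation

end LOD

/-! ### Friedrichs' inequality and the trace inequality -/

namespace LOD

variable {Ω : Set Plane}

theorem eLpNorm_two_sq {X F : Type*} [MeasurableSpace X] [NormedAddCommGroup F] (μ : Measure X)
    (f : X → F) : eLpNorm f 2 μ ^ 2 = ∫⁻ x, ‖f x‖ₑ ^ 2 ∂μ := by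
  have h := eLpNorm_nnreal_pow_eq_lintegral (μ := μ) (f := f) (p := 2) (by norm_num)
  have e : ((2 : NNReal) : ℝ) = (2 : ℕ) := by norm_num
  simpa only [e, ENNReal.rpow_natCast, ENNReal.coe_ofNat] using h

theorem norm_gradient (φ : Plane → ℝ) (x : Plane) : ‖gradient φ x‖ = ‖fderiv ℝ φ x‖ := by
  simp [gradient]

theorem inner_gradient (φ : Plane → ℝ) (x v : Plane) :
    inner ℝ (gradient φ x) v = fderiv ℝ φ x v := by
  simp [gradient]

/-- The smooth functions with compact support in `Ω`. -/
def IsTest (Ω : Set Plane) (φ : Plane → ℝ) : Prop :=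
  ContDiff ℝ ∞ φ ∧ HasCompactSupport φ ∧ tsupport φ ⊆ Ω

theorem IsTest.continuous_gradient {φ : Plane → ℝ} (h : IsTest Ω φ) : Continuous (gradient φ) :=
  (InnerProductSpace.toDual ℝ Plane).symm.continuous.comp (h.1.continuous_fderiv (by simp))

theorem IsTest.support_gradient {φ : Plane → ℝ} (h : IsTest Ω φ) :
    Function.support (gradient φ) ⊆ Ω := fun x hx => by
  refine h.2.2 (support_fderiv_subset ℝ fun h0 => hx ?_)
  simp [gradient, h0]

theorem friedrichs_of_isTest (hΩ : Bornology.IsBounded Ω) : ∃ C : NNReal, ∀ φ, IsTest Ω φ →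
    eLpNorm φ 2 (bulk Ω) ≤ C * eLpNorm (gradient φ) 2 (bulk Ω) := by
  have hfin : volume Ω ≠ ⊤ := hΩ.measure_lt_top.ne
  refine ⟨eLpNormLESNormFDerivOneConst (volume : Measure Plane) (2 : NNReal) *
    (volume Ω).toNNReal ^ (1 / 2 : ℝ),
    fun φ hφ => ?_⟩
  have h1 := eLpNorm_le_eLpNorm_fderiv_one (volume : Measure Plane) (hφ.1.of_le (by norm_cast))
    hφ.2.1 (p := 2) (by
      rw [finrank_euclideanSpace_fin]
      exact NNReal.HolderConjugate.two_two)
  have h2 : eLpNorm φ 2 (bulk Ω) ≤ eLpNorm φ 2 volume := eLpNorm_restrict_le _ _ _ _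
  have h3 : eLpNorm (fderiv ℝ φ) 1 volume = eLpNorm (gradient φ) 1 (bulk Ω) := by
    rw [bulk, eLpNorm_restrict_eq_of_support_subset hφ.support_gradient]
    exact eLpNorm_congr_norm_ae (ae_of_all _ fun x => (norm_gradient φ x).symm)
  have h4 := eLpNorm_le_eLpNorm_mul_rpow_measure_univ (μ := bulk Ω) (p := 1) (q := 2)
    (by norm_num) hφ.continuous_gradient.aestronglyMeasurable
  have h5 : ((volume Ω).toNNReal ^ (1 / 2 : ℝ) : NNReal) = (bulk Ω) univ ^
      (1 / (1 : ℝ≥0∞).toReal - 1 / (2 : ℝ≥0∞).toReal) := by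
    rw [bulk, Measure.restrict_apply_univ, ENNReal.coe_rpow_of_nonneg _ (by norm_num),
      ENNReal.coe_toNNReal hfin]
    norm_num
  rw [ENNReal.coe_mul, h5, mul_assoc, mul_comm (_ ^ _)]
  refine h2.trans (h1.trans ?_)
  rw [h3]
  gcongr

/-- Along a family of parallel segments transversal to a short arc, areas are comparable with the
product measure of the parameters. -/
theorem lintegral_strip_le {c : ℝ → Plane} (hc : ContDiff ℝ 1 c) (ν : Plane) (p q R : ℝ)
    (hdet : ∀ t ∈ Icc p q, 1 / 2 ≤ deriv c t 0 * ν 1 - deriv c t 1 * ν 0) (h : Plane → ℝ≥0∞)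
    (hh : Measurable h) :
    ∫⁻ t in Icc p q, ∫⁻ s in Icc 0 R, h (c t + s • ν) ≤ 2 * ∫⁻ x, h x := by
  have hcd : ∀ t, HasDerivAt c (deriv c t) t := fun t =>
    ((hc.differentiable (by norm_num)) t).hasDerivAt
  let pr (j : Fin 2) : Plane →L[ℝ] ℝ := EuclideanSpace.proj j
  let Φ : Plane → Plane := fun y => c (y 0) + (y 1) • ν
  let Φ' : Plane → Plane →L[ℝ] Plane := fun y =>
    (pr 0).smulRight (deriv c (y 0)) + (pr 1).smulRight ν
  have hΦ : ∀ y, HasFDerivAt Φ (Φ' y) y := fun y => by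
    have h0 : HasFDerivAt (fun y : Plane => c (y 0)) ((pr 0).smulRight (deriv c (y 0))) y :=
      (HasFDerivAt.comp (f := fun y : Plane => pr 0 y) y (hcd (y 0)).hasFDerivAt
        (pr 0).hasFDerivAt).congr_fderiv (by ext v; simp)
    exact h0.add ((pr 1).hasFDerivAt.smul_const ν)
  have hdetΦ : ∀ y, (Φ' y).det = deriv c (y 0) 0 * ν 1 - deriv c (y 0) 1 * ν 0 := fun y => by
    rw [ContinuousLinearMap.det,
      ← LinearMap.det_toMatrix (EuclideanSpace.basisFun (Fin 2) ℝ).toBasis,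
      Matrix.det_fin_two]
    simp [LinearMap.toMatrix_apply, Φ', pr]
    ring
  let S : Set Plane := {y | y 0 ∈ Icc p q ∧ y 1 ∈ Icc 0 R}
  have hS : MeasurableSet S :=
    ((isClosed_Icc.preimage (pr 0).continuous).inter
      (isClosed_Icc.preimage (pr 1).continuous)).measurableSet
  have hinj : InjOn Φ S := by
    intro y hy y' hy' hyy
    have hmono : StrictMonoOn (fun t => c t 0 * ν 1 - c t 1 * ν 0) (Icc p q) := by
      have hd : ∀ t, HasDerivAt (fun t => c t 0 * ν 1 - c t 1 * ν 0)
          (deriv c t 0 * ν 1 - deriv c t 1 * ν 0) t := fun t =>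
        (((pr 0).hasFDerivAt.comp_hasDerivAt t (hcd t)).mul_const _).sub
          (((pr 1).hasFDerivAt.comp_hasDerivAt t (hcd t)).mul_const _)
      refine strictMonoOn_of_deriv_pos (convex_Icc p q)
        (fun t _ => (hd t).continuousAt.continuousWithinAt) fun t ht => ?_
      rw [(hd t).deriv]
      linarith [hdet t (interior_subset ht)]
    have e0 := congrArg (fun z : Plane => z 0) hyy
    have e1 := congrArg (fun z : Plane => z 1) hyy
    simp only [Φ, PiLp.add_apply, PiLp.smul_apply, smul_eq_mul] at e0 e1
    have h0 : y 0 = y' 0 := hmono.injOn hy.1 hy'.1 (by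
      simp only
      linear_combination ν 1 * e0 - ν 0 * e1)
    rw [h0] at e0 e1
    have h1 : y 1 = y' 1 := by
      by_contra hne
      have hne' : y 1 - y' 1 ≠ 0 := sub_ne_zero.2 hne
      have n0 : ν 0 = 0 := mul_left_cancel₀ hne' (by linarith)
      have n1 : ν 1 = 0 := mul_left_cancel₀ hne' (by linarith)
      have := hdet _ hy.1
      rw [n0, n1] at this
      norm_num at this
    ext j
    fin_cases j
    · exact h0
    · exact h1
  have key := lintegral_image_eq_lintegral_abs_det_fderiv_mul volume hS
    (fun y _ => (hΦ y).hasFDerivWithinAt) hinj h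
  have hprod : ∫⁻ t in Icc p q, ∫⁻ s in Icc 0 R, h (c t + s • ν) = ∫⁻ y in S, h (Φ y) := by
    let g : ℝ × ℝ → ℝ≥0∞ := fun z => h (c z.1 + z.2 • ν)
    have hg : Measurable g := hh.comp
      ((hc.continuous.comp continuous_fst).add (continuous_snd.smul continuous_const)).measurable
    rw [← setLIntegral_prod g hg.aemeasurable]
    let e : Plane ≃ᵐ ℝ × ℝ := (MeasurableEquiv.toLp 2 (Fin 2 → ℝ)).symm.trans
      MeasurableEquiv.finTwoArrow
    have he : MeasurePreserving e volume volume :=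
      (volume_preserving_finTwoArrow ℝ).comp (PiLp.volume_preserving_ofLp (Fin 2))
    have := he.setLIntegral_comp_preimage_emb e.measurableEmbedding g (Icc p q ×ˢ Icc 0 R)
    exact this.symm
  rw [hprod]
  calc ∫⁻ y in S, h (Φ y) ≤ ∫⁻ y in S, 2 * (ENNReal.ofReal |(Φ' y).det| * h (Φ y)) := by
        refine setLIntegral_mono' hS fun y hy => ?_
        have h1 := hdet _ hy.1
        rw [← hdetΦ] at h1
        have h2 : (1 : ℝ≥0∞) ≤ 2 * ENNReal.ofReal |(Φ' y).det| := by
          have h3 := h1.trans (le_abs_self _)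
          generalize |(Φ' y).det| = r at h3
          rw [show (2 : ℝ≥0∞) = ENNReal.ofReal 2 by simp, ← ENNReal.ofReal_mul (by norm_num),
            ← ENNReal.ofReal_one]
          exact ENNReal.ofReal_le_ofReal (by linarith)
        rw [← mul_assoc]
        exact le_mul_of_one_le_left (by positivity) h2
    _ = 2 * ∫⁻ x in Φ '' S, h x := by
        rw [key, lintegral_const_mul' _ _ (by norm_num)]
    _ ≤ 2 * ∫⁻ x, h x := by
        gcongr
        exact Measure.restrict_le_self

/-- A test function at the end point of a segment that leaves the domain. -/
theorem sq_enorm_le_segment {φ : Plane → ℝ} (hφ : IsTest Ω φ) {x ν : Plane} (hν : ‖ν‖ ≤ 1) {R : ℝ}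
    (hR : 0 ≤ R) (hx : x + R • ν ∉ Ω) :
    ‖φ x‖ₑ ^ 2 ≤ ENNReal.ofReal R * ∫⁻ s in Icc 0 R, ‖gradient φ (x + s • ν)‖ₑ ^ 2 := by
  have hd : ∀ s : ℝ, HasDerivAt (fun s : ℝ => φ (x + s • ν))
      (inner ℝ (gradient φ (x + s • ν)) ν) s := fun s => by
    rw [inner_gradient]
    have h1 : HasDerivAt (fun s : ℝ => x + s • ν) ν s := by
      simpa using ((hasDerivAt_id s).smul_const ν).const_add x
    exact (hφ.1.differentiable (by simp) _).hasFDerivAt.comp_hasDerivAt s h1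
  have hcont : Continuous fun s : ℝ => gradient φ (x + s • ν) :=
    hφ.continuous_gradient.comp (by fun_prop)
  have hφR : φ (x + R • ν) = 0 := by
    by_contra hne
    exact hx (hφ.2.2 (subset_tsupport _ hne))
  have h1 := intervalIntegral.integral_eq_sub_of_hasDerivAt (a := 0) (b := R) (fun s _ => hd s)
    ((hcont.inner continuous_const).intervalIntegrable _ _)
  rw [hφR, zero_smul, add_zero, zero_sub, intervalIntegral.integral_of_le hR] at h1
  have h2 : ‖φ x‖ₑ ≤ eLpNorm (fun s : ℝ => gradient φ (x + s • ν)) 1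
      (volume.restrict (Icc 0 R)) := by
    rw [← enorm_neg, ← h1, eLpNorm_one_eq_lintegral_enorm]
    refine (enorm_integral_le_lintegral_enorm _).trans ?_
    rw [restrict_Ioc_eq_restrict_Icc]
    refine lintegral_mono fun s => ?_
    rw [enorm_le_iff_norm_le]
    refine (norm_inner_le_norm _ _).trans (mul_le_of_le_one_right (norm_nonneg _) hν)
  have h3 := eLpNorm_le_eLpNorm_mul_rpow_measure_univ (μ := volume.restrict (Icc 0 R)) (p := 1)
    (q := 2) (by norm_num) hcont.aestronglyMeasurable
  calc ‖φ x‖ₑ ^ 2 ≤ _ := pow_le_pow_left' (h2.trans h3) 2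
    _ = _ := by
      rw [mul_pow, eLpNorm_two_sq, ← ENNReal.rpow_natCast (_ ^ _), ← ENNReal.rpow_mul,
        Measure.restrict_apply_univ, Real.volume_Icc, mul_comm]
      norm_num

theorem trace_inequality_curve (hΩ : Bornology.IsBounded (closure Ω)) {c : ℝ → Plane}
    (hc : ContDiff ℝ 1 c) (L : ℝ) (hunit : ∀ t ∈ Icc 0 L, ‖deriv c t‖ = 1)
    (hmem : ∀ t ∈ Icc 0 L, c t ∈ closure Ω) :
    ∃ C : NNReal, ∀ φ, IsTest Ω φ →
      ∫⁻ t in Icc 0 L, ‖φ (c t)‖ₑ ^ 2 ≤ C * ∫⁻ x, ‖gradient φ x‖ₑ ^ 2 := by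
  have hcompact : IsCompact (Icc 0 L) := isCompact_Icc
  have main : ∃ C : NNReal, ∀ φ, IsTest Ω φ →
      ∫⁻ t in Icc 0 L ∩ Icc 0 L, ‖φ (c t)‖ₑ ^ 2 ≤ C * ∫⁻ x, ‖gradient φ x‖ₑ ^ 2 := by
    refine hcompact.induction_on (p := fun S => ∃ C : NNReal, ∀ φ, IsTest Ω φ →
      ∫⁻ t in S ∩ Icc 0 L, ‖φ (c t)‖ₑ ^ 2 ≤ C * ∫⁻ x, ‖gradient φ x‖ₑ ^ 2)
      ⟨0, fun φ _ => by simp⟩ ?_ ?_ ?_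
    · rintro S T hST ⟨C, hC⟩
      exact ⟨C, fun φ hφ => (lintegral_mono_set (inter_subset_inter_left _ hST)).trans (hC φ hφ)⟩
    · rintro S T ⟨C, hC⟩ ⟨C', hC'⟩
      refine ⟨C + C', fun φ hφ => ?_⟩
      rw [union_inter_distrib_right, ENNReal.coe_add, add_mul]
      exact (lintegral_union_le _ _ _).trans (add_le_add (hC φ hφ) (hC' φ hφ))
    · intro t₀ ht₀
      have hct : ContinuousAt (deriv c) t₀ := (hc.continuous_deriv le_rfl).continuousAt
      obtain ⟨δ, hδ, hδ'⟩ := Metric.continuousAt_iff.1 hct (1 / 2) (by norm_num)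
      -- the normal direction at `t₀` stays transversal nearby
      let τ := deriv c t₀
      let ν : Plane := !₂[-τ 1, τ 0]
      have hν : ‖ν‖ = 1 := by
        have h1 := hunit t₀ ht₀
        rw [EuclideanSpace.norm_eq, Fin.sum_univ_two] at h1 ⊢
        simp only [ν, τ, Matrix.cons_val_zero, Matrix.cons_val_one, norm_neg]
        rw [add_comm]
        exact h1
      let R := Metric.diam (closure Ω) + 1
      have hR : 0 ≤ R := by have := Metric.diam_nonneg (s := closure Ω); positivity
      refine ⟨Icc (t₀ - δ / 2) (t₀ + δ / 2), mem_nhdsWithin_of_mem_nhds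
        (Icc_mem_nhds (by linarith) (by linarith)), R.toNNReal * 2, fun φ hφ => ?_⟩
      rw [Icc_inter_Icc]
      have hmem' : ∀ t ∈ Icc (max (t₀ - δ / 2) 0) (min (t₀ + δ / 2) L),
          t ∈ Icc (t₀ - δ / 2) (t₀ + δ / 2) ∧ t ∈ Icc 0 L := fun t ht => by
        rwa [← mem_inter_iff, Icc_inter_Icc]
      have hdet : ∀ t ∈ Icc (max (t₀ - δ / 2) 0) (min (t₀ + δ / 2) L),
          1 / 2 ≤ deriv c t 0 * ν 1 - deriv c t 1 * ν 0 := by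
        intro t ht
        obtain ⟨ht, htL⟩ := hmem' t ht
        have h1 := hδ' (x := t) (by
          rw [Real.dist_eq, abs_lt]; constructor <;> linarith [ht.1, ht.2])
        have h2 : deriv c t 0 * ν 1 - deriv c t 1 * ν 0 = inner ℝ (deriv c t) τ := by
          simp [ν, PiLp.inner_apply, Fin.sum_univ_two]
          ring
        have h3 : (inner ℝ (deriv c t) τ : ℝ) = inner ℝ τ τ + inner ℝ (deriv c t - τ) τ := by
          rw [inner_sub_left]; ring
        have h4 := abs_real_inner_le_norm (deriv c t - τ) τ
        rw [hunit t₀ ht₀, mul_one] at h4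
        rw [dist_eq_norm] at h1
        rw [h2, h3, real_inner_self_eq_norm_sq, hunit t₀ ht₀]
        have := (abs_le.1 (h4.trans h1.le)).1
        linarith
      have hstrip := lintegral_strip_le hc ν _ _ R hdet (fun x => ‖gradient φ x‖ₑ ^ 2)
        (hφ.continuous_gradient.enorm.measurable.pow_const 2)
      have hout : ∀ t ∈ Icc 0 L, c t + R • ν ∉ Ω := fun t ht hin => by
        have h1 := Metric.dist_le_diam_of_mem hΩ (hmem t ht) (subset_closure hin)
        rw [dist_self_add_right, norm_smul, hν, mul_one, Real.norm_of_nonneg hR] at h1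
        linarith
      calc ∫⁻ t in Icc (max (t₀ - δ / 2) 0) (min (t₀ + δ / 2) L), ‖φ (c t)‖ₑ ^ 2
          ≤ ∫⁻ t in Icc (max (t₀ - δ / 2) 0) (min (t₀ + δ / 2) L),
              ENNReal.ofReal R * ∫⁻ s in Icc 0 R, ‖gradient φ (c t + s • ν)‖ₑ ^ 2 :=
            setLIntegral_mono' measurableSet_Icc fun t ht =>
              sq_enorm_le_segment hφ hν.le hR (hout t (hmem' t ht).2)
        _ ≤ ENNReal.ofReal R * (2 * ∫⁻ x, ‖gradient φ x‖ₑ ^ 2) := by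
            rw [lintegral_const_mul' _ _ ENNReal.ofReal_ne_top]
            gcongr
        _ = _ := by
            rw [ENNReal.coe_mul, mul_assoc]
            rfl
  simpa using main

theorem trace_inequality_of_isTest (hΩ : Bornology.IsBounded (closure Ω)) (Γ : Interfaces Ω) :
    ∃ C : NNReal, ∀ φ, IsTest Ω φ →
      eLpNorm φ 2 Γ.length ≤ C * eLpNorm (gradient φ) 2 (bulk Ω) := by
  choose C hC using fun i => trace_inequality_curve hΩ (Γ.contDiff i) (Γ.len i) (Γ.unit_speed i)
    (Γ.mem_closure i)
  -- the root turns the bound for the squares into one for the norms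
  refine ⟨(∑ i, C i) ^ (1 / 2 : ℝ), fun φ hφ => ?_⟩
  have h1 : eLpNorm φ 2 Γ.length ^ 2 ≤
      (∑ i, C i : NNReal) * eLpNorm (gradient φ) 2 (bulk Ω) ^ 2 := by
    rw [bulk, eLpNorm_restrict_eq_of_support_subset hφ.support_gradient, eLpNorm_two_sq,
      eLpNorm_two_sq, Interfaces.length, lintegral_finsetSum_measure, ENNReal.ofNNReal_finsetSum,
      Finset.sum_mul]
    refine Finset.sum_le_sum fun i _ => ?_
    rw [lintegral_map (hφ.1.continuous.enorm.measurable.pow_const 2)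
      (Γ.contDiff i).continuous.measurable]
    exact hC i φ hφ
  rw [← ENNReal.pow_le_pow_left_iff two_ne_zero, mul_pow]
  refine h1.trans_eq ?_
  congr 1
  rw [← ENNReal.coe_pow]
  congr 1
  rw [← NNReal.rpow_natCast, ← NNReal.rpow_mul]
  norm_num

/-- Bounds of test functions by their gradients pass to the limits that define the energy
space. -/
theorem eLpNorm_le_of_tendsto {μ : Measure Plane} {C : NNReal}
    (hC : ∀ φ, IsTest Ω φ → eLpNorm φ 2 μ ≤ C * eLpNorm (gradient φ) 2 (bulk Ω))
    {φ : ℕ → Plane → ℝ} (hφ : ∀ n, IsTest Ω (φ n)) {v : Plane → ℝ} {G : Plane → Plane}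
    (hv : AEStronglyMeasurable v μ) (hG : AEStronglyMeasurable G (bulk Ω))
    (h1 : Tendsto (fun n => eLpNorm (fun x => φ n x - v x) 2 μ) atTop (𝓝 0))
    (h2 : Tendsto (fun n => eLpNorm (fun x => gradient (φ n) x - G x) 2 (bulk Ω)) atTop (𝓝 0)) :
    eLpNorm v 2 μ ≤ C * eLpNorm G 2 (bulk Ω) := by
  have hlim : Tendsto (fun n => eLpNorm (fun x => φ n x - v x) 2 μ +
      C * (eLpNorm (fun x => gradient (φ n) x - G x) 2 (bulk Ω) + eLpNorm G 2 (bulk Ω))) atTop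
      (𝓝 (0 + C * (0 + eLpNorm G 2 (bulk Ω)))) :=
    h1.add (ENNReal.Tendsto.const_mul (h2.add tendsto_const_nhds) (Or.inr ENNReal.coe_ne_top))
  rw [zero_add, zero_add] at hlim
  refine ge_of_tendsto' hlim fun n => ?_
  have mφ := (hφ n).1.continuous.aestronglyMeasurable (μ := μ)
  have mg := (hφ n).continuous_gradient.aestronglyMeasurable (μ := bulk Ω)
  have h3 : eLpNorm v 2 μ ≤ eLpNorm (fun x => φ n x - v x) 2 μ + eLpNorm (φ n) 2 μ := by
    have := eLpNorm_sub_le (μ := μ) (p := 2) mφ (mφ.sub hv) (by norm_num)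
    rw [sub_sub_cancel, add_comm] at this
    exact this
  have h4 : eLpNorm (gradient (φ n)) 2 (bulk Ω) ≤
      eLpNorm (fun x => gradient (φ n) x - G x) 2 (bulk Ω) + eLpNorm G 2 (bulk Ω) := by
    have := eLpNorm_add_le (μ := bulk Ω) (p := 2) (mg.sub hG) hG (by norm_num)
    rw [sub_add_cancel] at this
    exact this
  exact h3.trans (by gcongr; exact (hC _ (hφ n)).trans (by gcongr))

/-- On the energy space the gradient controls the function and its trace. -/
theorem exists_poincare (hΩ : Bornology.IsBounded (closure Ω)) (Γ : Interfaces Ω) :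
    ∃ C : ℝ, 0 < C ∧ ∀ v : energySpace Γ, ‖val v‖ ≤ C * ‖grad v‖ ∧ ‖trace v‖ ≤ C * ‖grad v‖ := by
  obtain ⟨C₁, h₁⟩ := friedrichs_of_isTest (hΩ.subset subset_closure)
  obtain ⟨C₂, h₂⟩ := trace_inequality_of_isTest hΩ Γ
  refine ⟨C₁ + C₂ + 1, by positivity, fun v => ?_⟩
  obtain ⟨⟨φ, hφ, a₁, a₂, a₃⟩, -⟩ := v.2
  have b₁ := eLpNorm_le_of_tendsto h₁ hφ (Lp.aestronglyMeasurable (val v))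
    (Lp.aestronglyMeasurable (grad v)) a₁ a₂
  have b₂ := eLpNorm_le_of_tendsto h₂ hφ (Lp.aestronglyMeasurable (trace v))
    (Lp.aestronglyMeasurable (grad v)) a₃ a₂
  have c₁ : ‖val v‖ ≤ C₁ * ‖grad v‖ := by
    rw [Lp.norm_def, Lp.norm_def]
    simpa using ENNReal.toReal_mono
      (ENNReal.mul_ne_top ENNReal.coe_ne_top (Lp.eLpNorm_ne_top _)) b₁
  have c₂ : ‖trace v‖ ≤ C₂ * ‖grad v‖ := by
    rw [Lp.norm_def, Lp.norm_def]
    simpa using ENNReal.toReal_mono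
      (ENNReal.mul_ne_top ENNReal.coe_ne_top (Lp.eLpNorm_ne_top _)) b₂
  have h0 := norm_nonneg (grad v)
  have p₁ := mul_nonneg C₁.2 h0
  have p₂ := mul_nonneg C₂.2 h0
  constructor
  · refine c₁.trans ?_
    have : (C₁ + C₂ + 1 : ℝ) * ‖grad v‖ = C₁ * ‖grad v‖ + C₂ * ‖grad v‖ + ‖grad v‖ := by ring
    rw [this]
    have : (0 : ℝ) ≤ C₂ * ‖grad v‖ := p₂
    linarith
  · refine c₂.trans ?_
    have : (C₁ + C₂ + 1 : ℝ) * ‖grad v‖ = C₁ * ‖grad v‖ + C₂ * ‖grad v‖ + ‖grad v‖ := by ring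
    rw [this]
    have : (0 : ℝ) ≤ C₁ * ‖grad v‖ := p₁
    linarith

end LOD

/-! ### The energy space is closed -/

namespace LOD

variable {Ω : Set Plane} {Γ : Interfaces Ω}

theorem hasGradientAndTrace_of_forall {v : Plane → ℝ} {G : Plane → Plane} {g : Plane → ℝ}
    (h : ∀ ε : ℝ≥0∞, 0 < ε → ∃ φ, IsTest Ω φ ∧ eLpNorm (fun x => φ x - v x) 2 (bulk Ω) ≤ ε ∧
      eLpNorm (fun x => gradient φ x - G x) 2 (bulk Ω) ≤ ε ∧
      eLpNorm (fun x => φ x - g x) 2 Γ.length ≤ ε) : HasGradientAndTrace Γ v G g := by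
  choose φ hφ h1 h2 h3 using fun n : ℕ => h ((n : ℝ≥0∞)⁻¹) (by simp)
  have key : ∀ u : ℕ → ℝ≥0∞, (∀ n, u n ≤ (n : ℝ≥0∞)⁻¹) → Tendsto u atTop (𝓝 0) := fun u hu =>
    tendsto_of_tendsto_of_tendsto_of_le_of_le tendsto_const_nhds
      ENNReal.tendsto_inv_nat_nhds_zero (fun _ => zero_le) hu
  exact ⟨φ, hφ, key _ h1, key _ h2, key _ h3⟩

theorem HasGradientAndTrace.exists_test {v : Plane → ℝ} {G : Plane → Plane} {g : Plane → ℝ}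
    (h : HasGradientAndTrace Γ v G g) {ε : ℝ≥0∞} (hε : 0 < ε) :
    ∃ φ, IsTest Ω φ ∧ eLpNorm (fun x => φ x - v x) 2 (bulk Ω) ≤ ε ∧
      eLpNorm (fun x => gradient φ x - G x) 2 (bulk Ω) ≤ ε ∧
      eLpNorm (fun x => φ x - g x) 2 Γ.length ≤ ε := by
  obtain ⟨φ, hφ, h1, h2, h3⟩ := h
  obtain ⟨n, h⟩ := ((h1.eventually (ge_mem_nhds hε)).and ((h2.eventually (ge_mem_nhds hε)).and
    (h3.eventually (ge_mem_nhds hε)))).exists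
  exact ⟨φ n, hφ n, h⟩

theorem Interfaces.memLp_comp_curve {E : Type*} [NormedAddCommGroup E] (i : Fin Γ.num)
    (f : Lp E 2 Γ.length) :
    MemLp (fun s => f (Γ.curve i s)) 2 (volume.restrict (Icc 0 (Γ.len i))) :=
  ((Lp.memLp f).mono_measure (Γ.map_le_length i)).comp_of_map (Γ.contDiff i).continuous.aemeasurable

theorem Interfaces.eLpNorm_comp_curve_le {E : Type*} [NormedAddCommGroup E] (i : Fin Γ.num)
    {f : Plane → E} (hf : AEStronglyMeasurable f Γ.length) :
    eLpNorm (fun s => f (Γ.curve i s)) 2 (volume.restrict (Icc 0 (Γ.len i))) ≤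
      eLpNorm f 2 Γ.length := by
  have h := eLpNorm_map_measure (p := 2) (hf.mono_measure (Γ.map_le_length i))
    (Γ.contDiff i).continuous.aemeasurable
  exact h.symm.trans_le (eLpNorm_mono_measure _ (Γ.map_le_length i))

theorem Interfaces.integral_norm_sub_curve_le {E : Type*} [NormedAddCommGroup E] (i : Fin Γ.num)
    (f g : Lp E 2 Γ.length) :
    ∫ s in Icc 0 (Γ.len i), ‖f (Γ.curve i s) - g (Γ.curve i s)‖ ≤ √(Γ.len i) * ‖f - g‖ := by
  set μ := volume.restrict (Icc 0 (Γ.len i))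
  have m := (Γ.memLp_comp_curve i f).sub (Γ.memLp_comp_curve i g)
  have h1 := eLpNorm_le_eLpNorm_mul_rpow_measure_univ (μ := μ) (p := 1) (q := 2) (by norm_num)
    m.aestronglyMeasurable
  have h2 := Γ.eLpNorm_comp_curve_le i ((Lp.aestronglyMeasurable f).sub (Lp.aestronglyMeasurable g))
  have h3 : eLpNorm (⇑f - ⇑g) 2 Γ.length = eLpNorm (⇑(f - g)) 2 Γ.length :=
    eLpNorm_congr_ae (Lp.coeFn_sub f g).symm
  rw [h3] at h2
  have h4 := h1.trans (mul_le_mul_left h2 _)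
  have h5 := ENNReal.toReal_mono (ENNReal.mul_ne_top (Lp.eLpNorm_ne_top _) 
    (ENNReal.rpow_ne_top_of_nonneg (by norm_num) (measure_ne_top _ _))) h4
  rw [eLpNorm_one_eq_lintegral_enorm, ← integral_norm_eq_lintegral_enorm m.aestronglyMeasurable,
    ENNReal.toReal_mul, ← Lp.norm_def] at h5
  refine h5.trans_eq ?_
  rw [mul_comm, ← ENNReal.toReal_rpow, Measure.restrict_apply_univ, Real.volume_Icc, sub_zero,
    ENNReal.toReal_ofReal (Γ.len_pos i).le, Real.sqrt_eq_rpow]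
  norm_num

/-- `h` restricted to the `i`-th curve is the integral of the tangential part of `D`. -/
def IsPrimitive (Γ : Interfaces Ω) (h : Plane → ℝ) (D : Plane → Plane) : Prop :=
  ∀ i, ∀ t ∈ Icc 0 (Γ.len i), h (Γ.curve i t) =
    h (Γ.curve i 0) + ∫ s in (0 : ℝ)..t, inner ℝ (D (Γ.curve i s)) (deriv (Γ.curve i) s)

theorem Interfaces.intervalIntegrable_inner (Γ : Interfaces Ω) (i : Fin Γ.num)
    (D : Lp Plane 2 Γ.length) {a b : ℝ} (ha : a ∈ Icc 0 (Γ.len i)) (hb : b ∈ Icc 0 (Γ.len i)) :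
    IntervalIntegrable (fun s => (inner ℝ (D (Γ.curve i s)) (deriv (Γ.curve i) s) : ℝ))
      volume a b := by
  rw [intervalIntegrable_iff]
  refine (Γ.integrable_inner i D).mono_set (uIoc_subset_uIcc.trans ?_)
  exact uIcc_subset_Icc ha hb

theorem Interfaces.abs_integral_inner_sub_le (Γ : Interfaces Ω) (i : Fin Γ.num)
    (D B : Lp Plane 2 Γ.length) {a b : ℝ} (ha : a ∈ Icc 0 (Γ.len i)) (hb : b ∈ Icc 0 (Γ.len i)) :
    |(∫ s in a..b, inner ℝ (D (Γ.curve i s)) (deriv (Γ.curve i) s)) -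
      ∫ s in a..b, inner ℝ (B (Γ.curve i s)) (deriv (Γ.curve i) s)| ≤
      √(Γ.len i) * ‖D - B‖ := by
  rw [← intervalIntegral.integral_sub (Γ.intervalIntegrable_inner i D ha hb)
    (Γ.intervalIntegrable_inner i B ha hb), ← Real.norm_eq_abs]
  refine (intervalIntegral.norm_integral_le_integral_norm_uIoc).trans ?_
  refine le_trans ?_ (Γ.integral_norm_sub_curve_le i D B)
  have hsub : uIoc a b ⊆ Icc 0 (Γ.len i) := uIoc_subset_uIcc.trans (uIcc_subset_Icc ha hb)
  have m : IntegrableOn (fun s => ‖D (Γ.curve i s) - B (Γ.curve i s)‖) (Icc 0 (Γ.len i)) :=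
    (((Γ.memLp_comp_curve i D).sub (Γ.memLp_comp_curve i B)).integrable (by norm_num)).norm
  calc _ ≤ ∫ s in uIoc a b, ‖D (Γ.curve i s) - B (Γ.curve i s)‖ := by
        refine setIntegral_mono_on ?_ (m.mono_set hsub) measurableSet_uIoc fun s hs => ?_
        · exact (((Γ.integrable_inner i D).mono_set hsub).sub
            ((Γ.integrable_inner i B).mono_set hsub)).norm
        · rw [← inner_sub_left]
          refine (norm_inner_le_norm _ _).trans_eq ?_
          rw [Γ.unit_speed i s (hsub hs), mul_one]
    _ ≤ _ := setIntegral_mono_set m (ae_of_all _ fun s => norm_nonneg _) hsub.eventuallyLE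

theorem Interfaces.ae_mem_carrier (Γ : Interfaces Ω) : ∀ᵐ x ∂Γ.length, x ∈ Γ.carrier := by
  have hm : MeasurableSet Γ.carrier := by
    refine MeasurableSet.iUnion fun i => ?_
    exact (isCompact_Icc.image (Γ.contDiff i).continuous).isClosed.measurableSet
  rw [ae_iff, show {x | x ∉ Γ.carrier} = Γ.carrierᶜ from rfl, Interfaces.length,
    Measure.finsetSum_apply]
  refine Finset.sum_eq_zero fun i _ => ?_
  rw [Measure.map_apply (Γ.contDiff i).continuous.measurable hm.compl,
    Measure.restrict_apply ((Γ.contDiff i).continuous.measurable hm.compl)]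
  convert measure_empty (μ := (volume : Measure ℝ))
  ext t
  simp only [preimage_compl, mem_inter_iff, mem_compl_iff, mem_preimage, mem_empty_iff_false,
    iff_false, not_and]
  exact fun h ht => h (mem_iUnion.2 ⟨i, t, ht, rfl⟩)

/-- The continuous representatives depend on trace and tangential gradient in a Lipschitz manner,
with respect to the maximum norm. -/
theorem abs_sub_le_of_isPrimitive {g₁ g₂ : Lp ℝ 2 Γ.length} {D₁ D₂ : Lp Plane 2 Γ.length}
    {h₁ h₂ : Plane → ℝ} (e₁ : g₁ =ᵐ[Γ.length] h₁) (e₂ : g₂ =ᵐ[Γ.length] h₂)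
    (p₁ : IsPrimitive Γ h₁ D₁) (p₂ : IsPrimitive Γ h₂ D₂) {x : Plane} (hx : x ∈ Γ.carrier) :
    |h₁ x - h₂ x| ≤ ∑ i, ((Γ.len i)⁻¹ + 1) * √(Γ.len i) * (‖g₁ - g₂‖ + ‖D₁ - D₂‖) := by
  obtain ⟨i, s, hs, rfl⟩ := mem_iUnion.1 hx
  have hL := Γ.len_pos i
  have h0 : (0 : ℝ) ∈ Icc 0 (Γ.len i) := ⟨le_rfl, hL.le⟩
  set K := √(Γ.len i) * ‖D₁ - D₂‖
  set c := Γ.curve i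
  have hst : ∀ t ∈ Icc 0 (Γ.len i), |h₁ (c s) - h₂ (c s)| ≤ |h₁ (c t) - h₂ (c t)| + K := by
    intro t ht
    have h3 := Γ.abs_integral_inner_sub_le i D₁ D₂ ht hs
    rw [← intervalIntegral.integral_interval_sub_left (Γ.intervalIntegrable_inner i D₁ h0 hs)
      (Γ.intervalIntegrable_inner i D₁ h0 ht), ← intervalIntegral.integral_interval_sub_left
      (Γ.intervalIntegrable_inner i D₂ h0 hs) (Γ.intervalIntegrable_inner i D₂ h0 ht)] at h3
    have a1 := p₁ i s hs
    have a2 := p₁ i t ht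
    have a3 := p₂ i s hs
    have a4 := p₂ i t ht
    have e : h₁ (c s) - h₂ (c s) = (h₁ (c t) - h₂ (c t)) + ((h₁ (c s) - h₁ (c t)) -
      (h₂ (c s) - h₂ (c t))) := by ring
    rw [e]
    refine (abs_add_le _ _).trans (add_le_add le_rfl ?_)
    rw [a1, a2, a3, a4]
    refine le_trans (le_of_eq ?_) h3
    congr 1
    ring
  have hint : IntegrableOn (fun t => |h₁ (c t) - h₂ (c t)|) (Icc 0 (Γ.len i)) ∧
      ∫ t in Icc 0 (Γ.len i), |h₁ (c t) - h₂ (c t)| ≤ √(Γ.len i) * ‖g₁ - g₂‖ := by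
    have e : (fun t => ‖g₁ (c t) - g₂ (c t)‖) =ᵐ[volume.restrict (Icc 0 (Γ.len i))]
        fun t => |h₁ (c t) - h₂ (c t)| := by
      filter_upwards [Γ.ae_curve i e₁, Γ.ae_curve i e₂] with t b1 b2
      rw [b1, b2, Real.norm_eq_abs]
    have m : IntegrableOn (fun s => ‖g₁ (c s) - g₂ (c s)‖) (Icc 0 (Γ.len i)) :=
      (((Γ.memLp_comp_curve i g₁).sub (Γ.memLp_comp_curve i g₂)).integrable (by norm_num)).norm
    exact ⟨m.congr e, (integral_congr_ae e).symm.trans_le (Γ.integral_norm_sub_curve_le i g₁ g₂)⟩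
  have h4 : Γ.len i * |h₁ (c s) - h₂ (c s)| ≤ √(Γ.len i) * ‖g₁ - g₂‖ + Γ.len i * K := by
    have h5 := setIntegral_mono_on (μ := volume) (s := Icc 0 (Γ.len i))
      (f := fun _ => |h₁ (c s) - h₂ (c s)|) (g := fun t => |h₁ (c t) - h₂ (c t)| + K)
      (integrable_const _) (hint.1.add (integrable_const _)) measurableSet_Icc hst
    rw [integral_add hint.1 (integrable_const _)] at h5
    simp only [integral_const, measureReal_restrict_apply_univ, Real.volume_real_Icc, sub_zero,
      max_eq_left hL.le, smul_eq_mul] at h5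
    linarith [hint.2]
  have h6 : |h₁ (c s) - h₂ (c s)| ≤ ((Γ.len i)⁻¹ + 1) * √(Γ.len i) * (‖g₁ - g₂‖ + ‖D₁ - D₂‖) := by
    have h7 : |h₁ (c s) - h₂ (c s)| ≤ (Γ.len i)⁻¹ * (√(Γ.len i) * ‖g₁ - g₂‖) + K := by
      rw [← mul_le_mul_iff_right₀ hL]
      refine h4.trans_eq ?_
      field_simp
    have p1 : 0 ≤ (Γ.len i)⁻¹ * (√(Γ.len i) * ‖D₁ - D₂‖) := by positivity
    have p2 : 0 ≤ √(Γ.len i) * ‖g₁ - g₂‖ := by positivity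
    simp only [K] at h7
    linarith
  refine h6.trans ?_
  exact Finset.single_le_sum
    (f := fun i => ((Γ.len i)⁻¹ + 1) * √(Γ.len i) * (‖g₁ - g₂‖ + ‖D₁ - D₂‖))
    (fun j _ => by have := Γ.len_pos j; positivity) (Finset.mem_univ i)

theorem exists_seq_tendsto_ae_of_tendsto_Lp {E : Type*} [NormedAddCommGroup E]
    {μ : Measure Plane} {f : ℕ → Lp E 2 μ} {g : Lp E 2 μ} (h : Tendsto f atTop (𝓝 g)) :
    ∃ ns : ℕ → ℕ, StrictMono ns ∧
      ∀ᵐ x ∂μ, Tendsto (fun n => f (ns n) x) atTop (𝓝 (g x)) :=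
  (tendstoInMeasure_of_tendsto_Lp h).exists_seq_tendsto_ae

theorem hasTangentialGradient_of_tendsto {g : ℕ → Lp ℝ 2 Γ.length} {D : ℕ → Lp Plane 2 Γ.length}
    {g₀ : Lp ℝ 2 Γ.length} {D₀ : Lp Plane 2 Γ.length}
    (h : ∀ n, HasTangentialGradient Γ (g n) (D n)) (hg : Tendsto g atTop (𝓝 g₀))
    (hD : Tendsto D atTop (𝓝 D₀)) : HasTangentialGradient Γ g₀ D₀ := by
  obtain ⟨ns, hns, hae⟩ := exists_seq_tendsto_ae_of_tendsto_Lp hg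
  obtain ⟨ms, hms, hae'⟩ := exists_seq_tendsto_ae_of_tendsto_Lp (hD.comp hns.tendsto_atTop)
  replace hae : ∀ᵐ x ∂Γ.length, Tendsto (fun n => g (ns (ms n)) x) atTop (𝓝 (g₀ x)) := by
    filter_upwards [hae] with x hx using hx.comp hms.tendsto_atTop
  have hsub := (hns.comp hms).tendsto_atTop
  replace hg := hg.comp hsub
  replace hD := hD.comp hsub
  choose f fc fe fp ft using fun n => (h (ns (ms n))).imp fun f hf =>
    show ContinuousOn f Γ.carrier ∧ g (ns (ms n)) =ᵐ[Γ.length] f ∧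
      IsPrimitive Γ f (D (ns (ms n))) ∧ ∀ i, ∀ᵐ s ∂(volume.restrict (Icc 0 (Γ.len i))),
        D (ns (ms n)) (Γ.curve i s) = (inner ℝ (D (ns (ms n)) (Γ.curve i s))
          (deriv (Γ.curve i) s) : ℝ) • deriv (Γ.curve i) s from
      ⟨hf.1, hf.2.1, fun i => (hf.2.2 i).1, fun i => (hf.2.2 i).2⟩
  set g' := fun n => g (ns (ms n)) with hg'
  set D' := fun n => D (ns (ms n)) with hD'
  change Tendsto g' atTop _ at hg
  change Tendsto D' atTop _ at hD
  set K := ∑ i, ((Γ.len i)⁻¹ + 1) * √(Γ.len i)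
  have hbound : ∀ m n, ∀ x ∈ Γ.carrier, |f m x - f n x| ≤
      K * (‖g' m - g' n‖ + ‖D' m - D' n‖) := fun m n x hx => by
    rw [Finset.sum_mul]
    exact abs_sub_le_of_isPrimitive (fe m) (fe n) (fp m) (fp n) hx
  have hcauchy : UniformCauchySeqOn f atTop Γ.carrier := by
    rw [Metric.uniformCauchySeqOn_iff]
    intro ε hε
    have hK : 0 ≤ K := Finset.sum_nonneg fun j _ => by have := Γ.len_pos j; positivity
    obtain ⟨N₁, h₁⟩ := Metric.cauchySeq_iff.1 hg.cauchySeq (ε / (2 * (K + 1))) (by positivity)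
    obtain ⟨N₂, h₂⟩ := Metric.cauchySeq_iff.1 hD.cauchySeq (ε / (2 * (K + 1))) (by positivity)
    refine ⟨max N₁ N₂, fun m hm n hn x hx => ?_⟩
    have a₁ := h₁ m (le_of_max_le_left hm) n (le_of_max_le_left hn)
    have a₂ := h₂ m (le_of_max_le_right hm) n (le_of_max_le_right hn)
    rw [dist_eq_norm] at a₁ a₂
    rw [Real.dist_eq]
    calc |f m x - f n x| ≤ K * (‖g' m - g' n‖ + ‖D' m - D' n‖) := hbound m n x hx
      _ ≤ K * (ε / (2 * (K + 1)) + ε / (2 * (K + 1))) := by gcongr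
      _ < ε := by
        rw [← sub_pos]
        have : ε - K * (ε / (2 * (K + 1)) + ε / (2 * (K + 1))) = ε / (K + 1) := by
          field_simp; ring
        rw [this]; positivity
  have hlim : ∀ x, ∃ y, x ∈ Γ.carrier → Tendsto (fun n => f n x) atTop (𝓝 y) := fun x => by
    by_cases hx : x ∈ Γ.carrier
    · obtain ⟨y, hy⟩ := cauchySeq_tendsto_of_complete (hcauchy.cauchySeq hx)
      exact ⟨y, fun _ => hy⟩
    · exact ⟨0, fun h => absurd h hx⟩
  choose f₀ hf₀ using hlim
  have hunif : TendstoUniformlyOn f f₀ atTop Γ.carrier :=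
    hcauchy.tendstoUniformlyOn_of_tendsto fun x hx => hf₀ x hx
  refine ⟨f₀, hunif.continuousOn (Frequently.of_forall fc), ?_, fun i => ⟨fun t ht => ?_, ?_⟩⟩
  · filter_upwards [hae, Γ.ae_mem_carrier, ae_all_iff.2 fe] with x h1 h2 h3
    exact tendsto_nhds_unique h1 ((hf₀ x h2).congr fun n => (h3 n).symm)
  · have h0 : (0 : ℝ) ∈ Icc 0 (Γ.len i) := ⟨le_rfl, (Γ.len_pos i).le⟩
    have hc : ∀ s ∈ Icc 0 (Γ.len i), Γ.curve i s ∈ Γ.carrier := fun s hs =>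
      mem_iUnion.2 ⟨i, s, hs, rfl⟩
    have h1 : Tendsto (fun n => ∫ s in (0 : ℝ)..t, (inner ℝ (D' n (Γ.curve i s))
        (deriv (Γ.curve i) s) : ℝ)) atTop
        (𝓝 (∫ s in (0 : ℝ)..t, (inner ℝ (D₀ (Γ.curve i s)) (deriv (Γ.curve i) s) : ℝ))) := by
      rw [tendsto_iff_norm_sub_tendsto_zero]
      refine squeeze_zero (fun _ => norm_nonneg _)
        (fun n => Γ.abs_integral_inner_sub_le i (D' n) D₀ h0 ht) ?_
      simpa using (tendsto_iff_norm_sub_tendsto_zero.1 hD).const_mul (√(Γ.len i))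
    exact tendsto_nhds_unique (hf₀ _ (hc t ht))
      (((hf₀ _ (hc 0 h0)).add h1).congr fun n => (fp n i t ht).symm)
  · filter_upwards [Γ.ae_curve i hae', ae_all_iff.2 fun n => ft n i] with s h1 h2
    refine tendsto_nhds_unique h1 (Tendsto.congr (fun n => (h2 n).symm) ?_)
    exact (h1.inner tendsto_const_nhds).smul_const _

theorem isClosed_energySpace (Γ : Interfaces Ω) : IsClosed (energySpace Γ : Set (Ambient Γ)) := by
  refine IsSeqClosed.isClosed fun w w₀ hw hlim => ?_
  have l1 : Tendsto (fun n => (w n).1) atTop (𝓝 w₀.1) := (continuous_fst.tendsto _).comp hlim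
  have l2 : Tendsto (fun n => (w n).2.1) atTop (𝓝 w₀.2.1) :=
    ((continuous_fst.comp continuous_snd).tendsto _).comp hlim
  have l3 : Tendsto (fun n => (w n).2.2.1) atTop (𝓝 w₀.2.2.1) :=
    ((continuous_fst.comp (continuous_snd.comp continuous_snd)).tendsto _).comp hlim
  have l4 : Tendsto (fun n => (w n).2.2.2) atTop (𝓝 w₀.2.2.2) :=
    ((continuous_snd.comp (continuous_snd.comp continuous_snd)).tendsto _).comp hlim
  refine ⟨hasGradientAndTrace_of_forall fun ε hε => ?_,
    hasTangentialGradient_of_tendsto (fun n => (hw n).2) l3 l4⟩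
  have hε2 : 0 < ε / 2 := ENNReal.half_pos hε.ne'
  have key : ∀ {E : Type} [NormedAddCommGroup E] {μ : Measure Plane} {f : ℕ → Lp E 2 μ}
      {f₀ : Lp E 2 μ}, Tendsto f atTop (𝓝 f₀) →
      ∀ᶠ n in atTop, eLpNorm (fun x => f n x - f₀ x) 2 μ ≤ ε / 2 := fun h =>
    ((Lp.tendsto_Lp_iff_tendsto_eLpNorm' _ _).1 h).eventually (ge_mem_nhds hε2)
  obtain ⟨n, k1, k2, k3⟩ := ((key l1).and ((key l2).and (key l3))).exists
  obtain ⟨φ, hφ, b1, b2, b3⟩ := (hw n).1.exists_test hε2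
  have tri : ∀ {E : Type} [NormedAddCommGroup E] {μ : Measure Plane} {p : Plane → E}
      {f f₀ : Lp E 2 μ}, AEStronglyMeasurable p μ → eLpNorm (fun x => p x - f x) 2 μ ≤ ε / 2 →
      eLpNorm (fun x => f x - f₀ x) 2 μ ≤ ε / 2 → eLpNorm (fun x => p x - f₀ x) 2 μ ≤ ε := by
    intro E _ μ p f f₀ hp h1 h2
    have := eLpNorm_add_le (μ := μ) (p := 2) (hp.sub (Lp.aestronglyMeasurable f))
      ((Lp.aestronglyMeasurable f).sub (Lp.aestronglyMeasurable f₀)) (by norm_num)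
    rw [sub_add_sub_cancel] at this
    exact this.trans ((add_le_add h1 h2).trans_eq (ENNReal.add_halves ε))
  exact ⟨φ, hφ, tri hφ.1.continuous.aestronglyMeasurable b1 k1,
    tri hφ.continuous_gradient.aestronglyMeasurable b2 k2,
    tri hφ.1.continuous.aestronglyMeasurable b3 k3⟩

end LOD

/-! ### Locality of the gradients -/

namespace LOD

variable {Ω : Set Plane} {Γ : Interfaces Ω}

theorem IsTest.memLp {φ : Plane → ℝ} (h : IsTest Ω φ) (μ : Measure Plane)
    [IsFiniteMeasureOnCompacts μ] : MemLp φ 2 μ :=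
  h.1.continuous.memLp_of_hasCompactSupport h.2.1

theorem IsTest.hasCompactSupport_gradient {φ : Plane → ℝ} (h : IsTest Ω φ) :
    HasCompactSupport (gradient φ) :=
  h.2.1.mono' fun x hx => support_fderiv_subset ℝ fun h0 => hx (by simp [gradient, h0])

theorem IsTest.memLp_gradient {φ : Plane → ℝ} (h : IsTest Ω φ) (μ : Measure Plane)
    [IsFiniteMeasureOnCompacts μ] : MemLp (gradient φ) 2 μ :=
  h.continuous_gradient.memLp_of_hasCompactSupport h.hasCompactSupport_gradient

instance : IsFiniteMeasureOnCompacts (bulk Ω) := by unfold bulk; infer_instance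

theorem integral_bulk_eq {F : Type*} [NormedAddCommGroup F] [NormedSpace ℝ F] {f : Plane → F}
    (h : Function.support f ⊆ Ω) : ∫ x, f x ∂(bulk Ω) = ∫ x, f x :=
  setIntegral_eq_integral_of_forall_compl_eq_zero fun x hx => by
    by_contra hne
    exact hx (h hne)

theorem IsTest.integral_by_parts {φ ψ : Plane → ℝ} (hφ : IsTest Ω φ) (hψ : IsTest Ω ψ)
    (e : Plane) : ∫ x, inner ℝ (gradient φ x) (ψ x • e) ∂(bulk Ω) =
      -∫ x, φ x * inner ℝ (gradient ψ x) e ∂(bulk Ω) := by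
  have dφ : Differentiable ℝ φ := hφ.1.differentiable (by simp)
  have dψ : Differentiable ℝ ψ := hψ.1.differentiable (by simp)
  have cφ : Continuous fun x => fderiv ℝ φ x e :=
    (hφ.1.continuous_fderiv (by simp)).clm_apply continuous_const
  have cψ : Continuous fun x => fderiv ℝ ψ x e :=
    (hψ.1.continuous_fderiv (by simp)).clm_apply continuous_const
  have key := integral_mul_fderiv_eq_neg_fderiv_mul_of_integrable (μ := (volume : Measure Plane))
    (f := φ) (g := ψ) (v := e)
    ((cφ.mul hψ.1.continuous).integrable_of_hasCompactSupport hψ.2.1.mul_left)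
    ((hφ.1.continuous.mul cψ).integrable_of_hasCompactSupport hφ.2.1.mul_right)
    ((hφ.1.continuous.mul hψ.1.continuous).integrable_of_hasCompactSupport hφ.2.1.mul_right)
    (fun x _ => dφ x) (fun x _ => dψ x)
  simp only [real_inner_smul_right, inner_gradient]
  rw [integral_bulk_eq, integral_bulk_eq, key, neg_neg]
  · simp only [mul_comm]
  · intro x hx
    exact hφ.2.2 (subset_tsupport _ (left_ne_zero_of_mul hx))
  · intro x hx
    exact hψ.2.2 (subset_tsupport _ (left_ne_zero_of_mul hx))

/-- The weak gradient is the distributional gradient. -/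
theorem integral_grad (v : energySpace Γ) {ψ : Plane → ℝ} (hψ : IsTest Ω ψ) (e : Plane) :
    ∫ x, inner ℝ (grad v x) (ψ x • e) ∂(bulk Ω) =
      -∫ x, val v x * inner ℝ (gradient ψ x) e ∂(bulk Ω) := by
  obtain ⟨⟨φ, hφ, a₁, a₂, -⟩, -⟩ := v.2
  have m₁ : MemLp (fun x => ψ x • e) 2 (bulk Ω) :=
    (hψ.1.continuous.smul continuous_const).memLp_of_hasCompactSupport hψ.2.1.smul_right
  have m₂ : MemLp (fun x => (inner ℝ (gradient ψ x) e : ℝ)) 2 (bulk Ω) :=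
    (hψ.continuous_gradient.inner continuous_const).memLp_of_hasCompactSupport
      (hψ.hasCompactSupport_gradient.mono fun x hx h0 => hx (by simp [h0]))
  have conv : ∀ {E : Type} [NormedAddCommGroup E] [InnerProductSpace ℝ E] {f : ℕ → Plane → E}
      {f₀ : Lp E 2 (bulk Ω)} {g : Plane → E} (hf : ∀ n, MemLp (f n) 2 (bulk Ω))
      (hg : MemLp g 2 (bulk Ω)),
      Tendsto (fun n => eLpNorm (fun x => f n x - f₀ x) 2 (bulk Ω)) atTop (𝓝 0) →
      Tendsto (fun n => ∫ x, inner ℝ (f n x) (g x) ∂(bulk Ω)) atTop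
        (𝓝 (∫ x, inner ℝ (f₀ x) (g x) ∂(bulk Ω))) := by
    intro E _ _ f f₀ g hf hg h
    have h1 : Tendsto (fun n => (hf n).toLp) atTop (𝓝 f₀) := by
      rw [Lp.tendsto_Lp_iff_tendsto_eLpNorm']
      refine h.congr fun n => eLpNorm_congr_ae ?_
      filter_upwards [(hf n).coeFn_toLp] with x hx
      rw [Pi.sub_apply, hx]
    have h2 : Tendsto (fun n => inner ℝ (hf n).toLp hg.toLp) atTop (𝓝 (inner ℝ f₀ hg.toLp)) :=
      h1.inner tendsto_const_nhds
    simp only [L2.inner_def] at h2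
    have e₀ : ∫ x, inner ℝ (f₀ x) ((hg.toLp : Lp E 2 (bulk Ω)) x) ∂(bulk Ω) =
        ∫ x, inner ℝ (f₀ x) (g x) ∂(bulk Ω) :=
      integral_congr_ae (by filter_upwards [hg.coeFn_toLp] with x hx; rw [hx])
    rw [e₀] at h2
    refine h2.congr fun n => integral_congr_ae ?_
    filter_upwards [hg.coeFn_toLp, (hf n).coeFn_toLp] with x hx hx'
    rw [hx, hx']
  have c₁ := conv (fun n => IsTest.memLp_gradient (hφ n) _) m₁ a₂
  have c₂ := (conv (fun n => IsTest.memLp (hφ n) _) m₂ a₁).neg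
  refine tendsto_nhds_unique c₁ ?_
  refine Tendsto.congr (fun n => ?_) (c₂.trans (le_of_eq ?_))
  · rw [IsTest.integral_by_parts (hφ n) hψ e]
    simp [mul_comm]
  · simp [mul_comm]
    rfl

theorem ae_grad_eq_zero (hΩ : IsOpen Ω) (v : energySpace Γ) {S : Set Plane} (hS : IsClosed S)
    (hv : ∀ᵐ x ∂(bulk Ω), x ∉ S → val v x = 0) : ∀ᵐ x ∂(bulk Ω), x ∉ S → grad v x = 0 := by
  have hU : IsOpen (Ω \ S) := hΩ.sdiff hS
  have h := hU.ae_eq_zero_of_integral_contDiff_smul_eq_zero (μ := bulk Ω) (f := grad v)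
    (((Lp.memLp (grad v)).locallyIntegrable (by norm_num)).locallyIntegrableOn _)
    fun ψ hψ hψc hψs => by
      have hψ' : IsTest Ω ψ := ⟨hψ, hψc, hψs.trans sdiff_subset⟩
      have hint : Integrable (fun x => ψ x • grad v x) (bulk Ω) :=
        memLp_one_iff_integrable.1 ((Lp.memLp (grad v)).smul (hψ'.memLp _))
      refine ext_inner_left ℝ fun e => ?_
      rw [inner_zero_right, ← integral_inner hint]
      have h1 := integral_grad v hψ' e
      have h2 : ∫ x, val v x * inner ℝ (gradient ψ x) e ∂(bulk Ω) = 0 := by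
        refine integral_eq_zero_of_ae ?_
        filter_upwards [hv] with x hx
        by_cases hxS : x ∈ S
        · have : gradient ψ x = 0 := by
            by_contra hne
            have : fderiv ℝ ψ x ≠ 0 := fun h0 => hne (by simp [gradient, h0])
            exact (hψs (support_fderiv_subset ℝ this)).2 hxS
          simp [this]
        · simp [hx hxS]
      rw [h2, neg_zero] at h1
      rw [← h1]
      refine integral_congr_ae (ae_of_all _ fun x => ?_)
      simp only [real_inner_smul_right]
      rw [real_inner_comm]
  filter_upwards [h, ae_restrict_mem hΩ.measurableSet] with x hx hxΩ hxS using hx ⟨hxΩ, hxS⟩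

theorem Interfaces.ae_length (Γ : Interfaces Ω) {p : Plane → Prop} (hp : MeasurableSet {x | p x})
    (h : ∀ i, ∀ᵐ s ∂(volume.restrict (Icc 0 (Γ.len i))), p (Γ.curve i s)) :
    ∀ᵐ x ∂Γ.length, p x := by
  rw [ae_iff, Interfaces.length, Measure.finsetSum_apply]
  refine Finset.sum_eq_zero fun i _ => ?_
  have := (ae_map_iff (Γ.contDiff i).continuous.aemeasurable hp).2 (h i)
  rwa [ae_iff] at this

theorem IsPrimitive.ae_hasDerivAt {h : Plane → ℝ} {D : Lp Plane 2 Γ.length}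
    (hp : IsPrimitive Γ h D) (i : Fin Γ.num) :
    ∀ᵐ t ∂(volume.restrict (Icc 0 (Γ.len i))), t ∈ Ioo 0 (Γ.len i) ∧
      HasDerivAt (fun t => h (Γ.curve i t))
        (inner ℝ (D (Γ.curve i t)) (deriv (Γ.curve i) t)) t := by
  have hL := (Γ.len_pos i).le
  have h0 : (0 : ℝ) ∈ Icc 0 (Γ.len i) := ⟨le_rfl, hL⟩
  have hL' : Γ.len i ∈ Icc 0 (Γ.len i) := ⟨hL, le_rfl⟩
  rw [restrict_Ioo_eq_restrict_Icc.symm, ae_restrict_iff' measurableSet_Ioo]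
  filter_upwards [(Γ.intervalIntegrable_inner i D h0 hL').ae_hasDerivAt_integral] with t ht htI
  have h1 := ht (by rw [uIcc_of_le hL]; exact Ioo_subset_Icc_self htI) 0 (by simp)
  refine ⟨htI, (h1.const_add (h (Γ.curve i 0))).congr_of_eventuallyEq ?_⟩
  filter_upwards [Icc_mem_nhds htI.1 htI.2] with s hs
  exact hp i s hs

theorem ae_tgrad_eq_zero (v : energySpace Γ) {S : Set Plane} (hS : IsClosed S)
    (hv : ∀ᵐ x ∂Γ.length, x ∉ S → trace v x = 0) : ∀ᵐ x ∂Γ.length, x ∉ S → tgrad v x = 0 := by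
  obtain ⟨-, h, hc, he, hD⟩ := v.2
  have hmeas : MeasurableSet {x | x ∉ S → tgrad v x = 0} := by
    have : {x | x ∉ S → tgrad v x = 0} = S ∪ (tgrad v) ⁻¹' {0} := by
      ext x
      by_cases hx : x ∈ S <;> simp [hx]
    rw [this]
    exact hS.measurableSet.union ((Lp.stronglyMeasurable (tgrad v)).measurable
      (measurableSet_singleton 0))
  refine Γ.ae_length hmeas fun i => ?_
  have hp : IsPrimitive Γ h (tgrad v) := fun i => (hD i).1
  have hcc := (Γ.contDiff i).continuous
  have hU : IsOpen (Ioo 0 (Γ.len i) ∩ (Γ.curve i) ⁻¹' Sᶜ) :=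
    isOpen_Ioo.inter (hS.isOpen_compl.preimage hcc)
  have hzero : EqOn (fun t => h (Γ.curve i t)) (fun _ => 0)
      (Ioo 0 (Γ.len i) ∩ (Γ.curve i) ⁻¹' Sᶜ) := by
    refine Measure.eqOn_open_of_ae_eq (μ := volume) ?_ hU ?_ continuousOn_const
    · have h1 : ∀ᵐ t ∂(volume.restrict (Icc 0 (Γ.len i))), Γ.curve i t ∉ S →
          h (Γ.curve i t) = 0 := by
        filter_upwards [Γ.ae_curve i hv, Γ.ae_curve i he] with t h1 h2 h3
        exact h2.symm.trans (h1 h3)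
      refine (ae_restrict_iff' hU.measurableSet).2 ?_
      filter_upwards [(ae_restrict_iff' measurableSet_Icc).1 h1] with t ht ht'
      exact ht (Ioo_subset_Icc_self ht'.1) ht'.2
    · refine hc.comp hcc.continuousOn fun t ht => ?_
      exact mem_iUnion.2 ⟨i, t, Ioo_subset_Icc_self ht.1, rfl⟩
  filter_upwards [hp.ae_hasDerivAt i, (hD i).2] with t h1 h2 h3
  have h4 : HasDerivAt (fun t => h (Γ.curve i t)) 0 t :=
    (hasDerivAt_const t (0 : ℝ)).congr_of_eventuallyEq
      (hzero.eventuallyEq_of_mem (hU.mem_nhds ⟨h1.1, h3⟩))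
  change v.1.2.2.2 _ = 0
  rw [h2]
  have h5 := h1.2.unique h4
  change (inner ℝ (v.1.2.2.2 (Γ.curve i t)) _ : ℝ) = 0 at h5
  rw [h5, zero_smul]

end LOD

/-! ### Smooth approximation of Lipschitz functions with compact support -/

namespace LOD

variable {Ω : Set Plane}

/-- Shrinking bump functions for mollification. -/
noncomputable def mollifier (n : ℕ) : ContDiffBump (0 : Plane) where
  rIn := 1 / (2 * (n + 1))
  rOut := 1 / (n + 1)
  rIn_pos := by positivity
  rIn_lt_rOut := by
    apply one_div_lt_one_div_of_lt <;> linarith [(Nat.cast_nonneg n : (0 : ℝ) ≤ n)]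

theorem tendsto_mollifier_rOut : Tendsto (fun n => (mollifier n).rOut) atTop (𝓝 0) :=
  tendsto_one_div_add_atTop_nhds_zero_nat

/-- The mollification of `f`. -/
noncomputable def mollify {F : Type*} [NormedAddCommGroup F] [NormedSpace ℝ F] (n : ℕ)
    (f : Plane → F) : Plane → F :=
  convolution ((mollifier n).normed volume) f (ContinuousLinearMap.lsmul ℝ ℝ) volume

theorem integrable_mollifier (n : ℕ) :
    Integrable ((mollifier n).normed (volume : Measure Plane)) :=
  (mollifier n).continuous_normed.integrable_of_hasCompactSupport
    (mollifier n).hasCompactSupport_normed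

theorem norm_mollify_le {F : Type*} [NormedAddCommGroup F] [NormedSpace ℝ F] (n : ℕ)
    {f : Plane → F} {K : ℝ} (hf : ∀ x, ‖f x‖ ≤ K) (x : Plane) : ‖mollify n f x‖ ≤ K := by
  have h := norm_integral_le_of_norm_le (μ := (volume : Measure Plane))
    (f := fun t => (mollifier n).normed volume t • f (x - t))
    (g := fun t => (mollifier n).normed volume t * K)
    ((integrable_mollifier n).mul_const K) (ae_of_all _ fun t => by
      rw [norm_smul, Real.norm_of_nonneg ((mollifier n).nonneg_normed t)]
      exact mul_le_mul_of_nonneg_left (hf _) ((mollifier n).nonneg_normed t))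
  rw [integral_mul_const, (mollifier n).integral_normed, one_mul] at h
  exact h

theorem hasFDerivAt_mollify (n : ℕ) {f : Plane → ℝ} {K : NNReal} (hf : LipschitzWith K f)
    (x : Plane) : HasFDerivAt (mollify n f) (mollify n (fderiv ℝ f) x) x := by
  have hcont := (mollifier n).continuous_normed (μ := (volume : Measure Plane))
  refine (hasFDerivAt_integral_of_dominated_loc_of_lip (𝕜 := ℝ) (μ := (volume : Measure Plane))
    (F := fun x t => (mollifier n).normed volume t • f (x - t))
    (F' := fun t => (mollifier n).normed volume t • fderiv ℝ f (x - t))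
    (bound := fun t => (mollifier n).normed volume t * K) univ_mem ?_ ?_ ?_ ?_ ?_ ?_).2
  · refine Eventually.of_forall fun y => ?_
    exact (hcont.smul
      (hf.continuous.comp (continuous_const.sub continuous_id))).aestronglyMeasurable
  · exact (hcont.smul (hf.continuous.comp
      (continuous_const.sub continuous_id))).integrable_of_hasCompactSupport
      (mollifier n).hasCompactSupport_normed.smul_right
  · exact (hcont.measurable.smul ((measurable_fderiv ℝ f).comp
      (measurable_const.sub measurable_id))).aestronglyMeasurable
  · refine ae_of_all _ fun t => LipschitzWith.lipschitzOnWith ?_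
    refine LipschitzWith.of_dist_le_mul fun y z => ?_
    rw [dist_smul₀, Real.norm_of_nonneg ((mollifier n).nonneg_normed t)]
    have h1 := hf.dist_le_mul (y - t) (z - t)
    rw [dist_sub_right] at h1
    have h2 : ((Real.nnabs ((mollifier n).normed volume t * K) : NNReal) : ℝ) =
        (mollifier n).normed volume t * K := by
      rw [Real.coe_nnabs, abs_of_nonneg
        (mul_nonneg ((mollifier n).nonneg_normed t) K.coe_nonneg)]
    rw [h2, mul_assoc]
    exact mul_le_mul_of_nonneg_left h1 ((mollifier n).nonneg_normed t)
  · exact (integrable_mollifier n).mul_const K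
  · have h1 := (quasiMeasurePreserving_sub_left_of_right_invariant
      (volume : Measure Plane) x).ae (hf.ae_differentiableAt (μ := volume))
    filter_upwards [h1] with t ht
    have h2 : HasFDerivAt (fun y => f (y - t)) (fderiv ℝ f (x - t)) x := by
      have h3 := HasFDerivAt.comp (g := f) (f := fun y : Plane => y - t) x ht.hasFDerivAt
        ((hasFDerivAt_id x).sub_const t)
      rwa [ContinuousLinearMap.comp_id] at h3
    exact h2.const_smul ((mollifier n).normed volume t)

theorem gradient_eq (f : Plane → ℝ) (x : Plane) :
    gradient f x = (InnerProductSpace.toDual ℝ Plane).symm (fderiv ℝ f x) := rfl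

theorem exists_test_of_lipschitz {f : Plane → ℝ} {K : NNReal} (hf : LipschitzWith K f)
    (hc : HasCompactSupport f) (hΩ : IsOpen Ω) (hs : tsupport f ⊆ Ω) {ε : NNReal} (hε : 0 < ε) :
    ∃ φ, IsTest Ω φ ∧ (∀ x, |φ x - f x| ≤ ε) ∧
      eLpNorm (fun x => gradient φ x - gradient f x) 2 volume ≤ ε := by
  have hint : LocallyIntegrable f := hf.continuous.locallyIntegrable
  have hb : ∀ x, ‖fderiv ℝ f x‖ ≤ K := fun x => norm_fderiv_le_of_lipschitz ℝ hf
  have hgi : LocallyIntegrable (fderiv ℝ f) (volume : Measure Plane) := by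
    refine (locallyIntegrable_const (K : ℝ)).mono
      (measurable_fderiv ℝ f).aestronglyMeasurable (ae_of_all _ fun x => ?_)
    rw [Real.norm_of_nonneg K.coe_nonneg]
    exact hb x
  obtain ⟨δ, hδ, hδΩ⟩ := hc.isCompact.exists_cthickening_subset_open hΩ hs
  have hsmooth : ∀ n, ContDiff ℝ ∞ (mollify n f) := fun n =>
    (mollifier n).hasCompactSupport_normed.contDiff_convolution_left _
      (mollifier n).contDiff_normed hint
  have hsupp : ∀ n, tsupport (mollify n f) ⊆ Metric.cthickening (mollifier n).rOut (tsupport f) :=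
    fun n => by
      refine closure_minimal ?_ Metric.isClosed_cthickening
      refine (support_convolution_subset _).trans ?_
      rintro _ ⟨y, hy, z, hz, rfl⟩
      rw [(mollifier n).support_normed_eq] at hy
      refine Metric.mem_cthickening_of_dist_le _ z _ _ (subset_tsupport _ hz) ?_
      simpa using (Metric.mem_ball.1 hy).le
  have hzero : ∀ n, ∀ x ∉ Metric.cthickening 1 (tsupport f),
      fderiv ℝ (mollify n f) x = 0 ∧ fderiv ℝ f x = 0 := by
    intro n x hx
    constructor
    · by_contra hne
      refine hx (Metric.cthickening_mono ?_ _ (hsupp n (support_fderiv_subset ℝ hne)))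
      change 1 / ((n : ℝ) + 1) ≤ 1
      rw [div_le_one (by positivity)]
      linarith [(Nat.cast_nonneg n : (0 : ℝ) ≤ n)]
    · by_contra hne
      exact hx (Metric.self_subset_cthickening _ (support_fderiv_subset ℝ hne))
  have hfd : ∀ n, fderiv ℝ (mollify n f) = mollify n (fderiv ℝ f) := fun n =>
    funext fun x => (hasFDerivAt_mollify n hf x).fderiv
  -- the derivatives converge almost everywhere, are bounded, and vanish off a fixed compact set
  have hlim : Tendsto (fun n => ∫⁻ x, ‖fderiv ℝ (mollify n f) x - fderiv ℝ f x‖ₑ ^ 2)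
      atTop (𝓝 0) := by
    have hae := ContDiffBump.ae_convolution_tendsto_right_of_locallyIntegrable
      (K := 2) (φ := mollifier) tendsto_mollifier_rOut (Eventually.of_forall fun n => by
        change 1 / ((n : ℝ) + 1) ≤ 2 * (1 / (2 * (n + 1)))
        apply le_of_eq
        field_simp) hgi
    have e0 : ‖(0 : Plane →L[ℝ] ℝ)‖ₑ ^ 2 = 0 := by
      rw [← ofReal_norm, norm_zero, ENNReal.ofReal_zero, zero_pow two_ne_zero]
    have hcomp : IsCompact (Metric.cthickening 1 (tsupport f)) := hc.isCompact.cthickening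
    have := tendsto_lintegral_of_dominated_convergence (μ := (volume : Measure Plane))
      (F := fun n x => ‖fderiv ℝ (mollify n f) x - fderiv ℝ f x‖ₑ ^ 2) (f := fun _ => 0)
      ((Metric.cthickening 1 (tsupport f)).indicator fun _ => ENNReal.ofReal (2 * K) ^ 2)
      (fun n => (((measurable_fderiv ℝ _).sub (measurable_fderiv ℝ f)).enorm).pow_const 2)
      (fun n => ae_of_all _ fun x => ?_) ?_ ?_
    · rwa [lintegral_zero] at this
    · by_cases hx : x ∈ Metric.cthickening 1 (tsupport f)
      · rw [indicator_of_mem hx]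
        refine pow_le_pow_left' ?_ 2
        rw [← ofReal_norm]
        refine ENNReal.ofReal_le_ofReal ((norm_sub_le _ _).trans ?_)
        rw [hfd]
        linarith [norm_mollify_le n hb x, hb x]
      · change ‖fderiv ℝ (mollify n f) x - fderiv ℝ f x‖ₑ ^ 2 ≤ _
        rw [(hzero n x hx).1, (hzero n x hx).2, sub_zero]
        exact e0.trans_le zero_le
    · rw [lintegral_indicator_const hcomp.isClosed.measurableSet]
      exact ENNReal.mul_ne_top (ENNReal.pow_ne_top ENNReal.ofReal_ne_top) hcomp.measure_lt_top.ne
    · filter_upwards [hae] with x hx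
      have h1 : Tendsto (fun n => ‖fderiv ℝ (mollify n f) x - fderiv ℝ f x‖ₑ ^ 2) atTop
          (𝓝 (‖fderiv ℝ f x - fderiv ℝ f x‖ₑ ^ 2)) := by
        simp only [hfd]
        exact ENNReal.Tendsto.pow ((hx.sub tendsto_const_nhds).enorm)
      rw [sub_self] at h1
      exact h1.trans (le_of_eq (congrArg 𝓝 e0))
  have hε2 : (0 : ℝ≥0∞) < (ε : ℝ≥0∞) ^ 2 := by positivity
  obtain ⟨n, hn1, hn2, hn3⟩ := ((hlim.eventually (ge_mem_nhds hε2)).and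
    ((tendsto_mollifier_rOut.eventually (ge_mem_nhds hδ)).and
      (tendsto_mollifier_rOut.eventually (ge_mem_nhds
        (show 0 < (ε : ℝ) / (K + 1) by positivity))))).exists
  refine ⟨mollify n f, ⟨hsmooth n, (mollifier n).hasCompactSupport_normed.convolution _ hc,
    (hsupp n).trans ((Metric.cthickening_mono hn2 _).trans hδΩ)⟩, fun x => ?_, ?_⟩
  · rw [← Real.dist_eq]
    refine ContDiffBump.dist_normed_convolution_le hf.continuous.aestronglyMeasurable
      fun y hy => ?_
    refine (hf.dist_le_mul y x).trans ?_
    have h1 := (Metric.mem_ball.1 hy).le.trans hn3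
    calc (K : ℝ) * dist y x ≤ K * (ε / (K + 1)) := by gcongr
      _ ≤ ε := by
        rw [mul_div_assoc', div_le_iff₀ (by positivity)]
        nlinarith [K.2, ε.2]
  · rw [← ENNReal.pow_le_pow_left_iff two_ne_zero, eLpNorm_two_sq]
    refine le_trans (le_of_eq (lintegral_congr fun x => ?_)) hn1
    rw [gradient_eq, gradient_eq, ← map_sub]
    congr 1
    rw [← ofReal_norm, ← ofReal_norm, LinearIsometryEquiv.norm_map]

end LOD

/-! ### Multiplication by cut-off functions: gradient and trace -/

namespace LOD

variable {Ω : Set Plane} {Γ : Interfaces Ω}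

/-- A function on an interval that is Lipschitz at each point, with the same constant, is
Lipschitz. -/
theorem abs_sub_le_of_eventually {f : ℝ → ℝ} {a b L : ℝ} (hab : a ≤ b)
    (h : ∀ t ∈ Icc a b, ∀ᶠ s in 𝓝[Icc a b] t, |f s - f t| ≤ L * |s - t|) :
    |f b - f a| ≤ L * (b - a) := by
  have hcont : ContinuousOn f (Icc a b) := fun t ht => by
    rw [ContinuousWithinAt, tendsto_iff_dist_tendsto_zero]
    refine squeeze_zero' (Eventually.of_forall fun _ => dist_nonneg) (h t ht) ?_
    have : Tendsto (fun s => L * |s - t|) (𝓝 t) (𝓝 (L * |t - t|)) :=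
      ((continuous_id.sub continuous_const).abs.const_mul L).tendsto t
    rw [sub_self, abs_zero, mul_zero] at this
    exact this.mono_left nhdsWithin_le_nhds
  have hclosed : IsClosed ({t | |f t - f a| ≤ L * (t - a)} ∩ Icc a b) := by
    rw [inter_comm]
    exact isClosed_Icc.isClosed_le ((hcont.sub continuousOn_const).abs)
      ((continuousOn_id.sub continuousOn_const).const_mul L)
  refine hclosed.Icc_subset_of_forall_exists_gt (by simp) ?_ (right_mem_Icc.2 hab)
  rintro t ⟨ht, htab⟩ y hy
  have h1 : ∀ᶠ s in 𝓝[>] t, |f s - f t| ≤ L * |s - t| := by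
    have h2 : 𝓝[>] t ≤ 𝓝[Icc a b] t := by
      refine nhdsWithin_le_iff.2 ?_
      filter_upwards [Ioo_mem_nhdsGT htab.2] with s hs
      exact ⟨htab.1.trans hs.1.le, hs.2.le⟩
    exact h2 (h t (Ico_subset_Icc_self htab))
  obtain ⟨s, hs, hs'⟩ := (h1.and (Ioc_mem_nhdsGT hy)).exists
  refine ⟨s, ?_, hs'⟩
  rw [abs_of_pos (sub_pos.2 hs'.1)] at hs
  have h3 := abs_add_le (f s - f t) (f t - f a)
  rw [sub_add_sub_cancel] at h3
  have ht' : |f t - f a| ≤ L * (t - a) := ht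
  change |f s - f a| ≤ L * (s - a)
  linarith

/-- A function with values in `[-1, 1]` which is Lipschitz in the inner metric of the closure of
`Ω` and differentiable almost everywhere.  Distances are only compared nearby, since a function
that is affine on the elements of a mesh need not be Lipschitz with respect to the Euclidean
distance, with a constant independent of the mesh. -/
structure IsMultiplier (Ω : Set Plane) (η : Plane → ℝ) (K : NNReal) : Prop where
  measurable : Measurable η
  bound : ∀ x ∈ closure Ω, |η x| ≤ 1
  lip : ∀ x ∈ closure Ω, ∀ᶠ y in 𝓝[closure Ω] x, |η y - η x| ≤ K * dist y x
  diff : ∀ᵐ x ∂(bulk Ω), DifferentiableAt ℝ η x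

namespace IsMultiplier

variable {η : Plane → ℝ} {K : NNReal}

theorem continuousOn (h : IsMultiplier Ω η K) : ContinuousOn η (closure Ω) := fun x hx => by
  rw [ContinuousWithinAt, tendsto_iff_dist_tendsto_zero]
  refine squeeze_zero' (Eventually.of_forall fun _ => dist_nonneg) (h.lip x hx) ?_
  have : Tendsto (fun y => (K : ℝ) * dist y x) (𝓝 x) (𝓝 (K * dist x x)) :=
    ((continuous_id.dist continuous_const).const_mul _).tendsto x
  rw [dist_self, mul_zero] at this
  exact this.mono_left nhdsWithin_le_nhds

theorem lip_nhds (h : IsMultiplier Ω η K) (hΩ : IsOpen Ω) {x : Plane} (hx : x ∈ Ω) :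
    ∀ᶠ y in 𝓝 x, |η y - η x| ≤ K * dist y x := by
  have := h.lip x (subset_closure hx)
  rwa [nhdsWithin_eq_nhds.2 (mem_of_superset (hΩ.mem_nhds hx) subset_closure)] at this

theorem norm_gradient_le (h : IsMultiplier Ω η K) (hΩ : IsOpen Ω) {x : Plane} (hx : x ∈ Ω) :
    ‖gradient η x‖ ≤ K := by
  rw [norm_gradient]
  by_cases hd : DifferentiableAt ℝ η x
  · refine hd.hasFDerivAt.le_of_lip' K.coe_nonneg ?_
    filter_upwards [h.lip_nhds hΩ hx] with y hy
    rwa [Real.norm_eq_abs, ← dist_eq_norm]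
  · rw [fderiv_zero_of_not_differentiableAt hd, norm_zero]
    exact K.coe_nonneg

theorem exists_lipschitz_mul (h : IsMultiplier Ω η K) (hΩ : IsOpen Ω) {φ : Plane → ℝ}
    (hφ : IsTest Ω φ) : ∃ L, LipschitzWith L (fun x => η x * φ x) := by
  obtain ⟨Lφ, hLφ⟩ := hφ.1.lipschitzWith_of_hasCompactSupport hφ.2.1 (by simp)
  obtain ⟨M, hM⟩ := hφ.2.1.exists_bound_of_continuous hφ.1.continuous
  have hM0 : 0 ≤ M := (norm_nonneg _).trans (hM 0)
  set L : NNReal := Lφ + ⟨M, hM0⟩ * K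
  have hL : (L : ℝ) = Lφ + M * K := rfl
  have hloc : ∀ x, ∀ᶠ y in 𝓝 x, |η y * φ y - η x * φ x| ≤ L * dist y x := fun x => by
    by_cases hx : x ∈ tsupport φ
    · have hxΩ := hφ.2.2 hx
      filter_upwards [h.lip_nhds hΩ hxΩ, hΩ.mem_nhds hxΩ] with y hy hyΩ
      have e : η y * φ y - η x * φ x = η y * (φ y - φ x) + φ x * (η y - η x) := by ring
      have h1 := hLφ.dist_le_mul y x
      rw [Real.dist_eq] at h1
      have h2 := h.bound y (subset_closure hyΩ)
      rw [e]
      refine (abs_add_le _ _).trans ?_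
      rw [abs_mul, abs_mul, hL, add_mul]
      refine add_le_add ?_ ?_
      · exact (mul_le_of_le_one_left (abs_nonneg _) h2).trans h1
      · rw [mul_assoc]
        exact mul_le_mul (hM x) hy (abs_nonneg _) hM0
    · filter_upwards [(isClosed_tsupport φ).isOpen_compl.mem_nhds hx] with y hy
      rw [image_eq_zero_of_notMem_tsupport hx, image_eq_zero_of_notMem_tsupport hy]
      simp only [mul_zero, sub_self, abs_zero]
      positivity
  refine ⟨L, LipschitzWith.of_dist_le_mul fun z y => ?_⟩
  have hc : Continuous fun t : ℝ => y + t • (z - y) := by fun_prop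
  have := abs_sub_le_of_eventually (a := 0) (b := 1) (L := L * dist z y) zero_le_one
    (f := fun t : ℝ => η (y + t • (z - y)) * φ (y + t • (z - y))) fun t _ => by
      refine nhdsWithin_le_nhds ?_
      filter_upwards [hc.continuousAt.eventually (hloc (y + t • (z - y)))] with s hs
      refine hs.trans_eq ?_
      rw [dist_eq_norm, add_sub_add_left_eq_sub, ← sub_smul, norm_smul, Real.norm_eq_abs,
        dist_eq_norm]
      ring
  simpa [Real.dist_eq] using this

theorem gradient_mul {φ : Plane → ℝ} (hφ : IsTest Ω φ) {x : Plane}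
    (hd : DifferentiableAt ℝ η x) :
    gradient (fun x => η x * φ x) x = η x • gradient φ x + φ x • gradient η x := by
  have h1 := (hφ.1.differentiable (by simp)).differentiableAt (x := x)
  rw [gradient_eq, gradient_eq, gradient_eq, fderiv_fun_mul hd h1]
  simp

end IsMultiplier

theorem hasGradientAndTrace_of_forall_mul {v : Plane → ℝ} {G : Plane → Plane} {g : Plane → ℝ}
    (C : NNReal) (h : ∀ ε : NNReal, 0 < ε → ∃ φ, IsTest Ω φ ∧
      eLpNorm (fun x => φ x - v x) 2 (bulk Ω) ≤ C * ε ∧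
      eLpNorm (fun x => gradient φ x - G x) 2 (bulk Ω) ≤ C * ε ∧
      eLpNorm (fun x => φ x - g x) 2 Γ.length ≤ C * ε) : HasGradientAndTrace Γ v G g := by
  refine hasGradientAndTrace_of_forall fun δ hδ => ?_
  obtain ⟨δ', hδ', hle⟩ := ENNReal.lt_iff_exists_nnreal_btwn.1 hδ
  have hδ0 : 0 < δ' := by exact_mod_cast hδ'
  obtain ⟨φ, hφ, h1, h2, h3⟩ := h (δ' / (C + 1)) (by positivity)
  have hC : (C : ℝ≥0∞) * (δ' / (C + 1) : NNReal) ≤ δ := by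
    refine le_trans ?_ hle.le
    rw [← ENNReal.coe_mul, ENNReal.coe_le_coe, mul_div_assoc', div_le_iff₀ (by positivity)]
    rw [mul_comm]
    gcongr
    exact le_self_add
  exact ⟨φ, hφ, h1.trans hC, h2.trans hC, h3.trans hC⟩

theorem eLpNorm_sub_le_of_close {μ : Measure Plane} {ψ η φ v : Plane → ℝ} {ε : NNReal}
    (hψ : AEStronglyMeasurable (fun x => ψ x - η x * φ x) μ)
    (hv : AEStronglyMeasurable (fun x => η x * (φ x - v x)) μ)
    (hη : ∀ᵐ x ∂μ, |η x| ≤ 1) (h1 : ∀ x, |ψ x - η x * φ x| ≤ ε)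
    (h2 : eLpNorm (fun x => φ x - v x) 2 μ ≤ ε) :
    eLpNorm (fun x => ψ x - η x * v x) 2 μ ≤ (μ univ ^ (1 / 2 : ℝ) + 1) * ε := by
  have e : (fun x => ψ x - η x * v x) =
      (fun x => ψ x - η x * φ x) + fun x => η x * (φ x - v x) := by
    funext x
    simp only [Pi.add_apply]
    ring
  rw [e]
  refine (eLpNorm_add_le hψ hv (by norm_num)).trans ?_
  rw [add_mul, one_mul]
  refine add_le_add ?_ ?_
  · have := eLpNorm_le_of_ae_bound (p := 2) (μ := μ) (f := fun x => ψ x - η x * φ x) (C := ε)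
      (ae_of_all _ h1)
    simpa using this
  · refine (eLpNorm_mono_ae ?_).trans h2
    filter_upwards [hη] with x hx
    rw [norm_mul]
    exact mul_le_of_le_one_left (norm_nonneg _) hx

instance : IsFiniteMeasure Γ.length := by
  unfold Interfaces.length
  infer_instance

theorem Interfaces.carrier_subset (Γ : Interfaces Ω) : Γ.carrier ⊆ closure Ω := by
  refine iUnion_subset fun i => ?_
  rintro _ ⟨t, ht, rfl⟩
  exact Γ.mem_closure i t ht

/-- The product rule for the weak gradient. -/
theorem HasGradientAndTrace.mul {η : Plane → ℝ} {K : NNReal} (h : IsMultiplier Ω η K)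
    (hΩ : IsOpen Ω) (hb : Bornology.IsBounded Ω) {v : Plane → ℝ} {G : Plane → Plane}
    {g : Plane → ℝ} (hv : AEStronglyMeasurable v (bulk Ω)) (hG : AEStronglyMeasurable G (bulk Ω))
    (hg : AEStronglyMeasurable g Γ.length) (hvG : HasGradientAndTrace Γ v G g) :
    HasGradientAndTrace Γ (fun x => η x * v x) (fun x => η x • G x + v x • gradient η x)
      (fun x => η x * g x) := by
  have hfin : (bulk Ω) univ ≠ ⊤ := by
    rw [bulk, Measure.restrict_apply_univ]
    exact hb.measure_lt_top.ne
  have hmη : ∀ μ : Measure Plane, AEStronglyMeasurable η μ := fun μ =>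
    h.measurable.aestronglyMeasurable
  have hmg : AEStronglyMeasurable (gradient η) (bulk Ω) :=
    ((InnerProductSpace.toDual ℝ Plane).symm.continuous.measurable.comp
      (measurable_fderiv ℝ η)).aestronglyMeasurable
  set c₁ : NNReal := ((bulk Ω) univ ^ (1 / 2 : ℝ)).toNNReal
  set c₂ : NNReal := (Γ.length univ ^ (1 / 2 : ℝ)).toNNReal
  have hc₁ : (c₁ : ℝ≥0∞) = (bulk Ω) univ ^ (1 / 2 : ℝ) :=
    ENNReal.coe_toNNReal (ENNReal.rpow_ne_top_of_nonneg (by norm_num) hfin)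
  have hc₂ : (c₂ : ℝ≥0∞) = Γ.length univ ^ (1 / 2 : ℝ) :=
    ENNReal.coe_toNNReal (ENNReal.rpow_ne_top_of_nonneg (by norm_num) (measure_ne_top _ _))
  have hbulk : ∀ᵐ x ∂(bulk Ω), x ∈ Ω := ae_restrict_mem hΩ.measurableSet
  refine hasGradientAndTrace_of_forall_mul (c₁ + c₂ + K + 2) fun ε hε => ?_
  obtain ⟨φ, hφ, e1, e2, e3⟩ := hvG.exists_test (ε := ε) (by exact_mod_cast hε)
  obtain ⟨L, hL⟩ := h.exists_lipschitz_mul hΩ hφ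
  obtain ⟨ψ, hψ, p1, p2⟩ := exists_test_of_lipschitz (f := fun x => η x * φ x) hL
    (hφ.2.1.mul_left) hΩ ((closure_mono fun x hx => right_ne_zero_of_mul hx).trans hφ.2.2) hε
  have mφ : ∀ μ : Measure Plane, AEStronglyMeasurable φ μ := fun μ =>
    hφ.1.continuous.aestronglyMeasurable
  have mψ : ∀ μ : Measure Plane, AEStronglyMeasurable ψ μ := fun μ =>
    hψ.1.continuous.aestronglyMeasurable
  refine ⟨ψ, hψ, ?_, ?_, ?_⟩
  · refine (eLpNorm_sub_le_of_close ((mψ _).sub ((hmη _).mul (mφ _))) ((hmη _).mul ((mφ _).sub hv))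
      ?_ p1 e1).trans ?_
    · filter_upwards [hbulk] with x hx using h.bound x (subset_closure hx)
    · rw [← hc₁]
      norm_cast
      calc (c₁ + 1) * ε ≤ ((c₁ + 1) + (c₂ + K + 1)) * ε :=
          mul_le_mul_of_nonneg_right le_self_add zero_le
        _ = _ := by ring
  · have e : (fun x => gradient ψ x - (η x • G x + v x • gradient η x)) =ᵐ[bulk Ω]
        (fun x => gradient ψ x - gradient (fun x => η x * φ x) x) +
        ((fun x => η x • (gradient φ x - G x)) + fun x => (φ x - v x) • gradient η x) := by
      filter_upwards [h.diff] with x hx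
      simp only [Pi.add_apply]
      rw [IsMultiplier.gradient_mul hφ hx]
      module
    have mf : AEStronglyMeasurable (gradient fun x => η x * φ x) (bulk Ω) :=
      ((InnerProductSpace.toDual ℝ Plane).symm.continuous.measurable.comp
        (measurable_fderiv ℝ _)).aestronglyMeasurable
    have m1 : AEStronglyMeasurable
        (fun x => gradient ψ x - gradient (fun x => η x * φ x) x) (bulk Ω) :=
      hψ.continuous_gradient.aestronglyMeasurable.sub mf
    have m2 : AEStronglyMeasurable (fun x => η x • (gradient φ x - G x)) (bulk Ω) :=
      (hmη _).smul (hφ.continuous_gradient.aestronglyMeasurable.sub hG)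
    have m3 : AEStronglyMeasurable (fun x => (φ x - v x) • gradient η x) (bulk Ω) :=
      ((mφ _).sub hv).smul hmg
    have b1 : eLpNorm (fun x => gradient ψ x - gradient (fun x => η x * φ x) x) 2 (bulk Ω) ≤ ε :=
      (eLpNorm_restrict_le _ _ _ _).trans p2
    have b2 : eLpNorm (fun x => η x • (gradient φ x - G x)) 2 (bulk Ω) ≤ ε := by
      refine (eLpNorm_mono_ae ?_).trans e2
      filter_upwards [hbulk] with x hx
      rw [norm_smul]
      exact mul_le_of_le_one_left (norm_nonneg _) (h.bound x (subset_closure hx))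
    have b3 : eLpNorm (fun x => (φ x - v x) • gradient η x) 2 (bulk Ω) ≤ K * ε := by
      have := eLpNorm_le_nnreal_smul_eLpNorm_of_ae_le_mul (μ := bulk Ω)
        (f := fun x => (φ x - v x) • gradient η x) (g := fun x => φ x - v x) (c := K) ?_ 2
      · refine this.trans ?_
        rw [ENNReal.smul_def, smul_eq_mul]
        gcongr
      · filter_upwards [hbulk] with x hx
        rw [← NNReal.coe_le_coe]
        simp only [coe_nnnorm, NNReal.coe_mul]
        rw [norm_smul, mul_comm]
        gcongr
        exact h.norm_gradient_le hΩ hx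
    rw [eLpNorm_congr_ae e]
    refine (eLpNorm_add_le m1 (m2.add m3) (by norm_num)).trans ?_
    refine (add_le_add b1 ((eLpNorm_add_le m2 m3 (by norm_num)).trans
      (add_le_add b2 b3))).trans ?_
    norm_cast
    calc ε + (ε + K * ε) = (K + 2) * ε := by ring
      _ ≤ (c₁ + c₂ + K + 2) * ε := by
        gcongr
        exact le_add_self
  · refine (eLpNorm_sub_le_of_close ((mψ _).sub ((hmη _).mul (mφ _))) ((hmη _).mul ((mφ _).sub hg))
      ?_ p1 e3).trans ?_
    · filter_upwards [Γ.ae_mem_carrier] with x hx using h.bound x (Γ.carrier_subset hx)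
    · rw [← hc₂]
      norm_cast
      calc (c₂ + 1) * ε ≤ ((c₂ + 1) + (c₁ + K + 1)) * ε :=
          mul_le_mul_of_nonneg_right le_self_add zero_le
        _ = _ := by ring

end LOD

/-! ### Multiplication by cut-off functions: tangential gradient -/

namespace LOD

variable {Ω : Set Plane} {Γ : Interfaces Ω}

/-- The derivative of a function vanishes almost everywhere on its level sets, since all but
countably many points of a subset of the line are accumulated by it from the right. -/
theorem ae_deriv_eq_zero_of_const (f : ℝ → ℝ) (E : Set ℝ) (c : ℝ) (h : ∀ t ∈ E, f t = c) :
    ∀ᵐ t, t ∈ E → deriv f t = 0 := by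
  have hc : ({t ∈ E | 𝓝[E ∩ Ioi t] t = ⊥} : Set ℝ).Countable :=
    countable_setOfPred_isolated_right_within
  filter_upwards [hc.ae_notMem volume] with t ht htE
  have hne : (𝓝[E ∩ Ioi t] t).NeBot := neBot_iff.2 fun h0 => ht ⟨htE, h0⟩
  refine deriv_zero_of_frequently_const (c := c) ?_
  have h1 : ∃ᶠ s in 𝓝[E ∩ Ioi t] t, f s = c :=
    (eventually_mem_nhdsWithin.mono fun s hs => h s hs.1).frequently
  exact h1.filter_mono (nhdsWithin_mono t fun s hs => (ne_of_gt hs.2))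

theorem Interfaces.measurableSet_image (i : Fin Γ.num) :
    MeasurableSet (Γ.curve i '' Icc 0 (Γ.len i)) :=
  (isCompact_Icc.image (Γ.contDiff i).continuous).measurableSet

/-- Almost every point of a curve lies on no other curve. -/
theorem Interfaces.ae_notMem_other (i : Fin Γ.num) :
    ∀ᵐ s ∂(volume.restrict (Icc 0 (Γ.len i))), s ∈ Ico 0 (Γ.len i) ∧
      ∀ j, j ≠ i → Γ.curve i s ∉ Γ.curve j '' Icc 0 (Γ.len j) := by
  refine (ae_restrict_iff' measurableSet_Icc).2 ?_
  have h1 : ∀ᵐ s : ℝ, s ≠ Γ.len i := by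
    filter_upwards [(countable_singleton (Γ.len i)).ae_notMem volume] with s hs using hs
  have h2 : ∀ᵐ s : ℝ, ∀ j, j ≠ i → ¬ (s ∈ Ico 0 (Γ.len i) ∧
      Γ.curve i s ∈ Γ.curve j '' Icc 0 (Γ.len j)) := by
    refine ae_all_iff.2 fun j => ?_
    by_cases hj : j = i
    · exact ae_of_all _ fun s h => absurd hj h
    · have hfin : (Ico 0 (Γ.len i) ∩ Γ.curve i ⁻¹'
          (Γ.curve i '' Icc 0 (Γ.len i) ∩ Γ.curve j '' Icc 0 (Γ.len j))).Finite := by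
        refine Finite.of_finite_image (f := Γ.curve i) ?_ ((Γ.injOn i).mono inter_subset_left)
        exact (Γ.finite_inter i j (Ne.symm hj)).subset (by rintro _ ⟨s, hs, rfl⟩; exact hs.2)
      filter_upwards [hfin.countable.ae_notMem volume] with s hs _ h
      exact hs ⟨h.1, ⟨s, Ico_subset_Icc_self h.1, rfl⟩, h.2⟩
  filter_upwards [h1, h2] with s h1 h2 hs
  have hs' : s ∈ Ico 0 (Γ.len i) := ⟨hs.1, lt_of_le_of_ne hs.2 h1⟩
  exact ⟨hs', fun j hj hm => h2 j hj ⟨hs', hm⟩⟩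

/-- Measurable functions of the arc length parameters combine to a measurable function on `Γ`. -/
theorem Interfaces.exists_measurable_field (Γ : Interfaces Ω) (τ : Fin Γ.num → ℝ → Plane)
    (hτ : ∀ i, Measurable (τ i)) : ∃ T : Plane → Plane, Measurable T ∧
      ∀ i, ∀ᵐ s ∂(volume.restrict (Icc 0 (Γ.len i))), T (Γ.curve i s) = τ i s := by
  have h1 : ∀ i, ∃ T : Plane → Plane, Measurable T ∧
      ∀ s ∈ Ico 0 (Γ.len i), T (Γ.curve i s) = τ i s := fun i => by
    have he : MeasurableEmbedding ((Ico 0 (Γ.len i)).domRestrict (Γ.curve i)) :=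
      (Γ.contDiff i).continuous.continuousOn.measurableEmbedding measurableSet_Ico (Γ.injOn i)
    obtain ⟨T, hT, hT'⟩ := he.exists_measurable_extend (g := fun s => τ i s)
      ((hτ i).comp measurable_subtype_coe) fun _ => ⟨0⟩
    exact ⟨T, hT, fun s hs => congrFun hT' ⟨s, hs⟩⟩
  choose T hT hT' using h1
  refine ⟨fun x => ∑ i, (Γ.curve i '' Icc 0 (Γ.len i)).indicator (T i) x,
    Finset.measurable_fun_sum _ fun i _ => (hT i).indicator (measurableSet_image i), fun i => ?_⟩
  filter_upwards [ae_notMem_other i] with s hs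
  rw [Finset.sum_eq_single i, indicator_of_mem (mem_image_of_mem _ (Ico_subset_Icc_self hs.1)),
    hT' i s hs.1]
  · exact fun j _ hj => indicator_of_notMem (hs.2 j hj) _
  · simp

namespace IsMultiplier

variable {η : Plane → ℝ} {K : NNReal}

theorem lipschitzOnWith_curve (h : IsMultiplier Ω η K) (i : Fin Γ.num) :
    LipschitzOnWith K (fun t => η (Γ.curve i t)) (Icc 0 (Γ.len i)) := by
  have hlip : LipschitzOnWith 1 (Γ.curve i) (Icc 0 (Γ.len i)) :=
    (convex_Icc 0 (Γ.len i)).lipschitzOnWith_of_nnnorm_deriv_le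
      (fun t _ => ((Γ.contDiff i).differentiable (by simp)).differentiableAt) fun t ht => by
        rw [← NNReal.coe_le_coe, coe_nnnorm, Γ.unit_speed i t ht, NNReal.coe_one]
  have main : ∀ a ∈ Icc 0 (Γ.len i), ∀ b ∈ Icc 0 (Γ.len i), a ≤ b →
      |η (Γ.curve i b) - η (Γ.curve i a)| ≤ K * (b - a) := fun a ha b hb hab => by
    refine abs_sub_le_of_eventually (f := fun t => η (Γ.curve i t)) hab fun t ht => ?_
    have hsub : Icc a b ⊆ Icc 0 (Γ.len i) := Icc_subset_Icc ha.1 hb.2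
    have htend : Tendsto (Γ.curve i) (𝓝[Icc a b] t) (𝓝[closure Ω] (Γ.curve i t)) :=
      tendsto_nhdsWithin_iff.2 ⟨(Γ.contDiff i).continuous.continuousAt.mono_left
        nhdsWithin_le_nhds, eventually_mem_nhdsWithin.mono fun s hs =>
          Γ.mem_closure i s (hsub hs)⟩
    filter_upwards [htend.eventually (h.lip _ (Γ.mem_closure i t (hsub ht))),
      eventually_mem_nhdsWithin] with s hs hs'
    refine hs.trans (mul_le_mul_of_nonneg_left ?_ K.coe_nonneg)
    have := hlip.dist_le_mul s (hsub hs') t (hsub ht)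
    rwa [NNReal.coe_one, one_mul, Real.dist_eq] at this
  refine LipschitzOnWith.of_dist_le_mul fun s hs t ht => ?_
  rw [Real.dist_eq, Real.dist_eq]
  rcases le_total s t with hst | hst
  · rw [abs_sub_comm, abs_sub_comm s, abs_of_nonneg (sub_nonneg.2 hst)]
    exact main s hs t ht hst
  · rw [abs_of_nonneg (sub_nonneg.2 hst)]
    exact main t ht s hs hst

/-- `T` is the tangential gradient of the multiplier `η` on `Γ`. -/
structure IsTangential (Γ : Interfaces Ω) (η : Plane → ℝ) (T : Plane → Plane) : Prop where
  measurable : Measurable T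
  eq : ∀ i, ∀ᵐ s ∂(volume.restrict (Icc 0 (Γ.len i))),
    T (Γ.curve i s) = deriv (fun t => η (Γ.curve i t)) s • deriv (Γ.curve i) s

theorem exists_isTangential (Γ : Interfaces Ω) (η : Plane → ℝ) : ∃ T, IsTangential Γ η T := by
  obtain ⟨T, hT, hT'⟩ := Γ.exists_measurable_field
    (fun i s => deriv (fun t => η (Γ.curve i t)) s • deriv (Γ.curve i) s) fun i =>
      (measurable_deriv fun t => η (Γ.curve i t)).smul (measurable_deriv (Γ.curve i))
  exact ⟨T, hT, hT'⟩

theorem IsTangential.ae_norm_le {T : Plane → Plane} (hT : IsTangential Γ η T)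
    (h : IsMultiplier Ω η K) : ∀ᵐ x ∂Γ.length, ‖T x‖ ≤ K := by
  refine Γ.ae_length (measurableSet_le hT.measurable.norm measurable_const) fun i => ?_
  have hIoo : ∀ᵐ s ∂(volume.restrict (Icc 0 (Γ.len i))), s ∈ Ioo 0 (Γ.len i) := by
    rw [restrict_Ioo_eq_restrict_Icc.symm]
    exact ae_restrict_mem measurableSet_Ioo
  filter_upwards [hT.eq i, hIoo] with s hs hs'
  rw [hs, norm_smul, Γ.unit_speed i s (Ioo_subset_Icc_self hs'), mul_one]
  exact norm_deriv_le_of_lipschitzOn (Icc_mem_nhds hs'.1 hs'.2) (h.lipschitzOnWith_curve i)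

/-- The tangential gradient vanishes where the function is constant. -/
theorem IsTangential.ae_eq_zero {T : Plane → Plane} (hT : IsTangential Γ η T) {A : Set Plane}
    (hA : MeasurableSet A) {c : ℝ} (hη : ∀ x ∈ A, η x = c) :
    ∀ᵐ x ∂Γ.length, x ∈ A → T x = 0 := by
  have hm : MeasurableSet {x | x ∈ A → T x = 0} := by
    have : {x | x ∈ A → T x = 0} = Aᶜ ∪ T ⁻¹' {0} := by
      ext x
      by_cases hx : x ∈ A <;> simp [hx]
    rw [this]
    exact hA.compl.union (hT.measurable (measurableSet_singleton 0))
  refine Γ.ae_length hm fun i => ?_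
  filter_upwards [hT.eq i, ae_restrict_of_ae (ae_deriv_eq_zero_of_const
    (fun t => η (Γ.curve i t)) (Γ.curve i ⁻¹' A) c fun t ht => hη _ ht)] with s h1 h2 h3
  rw [h1, h2 h3, zero_smul]

end IsMultiplier

theorem IsPrimitive.absolutelyContinuous {h : Plane → ℝ} {D : Lp Plane 2 Γ.length}
    (i : Fin Γ.num) : AbsolutelyContinuousOnInterval (fun t => h (Γ.curve i 0) +
      ∫ s in (0 : ℝ)..t, inner ℝ (D (Γ.curve i s)) (deriv (Γ.curve i) s)) 0 (Γ.len i) := by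
  have hL := (Γ.len_pos i).le
  have h1 := (Γ.intervalIntegrable_inner i D ⟨le_rfl, hL⟩
    ⟨hL, le_rfl⟩).absolutelyContinuousOnInterval_intervalIntegral (c := 0) (by simp)
  have h2 : AbsolutelyContinuousOnInterval (fun _ : ℝ => h (Γ.curve i 0)) 0 (Γ.len i) :=
    ((LipschitzWith.const (h (Γ.curve i 0))).lipschitzOnWith
      (s := uIcc 0 (Γ.len i))).absolutelyContinuousOnInterval
  exact h2.add h1

/-- The product rule for the tangential gradient. -/
theorem HasTangentialGradient.mul {η : Plane → ℝ} {K : NNReal} (h : IsMultiplier Ω η K)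
    {T : Plane → Plane} (hT : IsMultiplier.IsTangential Γ η T) {g : Plane → ℝ}
    {D : Lp Plane 2 Γ.length} (hg : HasTangentialGradient Γ g D) :
    HasTangentialGradient Γ (fun x => η x * g x) (fun x => η x • D x + g x • T x) := by
  obtain ⟨q, qc, qe, hq⟩ := hg
  refine ⟨fun x => η x * q x, (h.continuousOn.mono Γ.carrier_subset).mul qc, ?_, fun i =>
    ⟨fun t ht => ?_, ?_⟩⟩
  · filter_upwards [qe] with x hx
    rw [hx]
  · have hL := (Γ.len_pos i).le
    have hp : IsPrimitive Γ q D := fun i => (hq i).1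
    set G : ℝ → ℝ := fun t => q (Γ.curve i 0) +
      ∫ s in (0 : ℝ)..t, inner ℝ (D (Γ.curve i s)) (deriv (Γ.curve i) s) with hG
    set f : ℝ → ℝ := fun t => η (Γ.curve i t) with hf
    have hsub : uIcc 0 t ⊆ uIcc 0 (Γ.len i) := by
      rw [uIcc_of_le hL, uIcc_of_le ht.1]
      exact Icc_subset_Icc_right ht.2
    have ac1 : AbsolutelyContinuousOnInterval f 0 t := by
      have := h.lipschitzOnWith_curve (Γ := Γ) i
      rw [← uIcc_of_le hL] at this
      exact this.absolutelyContinuousOnInterval.mono hsub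
    have ac2 : AbsolutelyContinuousOnInterval G 0 t :=
      (IsPrimitive.absolutelyContinuous i).mono hsub
    have key := ac1.integral_deriv_mul_eq_sub ac2
    have hqG : ∀ s ∈ Icc 0 (Γ.len i), q (Γ.curve i s) = G s := fun s hs => hp i s hs
    have e1 : f t * G t = η (Γ.curve i t) * q (Γ.curve i t) := by rw [hqG t ht]
    have e2 : f 0 * G 0 = η (Γ.curve i 0) * q (Γ.curve i 0) := by rw [hqG 0 ⟨le_rfl, hL⟩]
    beta_reduce
    rw [← e1, ← e2, ← sub_eq_iff_eq_add', ← key]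
    refine intervalIntegral.integral_congr_ae ?_
    have h1 := (ae_restrict_iff' measurableSet_Icc).1 (hp.ae_hasDerivAt i)
    have h2 := (ae_restrict_iff' measurableSet_Icc).1 (hT.eq i)
    have h3 := (ae_restrict_iff' measurableSet_Icc).1 (Γ.ae_curve i qe)
    filter_upwards [h1, h2, h3] with s h1 h2 h3 hs
    rw [uIoc_of_le ht.1] at hs
    have hs' : s ∈ Icc 0 (Γ.len i) := ⟨hs.1.le, hs.2.trans ht.2⟩
    obtain ⟨h1a, h1b⟩ := h1 hs'
    have hGd : deriv G s = inner ℝ (D (Γ.curve i s)) (deriv (Γ.curve i) s) := by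
      refine (h1b.congr_of_eventuallyEq ?_).deriv
      filter_upwards [Icc_mem_nhds h1a.1 h1a.2] with r hr using (hqG r hr).symm
    rw [h2 hs', h3 hs', hGd, inner_add_left, real_inner_smul_left, real_inner_smul_left,
      real_inner_smul_left, real_inner_self_eq_norm_sq, Γ.unit_speed i s hs', ← hqG s hs']
    ring
  · filter_upwards [hT.eq i, (hq i).2, ae_restrict_mem measurableSet_Icc] with s h1 h2 hs
    rw [h1, inner_add_left, add_smul, real_inner_smul_left, mul_smul, ← h2, real_inner_smul_left,
      real_inner_smul_left, real_inner_self_eq_norm_sq, Γ.unit_speed i s hs]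
    simp [mul_smul]

end LOD

/-! ### Multiplication by cut-off functions in the energy space -/

namespace LOD

variable {Ω : Set Plane} {Γ : Interfaces Ω}

theorem HasGradientAndTrace.congr {v v' : Plane → ℝ} {G G' : Plane → Plane} {g g' : Plane → ℝ}
    (h : HasGradientAndTrace Γ v G g) (hv : v' =ᵐ[bulk Ω] v) (hG : G' =ᵐ[bulk Ω] G)
    (hg : g' =ᵐ[Γ.length] g) : HasGradientAndTrace Γ v' G' g' := by
  obtain ⟨φ, hφ, a, b, c⟩ := h
  refine ⟨φ, hφ, a.congr fun n => eLpNorm_congr_ae ?_, b.congr fun n => eLpNorm_congr_ae ?_,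
    c.congr fun n => eLpNorm_congr_ae ?_⟩
  · filter_upwards [hv] with x hx
    rw [hx]
  · filter_upwards [hG] with x hx
    rw [hx]
  · filter_upwards [hg] with x hx
    rw [hx]

theorem HasTangentialGradient.congr {g g' : Plane → ℝ} {D D' : Plane → Plane}
    (h : HasTangentialGradient Γ g D) (hg : g' =ᵐ[Γ.length] g) (hD : D' =ᵐ[Γ.length] D) :
    HasTangentialGradient Γ g' D' := by
  obtain ⟨q, qc, qe, hq⟩ := h
  refine ⟨q, qc, hg.trans qe, fun i => ⟨fun t ht => ?_, ?_⟩⟩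
  · rw [(hq i).1 t ht]
    congr 1
    refine intervalIntegral.integral_congr_ae ?_
    filter_upwards [(ae_restrict_iff' measurableSet_Icc).1 (Γ.ae_curve i hD)] with s hs hst
    rw [uIoc_of_le ht.1] at hst
    rw [hs ⟨hst.1.le, hst.2.trans ht.2⟩]
  · filter_upwards [(hq i).2, Γ.ae_curve i hD] with s h1 h2
    rw [h2]
    exact h1

theorem IsMultiplier.exists_mul {η : Plane → ℝ} {K : NNReal} (h : IsMultiplier Ω η K)
    (hΩ : IsOpen Ω) (hb : Bornology.IsBounded Ω) {T : Plane → Plane}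
    (hT : IsMultiplier.IsTangential Γ η T) (v : energySpace Γ) : ∃ w : energySpace Γ,
      (val w =ᵐ[bulk Ω] fun x => η x * val v x) ∧
      (grad w =ᵐ[bulk Ω] fun x => η x • grad v x + val v x • gradient η x) ∧
      (trace w =ᵐ[Γ.length] fun x => η x * trace v x) ∧
      (tgrad w =ᵐ[Γ.length] fun x => η x • tgrad v x + trace v x • T x) := by
  have hη : ∀ᵐ x ∂(bulk Ω), ‖η x‖ ≤ 1 := by
    filter_upwards [ae_restrict_mem hΩ.measurableSet] with x hx using h.bound x (subset_closure hx)
  have hη' : ∀ᵐ x ∂Γ.length, ‖η x‖ ≤ 1 := by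
    filter_upwards [Γ.ae_mem_carrier] with x hx using h.bound x (Γ.carrier_subset hx)
  have hmg : Measurable (gradient η) :=
    (InnerProductSpace.toDual ℝ Plane).symm.continuous.measurable.comp (measurable_fderiv ℝ η)
  have hgη : ∀ᵐ x ∂(bulk Ω), ‖gradient η x‖ ≤ K := by
    filter_upwards [ae_restrict_mem hΩ.measurableSet] with x hx using h.norm_gradient_le hΩ hx
  have mul1 : ∀ {E : Type} [NormedAddCommGroup E] [NormedSpace ℝ E] {μ : Measure Plane}
      {f : Plane → E}, (∀ᵐ x ∂μ, ‖η x‖ ≤ 1) → MemLp f 2 μ → MemLp (fun x => η x • f x) 2 μ :=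
    fun hη hf => hf.of_le (h.measurable.aestronglyMeasurable.smul hf.1) <| by
      filter_upwards [hη] with x hx
      rw [norm_smul]
      exact mul_le_of_le_one_left (norm_nonneg _) hx
  have mul2 : ∀ {μ : Measure Plane} {f : Plane → ℝ} {G : Plane → Plane}, Measurable G →
      (∀ᵐ x ∂μ, ‖G x‖ ≤ K) → MemLp f 2 μ → MemLp (fun x => f x • G x) 2 μ :=
    fun hG hGK hf => hf.of_le_mul (c := K) (hf.1.smul hG.aestronglyMeasurable) <| by
      filter_upwards [hGK] with x hx
      rw [norm_smul, mul_comm]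
      exact mul_le_mul_of_nonneg_right hx (norm_nonneg _)
  have m1 : MemLp (fun x => η x * val v x) 2 (bulk Ω) := mul1 hη (Lp.memLp (val v))
  have m2 : MemLp (fun x => η x • grad v x + val v x • gradient η x) 2 (bulk Ω) :=
    (mul1 hη (Lp.memLp (grad v))).add (mul2 hmg hgη (Lp.memLp (val v)))
  have m3 : MemLp (fun x => η x * trace v x) 2 Γ.length := mul1 hη' (Lp.memLp (trace v))
  have m4 : MemLp (fun x => η x • tgrad v x + trace v x • T x) 2 Γ.length :=
    (mul1 hη' (Lp.memLp (tgrad v))).add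
      (mul2 hT.measurable (hT.ae_norm_le h) (Lp.memLp (trace v)))
  have h1 : HasGradientAndTrace Γ m1.toLp m2.toLp m3.toLp :=
    (HasGradientAndTrace.mul h hΩ hb (Lp.aestronglyMeasurable (val v))
      (Lp.aestronglyMeasurable (grad v)) (Lp.aestronglyMeasurable (trace v)) v.2.1).congr
      m1.coeFn_toLp m2.coeFn_toLp m3.coeFn_toLp
  have h2 : HasTangentialGradient Γ m3.toLp m4.toLp :=
    (HasTangentialGradient.mul h hT v.2.2).congr m3.coeFn_toLp m4.coeFn_toLp
  exact ⟨⟨(m1.toLp, m2.toLp, m3.toLp, m4.toLp), h1, h2⟩, m1.coeFn_toLp, m2.coeFn_toLp,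
    m3.coeFn_toLp, m4.coeFn_toLp⟩

end LOD

/-! ### Decompositions over the mesh, and nodal cut-off functions -/

namespace LOD

variable {Ω : Set Plane} {Γ : Interfaces Ω} {𝒯 : Triangulation Ω} {γ : ℝ}

namespace Triangulation

theorem exists_mem_hull (𝒯 : Triangulation Ω) {x : Plane} (hx : x ∈ closure Ω) :
    ∃ t : 𝒯.tri, x ∈ hull t.1 := by
  rw [← 𝒯.cover] at hx
  obtain ⟨t, ht, hx⟩ := mem_iUnion₂.1 hx
  exact ⟨⟨t, ht⟩, hx⟩

/-- Nearby points of the closed domain share an element. -/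
theorem eventually_exists_mem_hull (𝒯 : Triangulation Ω) (x : Plane) :
    ∀ᶠ y in 𝓝[closure Ω] x, ∃ t : 𝒯.tri, x ∈ hull t.1 ∧ y ∈ hull t.1 := by
  have h : ∀ᶠ y in 𝓝 x, ∀ t : 𝒯.tri, y ∈ hull t.1 → x ∈ hull t.1 := by
    refine eventually_all.2 fun t => ?_
    by_cases hx : x ∈ hull t.1
    · exact Eventually.of_forall fun _ _ => hx
    · filter_upwards [(isCompact_hull t.1).isClosed.isOpen_compl.mem_nhds hx] with y hy hy'
      exact absurd hy' hy
  filter_upwards [mem_nhdsWithin_of_mem_nhds h, self_mem_nhdsWithin] with y hy hyΩ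
  obtain ⟨t, ht⟩ := 𝒯.exists_mem_hull hyΩ
  exact ⟨t, hy t ht, ht⟩

/-- Almost every point that lies in an element lies in its interior. -/
theorem ae_mem_interior_hull (𝒯 : Triangulation Ω) :
    ∀ᵐ x ∂(bulk Ω), ∀ t : 𝒯.tri, x ∈ hull t.1 → x ∈ interior (hull t.1) := by
  refine ae_restrict_of_ae (ae_all_iff.2 fun t => ?_)
  have h : volume (frontier (hull t.1)) = 0 := (convex_convexHull ℝ _).addHaar_frontier volume
  filter_upwards [measure_eq_zero_iff_ae_notMem.1 h] with x hx hxt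
  by_contra hxi
  exact hx ⟨subset_closure hxt, hxi⟩

theorem integral_bulk_eq_sum (𝒯 : Triangulation Ω) (hΩ : IsOpen Ω) {f : Plane → ℝ}
    (hf : Integrable f (bulk Ω)) :
    ∫ x, f x ∂(bulk Ω) = ∑ t : 𝒯.tri, ∫ x in hull t.1, f x ∂(bulk Ω) := by
  have h := hasSum_integral_iUnion_ae (μ := bulk Ω) (f := f) (s := fun t : 𝒯.tri => hull t.1)
    (fun t => (measurableSet_hull t.1).nullMeasurableSet) (fun s t hst => by
      have := 𝒯.volume_inter_hull s.2 t.2 fun h => hst (Subtype.ext h)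
      exact le_antisymm ((Measure.restrict_apply_le _ _).trans this.le) zero_le) hf.integrableOn
  rw [(hasSum_fintype _).unique h]
  rw [Measure.restrict_eq_self_of_ae_mem]
  filter_upwards [ae_restrict_mem hΩ.measurableSet] with x hx
  exact mem_iUnion.2 (𝒯.exists_mem_hull (subset_closure hx))

/-- The piecewise affine cut-off function with the nodal values `0` at the vertices of the
elements in `F` and `1` elsewhere. -/
theorem IsRegular.exists_multiplier (h : 𝒯.IsRegular γ) (hΩ : IsPolygonalDomain Ω)
    (F : Finset 𝒯.tri) {K : NNReal} (hK : 2 * γ / 𝒯.meshSize ≤ K) :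
    ∃ η : Plane → ℝ, IsMultiplier Ω η K ∧
      (∀ s ∈ F, ∀ x ∈ hull s.1, η x = 0) ∧
      (∀ s, (∀ t ∈ F, ¬ 𝒯.Meets s t) → ∀ x ∈ hull s.1, η x = 1) := by
  obtain ⟨η₀, b, c, h1, h2, h3, h4, h5⟩ := h.exists_cutoff hΩ F
  set η : Plane → ℝ := (closure Ω).indicator η₀ with hη
  have heq : ∀ s : 𝒯.tri, ∀ x ∈ hull s.1, η x = η₀ x := fun s x hx =>
    indicator_of_mem (𝒯.hull_subset s.2 hx) η₀
  have hlip : ∀ x ∈ closure Ω, ∀ᶠ y in 𝓝[closure Ω] x, |η y - η x| ≤ K * dist y x := by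
    intro x _
    filter_upwards [𝒯.eventually_exists_mem_hull x] with y hy
    obtain ⟨t, hxt, hyt⟩ := hy
    rw [heq t y hyt, heq t x hxt, h1 t y hyt, h1 t x hxt, add_sub_add_right_eq_sub,
      ← inner_sub_right, dist_eq_norm]
    exact (abs_real_inner_le_norm _ _).trans
      (mul_le_mul_of_nonneg_right ((h3 t).trans hK) (norm_nonneg _))
  have hcont : ContinuousOn η₀ (closure Ω) := fun x hx => by
    rw [ContinuousWithinAt, tendsto_iff_dist_tendsto_zero]
    have hlim : Tendsto (fun y => (K : ℝ) * dist y x) (𝓝 x) (𝓝 (K * dist x x)) :=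
      ((continuous_id.dist continuous_const).const_mul _).tendsto x
    rw [dist_self, mul_zero] at hlim
    refine squeeze_zero' (Eventually.of_forall fun _ => dist_nonneg) ?_
      (hlim.mono_left nhdsWithin_le_nhds)
    filter_upwards [hlip x hx, self_mem_nhdsWithin] with y hy hyΩ
    rwa [hη, indicator_of_mem hyΩ, indicator_of_mem hx] at hy
  refine ⟨η, ⟨?_, fun x hx => ?_, hlip, ?_⟩, fun s hs x hx => ?_, fun s hs x hx => ?_⟩
  · classical
    have := hcont.measurable_piecewise (g := fun _ => (0 : ℝ)) continuousOn_const
      isClosed_closure.measurableSet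
    rwa [hη, ← piecewise_eq_indicator]
  · obtain ⟨t, ht⟩ := 𝒯.exists_mem_hull hx
    rw [heq t x ht, abs_le]
    have := h2 t x ht
    exact ⟨by linarith [this.1], this.2⟩
  · filter_upwards [𝒯.ae_mem_interior_hull, ae_restrict_mem hΩ.isOpen.measurableSet] with x hx hxΩ
    obtain ⟨t, ht⟩ := 𝒯.exists_mem_hull (subset_closure hxΩ)
    have hd : DifferentiableAt ℝ (fun y => (inner ℝ (b t) y : ℝ) + c t) x :=
      ((differentiableAt_const (b t)).inner ℝ differentiableAt_id).add_const (c t)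
    refine hd.congr_of_eventuallyEq ?_
    filter_upwards [mem_interior_iff_mem_nhds.1 (hx t ht)] with y hy
    rw [heq t y hy, h1 t y hy]
  · rw [heq s x hx, (h4 s hs).2 x hx]
  · rw [heq s x hx, (h5 s hs).2 x hx]

theorem ae_gradient_eq_zero (𝒯 : Triangulation Ω) {η : Plane → ℝ} {t : 𝒯.tri} {c : ℝ}
    (h : ∀ x ∈ hull t.1, η x = c) : ∀ᵐ x ∂(bulk Ω), x ∈ hull t.1 → gradient η x = 0 := by
  filter_upwards [𝒯.ae_mem_interior_hull] with x hx hxt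
  have : η =ᶠ[𝓝 x] fun _ => c := by
    filter_upwards [mem_interior_iff_mem_nhds.1 (hx t hxt)] with y hy using h y hy
  rw [gradient_eq, this.fderiv_eq]
  simp

end Triangulation

namespace IsDistribution

variable {P : Finset Plane → Set Plane}

theorem ae_mem (hP : IsDistribution Γ 𝒯 P) : ∀ᵐ x ∂Γ.length, ∃ t : 𝒯.tri, x ∈ P t.1 := by
  filter_upwards [Γ.ae_mem_carrier] with x hx
  rw [← hP.cover] at hx
  obtain ⟨t, ht, hx⟩ := mem_iUnion₂.1 hx
  exact ⟨⟨t, ht⟩, hx⟩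

theorem integral_length_eq_sum (hP : IsDistribution Γ 𝒯 P) {f : Plane → ℝ}
    (hf : Integrable f Γ.length) :
    ∫ x, f x ∂Γ.length = ∑ t : 𝒯.tri, ∫ x in P t.1, f x ∂Γ.length := by
  have h := hasSum_integral_iUnion_ae (μ := Γ.length) (f := f) (s := fun t : 𝒯.tri => P t.1)
    (fun t => (hP.measurable t.1 t.2).nullMeasurableSet) (fun s t hst =>
      (hP.disjoint s.1 s.2 t.1 t.2 fun h => hst (Subtype.ext h)).aedisjoint) hf.integrableOn
  rw [(hasSum_fintype _).unique h]
  rw [Measure.restrict_eq_self_of_ae_mem]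
  filter_upwards [hP.ae_mem] with x hx
  exact mem_iUnion.2 hx

end IsDistribution

end LOD

/-! ### The local forms and the local Dirichlet energies -/

namespace LOD

variable {Ω : Set Plane} {Γ : Interfaces Ω} {𝒯 : Triangulation Ω} {γ α β : ℝ} {A B : Plane → ℝ}

namespace IsPermeability

theorem integrable_coeff_mul_inner {μ : Measure Plane} {A : Plane → ℝ} {α β : ℝ}
    (hm : AEStronglyMeasurable A μ) (hb : ∀ᵐ x ∂μ, α ≤ A x ∧ A x ≤ β) (G K : Lp Plane 2 μ) :
    Integrable (fun x => A x * inner ℝ (G x) (K x)) μ := by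
  refine (L2.integrable_inner (𝕜 := ℝ) G K).bdd_mul (c := max |α| |β|) hm ?_
  filter_upwards [hb] with x hx
  exact abs_le_max_abs_abs hx.1 hx.2

theorem integrable_bulk (h : IsPermeability Γ A B α β) (v w : energySpace Γ) :
    Integrable (fun x => A x * inner ℝ (grad v x) (grad w x)) (bulk Ω) :=
  integrable_coeff_mul_inner h.bulk_measurable h.bulk_bounds _ _

theorem integrable_interface (h : IsPermeability Γ A B α β) (v w : energySpace Γ) :
    Integrable (fun x => B x * inner ℝ (tgrad v x) (tgrad w x)) Γ.length :=
  integrable_coeff_mul_inner h.interface_measurable h.interface_bounds _ _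

end IsPermeability

theorem formOn_comm (A B : Plane → ℝ) (S S' : Set Plane) (v w : energySpace Γ) :
    formOn A B S S' v w = formOn A B S S' w v := by
  simp only [formOn, real_inner_comm]

theorem coeFn_grad_add (v w : energySpace Γ) :
    grad (v + w) =ᵐ[bulk Ω] fun x => grad v x + grad w x := Lp.coeFn_add (grad v) (grad w)

theorem coeFn_tgrad_add (v w : energySpace Γ) :
    tgrad (v + w) =ᵐ[Γ.length] fun x => tgrad v x + tgrad w x := Lp.coeFn_add (tgrad v) (tgrad w)

theorem coeFn_grad_smul (c : ℝ) (v : energySpace Γ) :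
    grad (c • v) =ᵐ[bulk Ω] fun x => c • grad v x := Lp.coeFn_smul c (grad v)

theorem coeFn_tgrad_smul (c : ℝ) (v : energySpace Γ) :
    tgrad (c • v) =ᵐ[Γ.length] fun x => c • tgrad v x := Lp.coeFn_smul c (tgrad v)

theorem formOn_add_left (h : IsPermeability Γ A B α β) (S S' : Set Plane)
    (v v' w : energySpace Γ) :
    formOn A B S S' (v + v') w = formOn A B S S' v w + formOn A B S S' v' w := by
  have e1 : ∫ x in S, A x * inner ℝ (grad (v + v') x) (grad w x) ∂(bulk Ω) =
      ∫ x in S, (A x * inner ℝ (grad v x) (grad w x) +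
        A x * inner ℝ (grad v' x) (grad w x)) ∂(bulk Ω) := by
    refine integral_congr_ae (ae_restrict_of_ae ?_)
    filter_upwards [coeFn_grad_add v v'] with x hx
    rw [hx, inner_add_left, mul_add]
  have e2 : ∫ x in S', B x * inner ℝ (tgrad (v + v') x) (tgrad w x) ∂Γ.length =
      ∫ x in S', (B x * inner ℝ (tgrad v x) (tgrad w x) +
        B x * inner ℝ (tgrad v' x) (tgrad w x)) ∂Γ.length := by
    refine integral_congr_ae (ae_restrict_of_ae ?_)
    filter_upwards [coeFn_tgrad_add v v'] with x hx
    rw [hx, inner_add_left, mul_add]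
  rw [formOn, e1, e2, integral_add (h.integrable_bulk v w).integrableOn
    (h.integrable_bulk v' w).integrableOn, integral_add (h.integrable_interface v w).integrableOn
    (h.integrable_interface v' w).integrableOn, formOn, formOn]
  ring

theorem formOn_smul_left (A B : Plane → ℝ) (S S' : Set Plane) (c : ℝ) (v w : energySpace Γ) :
    formOn A B S S' (c • v) w = c * formOn A B S S' v w := by
  have e1 : ∫ x in S, A x * inner ℝ (grad (c • v) x) (grad w x) ∂(bulk Ω) =
      ∫ x in S, c * (A x * inner ℝ (grad v x) (grad w x)) ∂(bulk Ω) := by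
    refine integral_congr_ae (ae_restrict_of_ae ?_)
    filter_upwards [coeFn_grad_smul c v] with x hx
    rw [hx, real_inner_smul_left]
    ring
  have e2 : ∫ x in S', B x * inner ℝ (tgrad (c • v) x) (tgrad w x) ∂Γ.length =
      ∫ x in S', c * (B x * inner ℝ (tgrad v x) (tgrad w x)) ∂Γ.length := by
    refine integral_congr_ae (ae_restrict_of_ae ?_)
    filter_upwards [coeFn_tgrad_smul c v] with x hx
    rw [hx, real_inner_smul_left]
    ring
  rw [formOn, e1, e2, integral_const_mul, integral_const_mul, formOn]
  ring

/-- The form restricted to parts of the domain and of the interfaces, as a bilinear map. -/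
noncomputable def formMap (h : IsPermeability Γ A B α β) (S S' : Set Plane) :
    energySpace Γ →ₗ[ℝ] energySpace Γ →ₗ[ℝ] ℝ :=
  LinearMap.mk₂ ℝ (formOn A B S S') (formOn_add_left h S S') (formOn_smul_left A B S S')
    (fun v w w' => by
      rw [formOn_comm, formOn_add_left h, formOn_comm _ _ _ _ w, formOn_comm _ _ _ _ w'])
    (fun c v w => by rw [formOn_comm, formOn_smul_left, formOn_comm, smul_eq_mul])

/-- `∫_S |∇v|² + ∫_S' |∇_τ v|²`. -/
noncomputable def dirichlet (S S' : Set Plane) (v : energySpace Γ) : ℝ :=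
  (∫ x in S, ‖grad v x‖ ^ 2 ∂(bulk Ω)) + ∫ x in S', ‖tgrad v x‖ ^ 2 ∂Γ.length

/-- `∫_S v² + ∫_S' v²`. -/
noncomputable def mass (S S' : Set Plane) (v : energySpace Γ) : ℝ :=
  (∫ x in S, ‖val v x‖ ^ 2 ∂(bulk Ω)) + ∫ x in S', ‖trace v x‖ ^ 2 ∂Γ.length

theorem integrable_norm_sq {E : Type*} [NormedAddCommGroup E] {μ : Measure Plane}
    (f : Lp E 2 μ) : Integrable (fun x => ‖f x‖ ^ 2) μ :=
  (Lp.memLp f).integrable_norm_pow (by norm_num)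

theorem norm_sq_eq_integral {E : Type*} [NormedAddCommGroup E] {μ : Measure Plane}
    (f : Lp E 2 μ) : ‖f‖ ^ 2 = ∫ x, ‖f x‖ ^ 2 ∂μ := by
  have h1 := eLpNorm_two_sq μ f
  rw [Lp.norm_def, ← ENNReal.toReal_pow, h1,
    integral_eq_lintegral_of_nonneg_ae (ae_of_all _ fun _ => by positivity)
      (integrable_norm_sq f).1]
  congr 1
  refine lintegral_congr fun x => ?_
  rw [← ofReal_norm, ENNReal.ofReal_pow (norm_nonneg _)]

theorem l2norm_nonneg {E : Type*} [NormedAddCommGroup E] (μ : Measure Plane) (S : Set Plane)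
    (f : Plane → E) : 0 ≤ l2norm μ S f := Real.sqrt_nonneg _

theorem l2norm_sq {E : Type*} [NormedAddCommGroup E] (μ : Measure Plane) (S : Set Plane)
    (f : Plane → E) : l2norm μ S f ^ 2 = ∫ x in S, ‖f x‖ ^ 2 ∂μ :=
  Real.sq_sqrt (integral_nonneg fun _ => by positivity)

theorem dirichlet_nonneg (S S' : Set Plane) (v : energySpace Γ) : 0 ≤ dirichlet S S' v :=
  add_nonneg (integral_nonneg fun _ => by positivity) (integral_nonneg fun _ => by positivity)

theorem IsPermeability.le_form (h : IsPermeability Γ A B α β) (S S' : Set Plane)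
    (v : energySpace Γ) : α * dirichlet S S' v ≤ formOn A B S S' v v := by
  rw [dirichlet, mul_add, formOn, ← integral_const_mul, ← integral_const_mul]
  refine add_le_add (integral_mono_ae ((integrable_norm_sq _).const_mul α).integrableOn
    (h.integrable_bulk v v).integrableOn (ae_restrict_of_ae ?_))
    (integral_mono_ae ((integrable_norm_sq _).const_mul α).integrableOn
    (h.integrable_interface v v).integrableOn (ae_restrict_of_ae ?_))
  · filter_upwards [h.bulk_bounds] with x hx
    rw [real_inner_self_eq_norm_sq]
    exact mul_le_mul_of_nonneg_right hx.1 (by positivity)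
  · filter_upwards [h.interface_bounds] with x hx
    rw [real_inner_self_eq_norm_sq]
    exact mul_le_mul_of_nonneg_right hx.1 (by positivity)

theorem IsPermeability.form_le (h : IsPermeability Γ A B α β) (S S' : Set Plane)
    (v : energySpace Γ) : formOn A B S S' v v ≤ β * dirichlet S S' v := by
  rw [dirichlet, mul_add, formOn, ← integral_const_mul, ← integral_const_mul]
  refine add_le_add (integral_mono_ae (h.integrable_bulk v v).integrableOn
    ((integrable_norm_sq _).const_mul β).integrableOn (ae_restrict_of_ae ?_))
    (integral_mono_ae (h.integrable_interface v v).integrableOn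
    ((integrable_norm_sq _).const_mul β).integrableOn (ae_restrict_of_ae ?_))
  · filter_upwards [h.bulk_bounds] with x hx
    rw [real_inner_self_eq_norm_sq]
    exact mul_le_mul_of_nonneg_right hx.2 (by positivity)
  · filter_upwards [h.interface_bounds] with x hx
    rw [real_inner_self_eq_norm_sq]
    exact mul_le_mul_of_nonneg_right hx.2 (by positivity)

theorem sum_formOn (h : IsPermeability Γ A B α β) (hΩ : IsOpen Ω) {P : Finset Plane → Set Plane}
    (hP : IsDistribution Γ 𝒯 P) (v w : energySpace Γ) :
    ∑ t : 𝒯.tri, formOn A B (hull t.1) (P t.1) v w = form A B v w := by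
  simp only [form, formOn, setIntegral_univ, Finset.sum_add_distrib]
  rw [𝒯.integral_bulk_eq_sum hΩ (h.integrable_bulk v w),
    hP.integral_length_eq_sum (h.integrable_interface v w)]

theorem sum_dirichlet (hΩ : IsOpen Ω) {P : Finset Plane → Set Plane}
    (hP : IsDistribution Γ 𝒯 P) (v : energySpace Γ) :
    ∑ t : 𝒯.tri, dirichlet (hull t.1) (P t.1) v = dirichlet univ univ v := by
  simp only [dirichlet, setIntegral_univ, Finset.sum_add_distrib]
  rw [𝒯.integral_bulk_eq_sum hΩ (integrable_norm_sq _),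
    hP.integral_length_eq_sum (integrable_norm_sq _)]

theorem sum_mass (hΩ : IsOpen Ω) {P : Finset Plane → Set Plane}
    (hP : IsDistribution Γ 𝒯 P) (v : energySpace Γ) :
    ∑ t : 𝒯.tri, mass (hull t.1) (P t.1) v = ‖val v‖ ^ 2 + ‖trace v‖ ^ 2 := by
  rw [norm_sq_eq_integral, norm_sq_eq_integral, 𝒯.integral_bulk_eq_sum hΩ (integrable_norm_sq _),
    hP.integral_length_eq_sum (integrable_norm_sq _), ← Finset.sum_add_distrib]
  rfl

theorem dirichlet_univ (v : energySpace Γ) :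
    dirichlet univ univ v = ‖grad v‖ ^ 2 + ‖tgrad v‖ ^ 2 := by
  rw [norm_sq_eq_integral, norm_sq_eq_integral, dirichlet, setIntegral_univ, setIntegral_univ]

/-! ### The interpolation bounds in terms of the local energies -/

theorem setIntegral_le_sum {μ : Measure Plane} {ι : Type*} {f : Plane → ℝ} (hf : Integrable f μ)
    (h0 : ∀ x, 0 ≤ f x) {S : Set Plane} (hS : MeasurableSet S) (F : Finset ι) (E : ι → Set Plane)
    (hE : ∀ s, MeasurableSet (E s)) (h : ∀ᵐ x ∂μ, x ∈ S → ∃ s ∈ F, x ∈ E s) :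
    ∫ x in S, f x ∂μ ≤ ∑ s ∈ F, ∫ x in E s, f x ∂μ := by
  have e : ∑ s ∈ F, ∫ x in E s, f x ∂μ = ∫ x, ∑ s ∈ F, (E s).indicator f x ∂μ := by
    rw [integral_finsetSum _ fun s _ => hf.indicator (hE s)]
    exact Finset.sum_congr rfl fun s _ => (integral_indicator (hE s)).symm
  rw [e, ← integral_indicator hS]
  refine integral_mono_ae (hf.indicator hS)
    (integrable_finsetSum _ fun s _ => hf.indicator (hE s)) ?_
  have hnn : ∀ s x, 0 ≤ (E s).indicator f x := fun s x => indicator_nonneg (fun y _ => h0 y) x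
  filter_upwards [h] with x hx
  by_cases hxS : x ∈ S
  · obtain ⟨s, hs, hxs⟩ := hx hxS
    rw [indicator_of_mem hxS]
    calc f x = (E s).indicator f x := (indicator_of_mem hxs f).symm
      _ ≤ _ := Finset.single_le_sum (f := fun s => (E s).indicator f x) (fun s _ => hnn s x) hs
  · rw [indicator_of_notMem hxS]
    exact Finset.sum_nonneg fun s _ => hnn s x

namespace IsDistribution

variable {P : Finset Plane → Set Plane}

theorem ae_exists_mem (hP : IsDistribution Γ 𝒯 P) (t : 𝒯.tri) : ∀ᵐ x ∂Γ.length,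
    x ∈ 𝒯.nbhd (hull t.1) → ∃ s ∈ graphBall 𝒯.Meets 2 t, x ∈ P s.1 := by
  filter_upwards [hP.ae_mem] with x hx hxt
  obtain ⟨s, hs⟩ := hx
  rw [Triangulation.nbhd_hull_eq] at hxt
  obtain ⟨u, hu, hxu⟩ := mem_iUnion₂.1 hxt
  exact ⟨s, mem_graphBall_succ.2 ⟨u, hu, x, (hP.subset s.1 s.2 hs).2, hxu⟩, hs⟩

theorem dirichlet_nbhd_le (hP : IsDistribution Γ 𝒯 P) (t : 𝒯.tri) (v : energySpace Γ) :
    dirichlet (𝒯.nbhd (hull t.1)) (𝒯.nbhd (hull t.1)) v ≤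
      ∑ s ∈ graphBall 𝒯.Meets 2 t, dirichlet (hull s.1) (P s.1) v := by
  have hm : MeasurableSet (𝒯.nbhd (hull t.1)) := by
    rw [Triangulation.nbhd_hull_eq]
    exact Finset.measurableSet_biUnion _ fun s _ => measurableSet_hull s.1
  simp only [dirichlet, Finset.sum_add_distrib]
  refine add_le_add ?_ ?_
  · refine setIntegral_le_sum (integrable_norm_sq _) (fun _ => by positivity) hm _
      (fun s : 𝒯.tri => hull s.1) (fun s => measurableSet_hull s.1) (ae_of_all _ fun x hx => ?_)
    rw [Triangulation.nbhd_hull_eq] at hx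
    obtain ⟨u, hu, hxu⟩ := mem_iUnion₂.1 hx
    exact ⟨u, graphBall_mono Triangulation.Meets.refl (by norm_num) hu, hxu⟩
  · exact setIntegral_le_sum (integrable_norm_sq _) (fun _ => by positivity) hm _
      (fun s : 𝒯.tri => P s.1) (fun s => hP.measurable s.1 s.2) (hP.ae_exists_mem t)

theorem dirichlet_le_hull (hP : IsDistribution Γ 𝒯 P) (t : 𝒯.tri) (v : energySpace Γ) :
    dirichlet (hull t.1) (P t.1) v ≤ dirichlet (hull t.1) (hull t.1) v :=
  add_le_add_right (setIntegral_mono_set (integrable_norm_sq _).integrableOn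
    (ae_of_all _ fun _ => by positivity)
    (LE.le.eventuallyLE fun _ hx => (hP.subset t.1 t.2 hx).2)) _

theorem mass_le_hull (hP : IsDistribution Γ 𝒯 P) (t : 𝒯.tri) (v : energySpace Γ) :
    mass (hull t.1) (P t.1) v ≤ mass (hull t.1) (hull t.1) v :=
  add_le_add_right (setIntegral_mono_set (integrable_norm_sq _).integrableOn
    (ae_of_all _ fun _ => by positivity)
    (LE.le.eventuallyLE fun _ hx => (hP.subset t.1 t.2 hx).2)) _

end IsDistribution

theorem add_sq_le_of_add_le {a b c d C : ℝ} (ha : 0 ≤ a) (hb : 0 ≤ b)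
    (h : a + b ≤ C * (c + d)) : a ^ 2 + b ^ 2 ≤ 2 * C ^ 2 * (c ^ 2 + d ^ 2) := by
  have h1 : (a + b) ^ 2 ≤ (C * (c + d)) ^ 2 := pow_le_pow_left₀ (by positivity) h 2
  nlinarith [mul_nonneg ha hb, mul_nonneg (sq_nonneg C) (sq_nonneg (c - d))]

namespace IsInterpolation

variable {P : Finset Plane → Set Plane} {C : ℝ} {I : energySpace Γ →ₗ[ℝ] coarseSpace Γ 𝒯}

theorem dirichlet_le (hI : IsInterpolation 𝒯 C I) (hP : IsDistribution Γ 𝒯 P) (t : 𝒯.tri)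
    (v : energySpace Γ) : dirichlet (hull t.1) (P t.1) (I v : energySpace Γ) ≤
      2 * C ^ 2 * ∑ s ∈ graphBall 𝒯.Meets 2 t, dirichlet (hull s.1) (P s.1) v := by
  have h1 : dirichlet (hull t.1) (hull t.1) (I v : energySpace Γ) ≤
      2 * C ^ 2 * dirichlet (𝒯.nbhd (hull t.1)) (𝒯.nbhd (hull t.1)) v := by
    simp only [dirichlet, ← l2norm_sq]
    exact add_sq_le_of_add_le (l2norm_nonneg _ _ _) (l2norm_nonneg _ _ _)
      (hI.stability v t.1 t.2)
  have h2 := hP.dirichlet_nbhd_le t v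
  have h3 := hP.dirichlet_le_hull t (I v : energySpace Γ)
  exact h3.trans (h1.trans (mul_le_mul_of_nonneg_left h2 (by positivity)))

theorem mass_sub_le (hI : IsInterpolation 𝒯 C I) (hP : IsDistribution Γ 𝒯 P) (t : 𝒯.tri)
    (v : energySpace Γ) : mass (hull t.1) (P t.1) (v - (I v : energySpace Γ)) ≤
      2 * (C * 𝒯.meshSize) ^ 2 *
        ∑ s ∈ graphBall 𝒯.Meets 2 t, dirichlet (hull s.1) (P s.1) v := by
  have h1 : mass (hull t.1) (hull t.1) (v - (I v : energySpace Γ)) ≤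
      2 * (C * 𝒯.meshSize) ^ 2 * dirichlet (𝒯.nbhd (hull t.1)) (𝒯.nbhd (hull t.1)) v := by
    simp only [mass, dirichlet, ← l2norm_sq]
    exact add_sq_le_of_add_le (l2norm_nonneg _ _ _) (l2norm_nonneg _ _ _)
      (hI.error_bound v t.1 t.2)
  have h2 := hP.dirichlet_nbhd_le t v
  have h3 := hP.mass_le_hull t (v - (I v : energySpace Γ))
  exact h3.trans (h1.trans (mul_le_mul_of_nonneg_left h2 (by positivity)))

end IsInterpolation

theorem ae_eq_zero_of_setIntegral_sq {E : Type*} [NormedAddCommGroup E] {μ : Measure Plane}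
    (f : Lp E 2 μ) {S : Set Plane} (hS : MeasurableSet S) (h : ∫ x in S, ‖f x‖ ^ 2 ∂μ = 0) :
    ∀ᵐ x ∂μ, x ∈ S → f x = 0 := by
  rw [setIntegral_eq_zero_iff_of_nonneg_ae (ae_of_all _ fun _ => by positivity)
    (integrable_norm_sq f).integrableOn] at h
  filter_upwards [(ae_restrict_iff' hS).1 h] with x hx hxS
  simpa using hx hxS

end LOD

/-! ### The mesh and the interpolation as a localized setting -/

namespace LOD

variable {Ω : Set Plane} {Γ : Interfaces Ω} {𝒯 : Triangulation Ω} {γ α β : ℝ} {A B : Plane → ℝ}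

theorem coeFn_val_add (v w : energySpace Γ) :
    val (v + w) =ᵐ[bulk Ω] fun x => val v x + val w x := Lp.coeFn_add (val v) (val w)

theorem coeFn_trace_add (v w : energySpace Γ) :
    trace (v + w) =ᵐ[Γ.length] fun x => trace v x + trace w x := Lp.coeFn_add (trace v) (trace w)

theorem coeFn_val_smul (c : ℝ) (v : energySpace Γ) :
    val (c • v) =ᵐ[bulk Ω] fun x => c * val v x := Lp.coeFn_smul c (val v)

theorem coeFn_trace_smul (c : ℝ) (v : energySpace Γ) :
    trace (c • v) =ᵐ[Γ.length] fun x => c * trace v x := Lp.coeFn_smul c (trace v)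

theorem coeFn_val_sub (v w : energySpace Γ) :
    val (v - w) =ᵐ[bulk Ω] fun x => val v x - val w x := Lp.coeFn_sub (val v) (val w)

theorem coeFn_trace_sub (v w : energySpace Γ) :
    trace (v - w) =ᵐ[Γ.length] fun x => trace v x - trace w x := Lp.coeFn_sub (trace v) (trace w)

theorem coeFn_grad_sub (v w : energySpace Γ) :
    grad (v - w) =ᵐ[bulk Ω] fun x => grad v x - grad w x := Lp.coeFn_sub (grad v) (grad w)

theorem coeFn_tgrad_sub (v w : energySpace Γ) :
    tgrad (v - w) =ᵐ[Γ.length] fun x => tgrad v x - tgrad w x := Lp.coeFn_sub (tgrad v) (tgrad w)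

theorem coeFn_val_zero : val (0 : energySpace Γ) =ᵐ[bulk Ω] fun _ => 0 := Lp.coeFn_zero ℝ 2 _

theorem coeFn_grad_zero : grad (0 : energySpace Γ) =ᵐ[bulk Ω] fun _ => 0 := Lp.coeFn_zero Plane 2 _

theorem coeFn_trace_zero : trace (0 : energySpace Γ) =ᵐ[Γ.length] fun _ => 0 :=
  Lp.coeFn_zero ℝ 2 _

theorem coeFn_tgrad_zero : tgrad (0 : energySpace Γ) =ᵐ[Γ.length] fun _ => 0 :=
  Lp.coeFn_zero Plane 2 _

/-- The functions that vanish, with their gradients, on `S ⊆ Ω` and on `S' ⊆ Γ`. -/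
def vanishing (Γ : Interfaces Ω) (S S' : Set Plane) : Submodule ℝ (energySpace Γ) where
  carrier := {v | (∀ᵐ x ∂(bulk Ω), x ∈ S → val v x = 0 ∧ grad v x = 0) ∧
    ∀ᵐ x ∂Γ.length, x ∈ S' → trace v x = 0 ∧ tgrad v x = 0}
  add_mem' := by
    rintro v w ⟨h1, h2⟩ ⟨h3, h4⟩
    constructor
    · filter_upwards [h1, h3, coeFn_val_add v w, coeFn_grad_add v w] with x h1 h3 e1 e2 hx
      rw [e1, e2, (h1 hx).1, (h1 hx).2, (h3 hx).1, (h3 hx).2]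
      simp
    · filter_upwards [h2, h4, coeFn_trace_add v w, coeFn_tgrad_add v w] with x h1 h3 e1 e2 hx
      rw [e1, e2, (h1 hx).1, (h1 hx).2, (h3 hx).1, (h3 hx).2]
      simp
  zero_mem' := by
    constructor
    · filter_upwards [coeFn_val_zero, coeFn_grad_zero] with x e1 e2 _ using ⟨e1, e2⟩
    · filter_upwards [coeFn_trace_zero, coeFn_tgrad_zero] with x e1 e2 _ using ⟨e1, e2⟩
  smul_mem' := by
    rintro c v ⟨h1, h2⟩
    constructor
    · filter_upwards [h1, coeFn_val_smul c v, coeFn_grad_smul c v] with x h1 e1 e2 hx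
      rw [e1, e2, (h1 hx).1, (h1 hx).2]
      simp
    · filter_upwards [h2, coeFn_trace_smul c v, coeFn_tgrad_smul c v] with x h1 e1 e2 hx
      rw [e1, e2, (h1 hx).1, (h1 hx).2]
      simp

theorem formOn_eq_zero {S S' : Set Plane} (hS : MeasurableSet S) (hS' : MeasurableSet S')
    {v : energySpace Γ} (h1 : ∀ᵐ x ∂(bulk Ω), x ∈ S → grad v x = 0)
    (h2 : ∀ᵐ x ∂Γ.length, x ∈ S' → tgrad v x = 0) (w : energySpace Γ) :
    formOn A B S S' v w = 0 := by
  rw [formOn, integral_eq_zero_of_ae, integral_eq_zero_of_ae, add_zero]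
  · filter_upwards [(ae_restrict_iff' hS').2 h2] with x hx
    simp [hx]
  · filter_upwards [(ae_restrict_iff' hS).2 h1] with x hx
    simp [hx]

theorem dirichlet_eq_zero {S S' : Set Plane} (hS : MeasurableSet S) (hS' : MeasurableSet S')
    {v : energySpace Γ} (hv : v ∈ vanishing Γ S S') : dirichlet S S' v = 0 := by
  rw [dirichlet, integral_eq_zero_of_ae, integral_eq_zero_of_ae, add_zero]
  · filter_upwards [(ae_restrict_iff' hS').2 hv.2] with x hx
    simp [hx]
  · filter_upwards [(ae_restrict_iff' hS).2 hv.1] with x hx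
    simp [hx]

theorem mem_vanishing_of_le_zero {S S' : Set Plane} (hS : MeasurableSet S)
    (hS' : MeasurableSet S') {v y : energySpace Γ} (e1 : dirichlet S S' y ≤ 0)
    (e2 : mass S S' (v - y) ≤ 0) (hv : v ∈ vanishing Γ S S') : y ∈ vanishing Γ S S' := by
  have n1 : 0 ≤ ∫ x in S, ‖grad y x‖ ^ 2 ∂(bulk Ω) := integral_nonneg fun _ => by positivity
  have n2 : 0 ≤ ∫ x in S', ‖tgrad y x‖ ^ 2 ∂Γ.length := integral_nonneg fun _ => by positivity
  have n3 : 0 ≤ ∫ x in S, ‖val (v - y) x‖ ^ 2 ∂(bulk Ω) := integral_nonneg fun _ => by positivity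
  have n4 : 0 ≤ ∫ x in S', ‖trace (v - y) x‖ ^ 2 ∂Γ.length :=
    integral_nonneg fun _ => by positivity
  unfold dirichlet at e1
  unfold mass at e2
  have z1 := ae_eq_zero_of_setIntegral_sq (grad y) hS (le_antisymm (by linarith) n1)
  have z2 := ae_eq_zero_of_setIntegral_sq (tgrad y) hS' (le_antisymm (by linarith) n2)
  have z3 := ae_eq_zero_of_setIntegral_sq (val (v - y)) hS (le_antisymm (by linarith) n3)
  have z4 := ae_eq_zero_of_setIntegral_sq (trace (v - y)) hS' (le_antisymm (by linarith) n4)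
  constructor
  · filter_upwards [z1, z3, hv.1, coeFn_val_sub v y] with x a b c d hx
    rw [b hx, (c hx).1, zero_sub, eq_comm, neg_eq_zero] at d
    exact ⟨d, a hx⟩
  · filter_upwards [z2, z4, hv.2, coeFn_trace_sub v y] with x a b c d hx
    rw [b hx, (c hx).1, zero_sub, eq_comm, neg_eq_zero] at d
    exact ⟨d, a hx⟩

/-- The functions that vanish outside `S`. -/
def supportedIn (Γ : Interfaces Ω) (S : Set Plane) : Submodule ℝ (energySpace Γ) where
  carrier := {v | (∀ᵐ x ∂(bulk Ω), x ∉ S → val v x = 0) ∧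
    ∀ᵐ x ∂Γ.length, x ∉ S → trace v x = 0}
  add_mem' := by
    rintro v w ⟨h1, h2⟩ ⟨h1', h2'⟩
    constructor
    · filter_upwards [h1, h1', coeFn_val_add v w] with x a b c hx
      rw [c, a hx, b hx, add_zero]
    · filter_upwards [h2, h2', coeFn_trace_add v w] with x a b c hx
      rw [c, a hx, b hx, add_zero]
  zero_mem' := ⟨by filter_upwards [coeFn_val_zero] with x hx _ using hx,
    by filter_upwards [coeFn_trace_zero] with x hx _ using hx⟩
  smul_mem' := by
    rintro c v ⟨h1, h2⟩
    constructor
    · filter_upwards [h1, coeFn_val_smul c v] with x a b hx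
      rw [b, a hx, mul_zero]
    · filter_upwards [h2, coeFn_trace_smul c v] with x a b hx
      rw [b, a hx, mul_zero]

/-- The elements of the kernel of `I` that are supported in `S`. -/
noncomputable def fineSpace (I : energySpace Γ →ₗ[ℝ] coarseSpace Γ 𝒯) (S : Set Plane) :
    Submodule ℝ (energySpace Γ) := LinearMap.ker I ⊓ supportedIn Γ S

theorem dirichlet_mul_le {S S' : Set Plane} {η : Plane → ℝ} {G T : Plane → Plane} {K : ℝ}
    {v w : energySpace Γ} (hη : ∀ᵐ x ∂(bulk Ω), |η x| ≤ 1) (hη' : ∀ᵐ x ∂Γ.length, |η x| ≤ 1)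
    (hG : ∀ᵐ x ∂(bulk Ω), ‖G x‖ ≤ K) (hT : ∀ᵐ x ∂Γ.length, ‖T x‖ ≤ K)
    (h1 : grad w =ᵐ[bulk Ω] fun x => η x • grad v x + val v x • G x)
    (h2 : tgrad w =ᵐ[Γ.length] fun x => η x • tgrad v x + trace v x • T x) :
    dirichlet S S' w ≤ 2 * dirichlet S S' v + 2 * K ^ 2 * mass S S' v := by
  have key : ∀ (a b : ℝ) (p q : Plane), |a| ≤ 1 → ‖q‖ ≤ K →
      ‖a • p + b • q‖ ^ 2 ≤ 2 * ‖p‖ ^ 2 + 2 * K ^ 2 * ‖b‖ ^ 2 := fun a b p q ha hq => by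
    have e1 : ‖a • p + b • q‖ ≤ ‖p‖ + K * ‖b‖ := by
      refine (norm_add_le _ _).trans (add_le_add ?_ ?_)
      · rw [norm_smul]
        exact mul_le_of_le_one_left (norm_nonneg _) ha
      · rw [norm_smul, mul_comm]
        exact mul_le_mul_of_nonneg_right hq (norm_nonneg _)
    have e2 := pow_le_pow_left₀ (norm_nonneg _) e1 2
    nlinarith [sq_nonneg (‖p‖ - K * ‖b‖)]
  have i1 : ∫ x in S, ‖grad w x‖ ^ 2 ∂(bulk Ω) ≤ ∫ x in S, (2 * ‖grad v x‖ ^ 2 +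
      2 * K ^ 2 * ‖val v x‖ ^ 2) ∂(bulk Ω) := by
    refine integral_mono_ae (integrable_norm_sq _).integrableOn
      (((integrable_norm_sq _).const_mul _).add
        ((integrable_norm_sq _).const_mul _)).integrableOn (ae_restrict_of_ae ?_)
    filter_upwards [h1, hη, hG] with x h1 h2 h3
    rw [h1]
    exact key _ _ _ _ h2 h3
  have i2 : ∫ x in S', ‖tgrad w x‖ ^ 2 ∂Γ.length ≤ ∫ x in S', (2 * ‖tgrad v x‖ ^ 2 +
      2 * K ^ 2 * ‖trace v x‖ ^ 2) ∂Γ.length := by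
    refine integral_mono_ae (integrable_norm_sq _).integrableOn
      (((integrable_norm_sq _).const_mul _).add
        ((integrable_norm_sq _).const_mul _)).integrableOn (ae_restrict_of_ae ?_)
    filter_upwards [h2, hη', hT] with x h1 h2 h3
    rw [h1]
    exact key _ _ _ _ h2 h3
  rw [integral_add ((integrable_norm_sq _).const_mul _).integrableOn
    ((integrable_norm_sq _).const_mul _).integrableOn, integral_const_mul,
    integral_const_mul] at i1 i2
  unfold dirichlet mass
  linarith

/-- The data of the localization argument that are fixed together. -/
structure MeshData (Γ : Interfaces Ω) (𝒯 : Triangulation Ω) (P : Finset Plane → Set Plane)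
    (I : energySpace Γ →ₗ[ℝ] coarseSpace Γ 𝒯) (A B : Plane → ℝ) (α β γ C : ℝ) : Prop where
  domain : IsPolygonalDomain Ω
  pos : 0 < α
  le : α ≤ β
  regular : 𝒯.IsRegular γ
  distribution : IsDistribution Γ 𝒯 P
  interpolation : IsInterpolation 𝒯 C I
  permeability : IsPermeability Γ A B α β

namespace MeshData

variable {P : Finset Plane → Set Plane} {I : energySpace Γ →ₗ[ℝ] coarseSpace Γ 𝒯} {C : ℝ}

/-- The interpolation constant with respect to the energy. -/
noncomputable def stab (α β γ C : ℝ) : ℝ := β / α * (2 + 16 * γ ^ 2 * C ^ 2)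

theorem exists_cutoff (h : MeshData Γ 𝒯 P I A B α β γ C) (F : Finset 𝒯.tri) (v : energySpace Γ)
    (hv : (I v : energySpace Γ) = 0) : ∃ w : energySpace Γ,
      (∀ t ∈ F, w ∈ vanishing Γ (hull t.1) (P t.1)) ∧
      (∀ t : 𝒯.tri, (∀ s ∈ F, ¬ 𝒯.Meets t s) → v - w ∈ vanishing Γ (hull t.1) (P t.1)) ∧
      ∀ t : 𝒯.tri, dirichlet (hull t.1) (P t.1) w ≤ (2 + 16 * γ ^ 2 * C ^ 2) *
        ∑ s ∈ graphBall 𝒯.Meets 2 t, dirichlet (hull s.1) (P s.1) v := by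
  have hH := 𝒯.meshSize_pos h.domain
  have hγ := h.regular.one_le h.domain
  set K : NNReal := (2 * γ / 𝒯.meshSize).toNNReal
  have hK : (K : ℝ) = 2 * γ / 𝒯.meshSize := Real.coe_toNNReal _ (by positivity)
  obtain ⟨η, hη, h0, h1⟩ := h.regular.exists_multiplier h.domain F hK.ge
  obtain ⟨T, hT⟩ := IsMultiplier.exists_isTangential Γ η
  obtain ⟨w, w1, w2, w3, w4⟩ := hη.exists_mul h.domain.isOpen
    ((isBounded_closure h.domain).subset subset_closure) hT v
  have hsub : ∀ t : 𝒯.tri, P t.1 ⊆ hull t.1 := fun t x hx =>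
    (h.distribution.subset t.1 t.2 hx).2
  refine ⟨w, fun t ht => ⟨?_, ?_⟩, fun t ht => ⟨?_, ?_⟩, fun t => ?_⟩
  · filter_upwards [w1, w2, 𝒯.ae_gradient_eq_zero (h0 t ht)] with x e1 e2 e3 hx
    rw [e1, e2, h0 t ht x hx, e3 hx]
    simp
  · filter_upwards [w3, w4, hT.ae_eq_zero (h.distribution.measurable t.1 t.2)
      fun x hx => h0 t ht x (hsub t hx)] with x e1 e2 e3 hx
    rw [e1, e2, h0 t ht x (hsub t hx), e3 hx]
    simp
  · filter_upwards [w1, w2, 𝒯.ae_gradient_eq_zero (h1 t ht), coeFn_val_sub v w,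
      coeFn_grad_sub v w] with x e1 e2 e3 e4 e5 hx
    rw [e4, e5, e1, e2, h1 t ht x hx, e3 hx]
    simp
  · filter_upwards [w3, w4, hT.ae_eq_zero (h.distribution.measurable t.1 t.2)
      fun x hx => h1 t ht x (hsub t hx), coeFn_trace_sub v w, coeFn_tgrad_sub v w] with
      x e1 e2 e3 e4 e5 hx
    rw [e4, e5, e1, e2, h1 t ht x (hsub t hx), e3 hx]
    simp
  · have hbulk : ∀ᵐ x ∂(bulk Ω), x ∈ Ω := ae_restrict_mem h.domain.isOpen.measurableSet
    have m1 := dirichlet_mul_le (S := hull t.1) (S' := P t.1)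
      (by filter_upwards [hbulk] with x hx using hη.bound x (subset_closure hx))
      (by filter_upwards [Γ.ae_mem_carrier] with x hx using hη.bound x (Γ.carrier_subset hx))
      (by filter_upwards [hbulk] with x hx using hη.norm_gradient_le h.domain.isOpen hx)
      (hT.ae_norm_le hη) w2 w4
    have m2 := h.interpolation.mass_sub_le h.distribution t v
    rw [hv, sub_zero] at m2
    have m3 : dirichlet (hull t.1) (P t.1) v ≤
        ∑ s ∈ graphBall 𝒯.Meets 2 t, dirichlet (hull s.1) (P s.1) v :=
      Finset.single_le_sum (f := fun s : 𝒯.tri => dirichlet (hull s.1) (P s.1) v)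
        (fun s _ => dirichlet_nonneg _ _ _)
        (self_mem_graphBall Triangulation.Meets.refl 2 t)
    set E := ∑ s ∈ graphBall 𝒯.Meets 2 t, dirichlet (hull s.1) (P s.1) v
    have m4 := mul_le_mul_of_nonneg_left m2 (by positivity : 0 ≤ 2 * (K : ℝ) ^ 2)
    have e : 2 * (K : ℝ) ^ 2 * (2 * (C * 𝒯.meshSize) ^ 2 * E) = 16 * γ ^ 2 * C ^ 2 * E := by
      rw [hK]
      field_simp
      ring
    rw [e] at m4
    linarith

theorem interpolation_local (h : MeshData Γ 𝒯 P I A B α β γ C) (v : energySpace Γ) (t : 𝒯.tri)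
    (hv : ∀ s ∈ graphBall 𝒯.Meets 2 t, v ∈ vanishing Γ (hull s.1) (P s.1)) :
    (I v : energySpace Γ) ∈ vanishing Γ (hull t.1) (P t.1) := by
  have hP := h.distribution
  have e0 : ∑ s ∈ graphBall 𝒯.Meets 2 t, dirichlet (hull s.1) (P s.1) v = 0 :=
    Finset.sum_eq_zero fun s hs => dirichlet_eq_zero (measurableSet_hull _)
      (hP.measurable s.1 s.2) (hv s hs)
  have e1 := h.interpolation.dirichlet_le hP t v
  have e2 := h.interpolation.mass_sub_le hP t v
  rw [e0, mul_zero] at e1 e2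
  exact mem_vanishing_of_le_zero (measurableSet_hull _) (hP.measurable t.1 t.2) e1 e2
    (hv t (self_mem_graphBall Triangulation.Meets.refl 2 t))

theorem isFine_patch (h : MeshData Γ 𝒯 P I A B α β γ C) (k : ℕ) (T : 𝒯.tri) (v : energySpace Γ)
    (hv : I v = 0) (hZ : ∀ s ∉ graphBall 𝒯.Meets k T, v ∈ vanishing Γ (hull s.1) (P s.1)) :
    IsFine I (𝒯.patch k T.1) v := by
  have hZ' := fun s : 𝒯.tri => (Classical.em (s ∈ graphBall 𝒯.Meets k T)).imp_right (hZ s)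
  have hmem : ∀ s ∈ graphBall 𝒯.Meets k T, hull s.1 ⊆ 𝒯.patch k T.1 := fun s hs x hx => by
    rw [Triangulation.patch_eq]
    exact mem_iUnion₂.2 ⟨s, hs, hx⟩
  refine ⟨hv, ?_, ?_⟩
  · have h1 : ∀ᵐ x ∂(bulk Ω), ∀ s : 𝒯.tri, x ∈ hull s.1 → x ∉ 𝒯.patch k T.1 → val v x = 0 := by
      refine ae_all_iff.2 fun s => ?_
      rcases hZ' s with hs | hs
      · exact ae_of_all _ fun x hx hx' => absurd (hmem s hs hx) hx'
      · filter_upwards [hs.1] with x hx hxs _ using (hx hxs).1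
    filter_upwards [h1, ae_restrict_mem h.domain.isOpen.measurableSet] with x hx hxΩ
    obtain ⟨s, hs⟩ := 𝒯.exists_mem_hull (subset_closure hxΩ)
    exact hx s hs
  · have h1 : ∀ᵐ x ∂Γ.length, ∀ s : 𝒯.tri, x ∈ P s.1 → x ∉ 𝒯.patch k T.1 → trace v x = 0 := by
      refine ae_all_iff.2 fun s => ?_
      rcases hZ' s with hs | hs
      · exact ae_of_all _ fun x hx hx' =>
          absurd (hmem s hs (h.distribution.subset s.1 s.2 hx).2) hx'
      · filter_upwards [hs.2] with x hx hxs _ using (hx hxs).1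
    filter_upwards [h1, h.distribution.ae_mem] with x hx hx'
    obtain ⟨s, hs⟩ := hx'
    exact hx s hs

theorem isClosed_patch (𝒯 : Triangulation Ω) (k : ℕ) (T : 𝒯.tri) :
    IsClosed (𝒯.patch k T.1) := by
  rw [Triangulation.patch_eq]
  exact Set.Finite.isClosed_biUnion (Finset.finite_toSet _) fun s _ =>
    (isCompact_hull s.1).isClosed

theorem formOn_eq_zero_of_isFine (h : MeshData Γ 𝒯 P I A B α β γ C) (k : ℕ) (T : 𝒯.tri)
    (v : energySpace Γ) (hv : IsFine I (𝒯.patch k T.1) v) (s : 𝒯.tri)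
    (hs : s ∉ graphBall 𝒯.Meets (k + 1) T) (w : energySpace Γ) :
    formOn A B (hull s.1) (P s.1) v w = 0 := by
  have hdisj : ∀ x ∈ hull s.1, x ∉ 𝒯.patch k T.1 := fun x hx hxp => by
    rw [Triangulation.patch_eq] at hxp
    obtain ⟨u, hu, hxu⟩ := mem_iUnion₂.1 hxp
    exact hs (mem_graphBall_succ.2 ⟨u, hu, x, hx, hxu⟩)
  have hcl := isClosed_patch 𝒯 k T
  refine formOn_eq_zero (measurableSet_hull _) (h.distribution.measurable s.1 s.2) ?_ ?_ w
  · filter_upwards [ae_grad_eq_zero h.domain.isOpen v hcl hv.2.1] with x hx hxs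
    exact hx (hdisj x hxs)
  · filter_upwards [ae_tgrad_eq_zero v hcl hv.2.2] with x hx hxs
    exact hx (hdisj x (h.distribution.subset s.1 s.2 hxs).2)

theorem stab_nonneg (hα : 0 < α) (hαβ : α ≤ β) : 0 ≤ stab α β γ C := by
  have := hα.trans_le hαβ
  unfold stab
  positivity

theorem form_le_stab_mul (h : MeshData Γ 𝒯 P I A B α β γ C) {t : 𝒯.tri} {v w : energySpace Γ}
    (hw : dirichlet (hull t.1) (P t.1) w ≤ (2 + 16 * γ ^ 2 * C ^ 2) *
      ∑ s ∈ graphBall 𝒯.Meets 2 t, dirichlet (hull s.1) (P s.1) v) :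
    formOn A B (hull t.1) (P t.1) w w ≤ stab α β γ C *
      ∑ s ∈ graphBall 𝒯.Meets 2 t, formOn A B (hull s.1) (P s.1) v v := by
  have hα := h.pos
  have hβ := hα.trans_le h.le
  have h1 : ∑ s ∈ graphBall 𝒯.Meets 2 t, dirichlet (hull s.1) (P s.1) v ≤
      α⁻¹ * ∑ s ∈ graphBall 𝒯.Meets 2 t, formOn A B (hull s.1) (P s.1) v v := by
    rw [Finset.mul_sum]
    refine Finset.sum_le_sum fun s _ => ?_
    rw [inv_mul_eq_div, le_div_iff₀ hα, mul_comm]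
    exact h.permeability.le_form _ _ v
  have h2 := (h.permeability.form_le (hull t.1) (P t.1) w).trans
    (mul_le_mul_of_nonneg_left (hw.trans (mul_le_mul_of_nonneg_left h1 (by positivity))) hβ.le)
  refine h2.trans_eq ?_
  rw [stab]
  ring

/-- The local setting of the localized orthogonal decomposition. -/
noncomputable def localSetting (h : MeshData Γ 𝒯 P I A B α β γ C) :
    LocalSetting (energySpace Γ) 𝒯.tri where
  r := 𝒯.Meets
  refl := Triangulation.Meets.refl
  symm := Triangulation.Meets.symm
  a := fun t => formMap h.permeability (hull t.1) (P t.1)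
  a_symm := fun t v w => formOn_comm _ _ _ _ v w
  a_nonneg := fun t v => (mul_nonneg h.pos.le (dirichlet_nonneg _ _ v)).trans
    (h.permeability.le_form _ _ v)
  Z := fun t => vanishing Γ (hull t.1) (P t.1)
  a_eq_zero := fun t v hv w => formOn_eq_zero (measurableSet_hull _)
    (h.distribution.measurable t.1 t.2) (hv.1.mono fun _ hx hxt => (hx hxt).2)
    (hv.2.mono fun _ hx hxt => (hx hxt).2) w
  I := (coarseSpace Γ 𝒯).subtype ∘ₗ I
  I_idem := fun v => congrArg Subtype.val (h.interpolation.idempotent v)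
  K := stab α β γ C
  K_nonneg := stab_nonneg h.pos h.le
  I_bound := fun v t => h.form_le_stab_mul <| by
    refine (h.interpolation.dirichlet_le h.distribution t v).trans
      (mul_le_mul_of_nonneg_right ?_ (Finset.sum_nonneg fun s _ => dirichlet_nonneg _ _ v))
    nlinarith [h.regular.one_le h.domain, sq_nonneg C,
      mul_le_mul_of_nonneg_right (one_le_pow₀ (h.regular.one_le h.domain) : 1 ≤ γ ^ 2)
        (sq_nonneg C)]
  I_local := h.interpolation_local
  cutoff := fun F v hv => by
    obtain ⟨w, h1, h2, h3⟩ := h.exists_cutoff F v hv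
    exact ⟨w, h1, h2, fun t => h.form_le_stab_mul (h3 t)⟩
  S := fun k T => fineSpace I (𝒯.patch k T.1)
  S_ker := fun k T v hv => congrArg Subtype.val hv.1
  mem_S := fun k T v hv hZ => h.isFine_patch k T v (Subtype.ext hv) hZ
  S_far := fun k T v hv s hs w => h.formOn_eq_zero_of_isFine k T v hv s hs w
  M := 16 * γ ^ 2
  card_le := h.regular.card_graphBall_le h.domain

end MeshData

end LOD

/-! ### Completeness of the energy space and its subspaces -/

namespace LOD

variable {Ω : Set Plane} {Γ : Interfaces Ω} {𝒯 : Triangulation Ω} {γ α β c : ℝ}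
  {A B : Plane → ℝ}

theorem norm_eq_max (v : energySpace Γ) :
    ‖v‖ = max ‖val v‖ (max ‖grad v‖ (max ‖trace v‖ ‖tgrad v‖)) := rfl

theorem norm_grad_le_norm (v : energySpace Γ) : ‖grad v‖ ≤ ‖v‖ := by
  rw [norm_eq_max]
  exact (le_max_left _ _).trans (le_max_right _ _)

theorem norm_tgrad_le_norm (v : energySpace Γ) : ‖tgrad v‖ ≤ ‖v‖ := by
  rw [norm_eq_max]
  exact ((le_max_right _ _).trans (le_max_right _ _)).trans (le_max_right _ _)

theorem dirichlet_le_norm (v : energySpace Γ) : dirichlet univ univ v ≤ 2 * ‖v‖ ^ 2 := by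
  rw [dirichlet_univ]
  have h1 := pow_le_pow_left₀ (norm_nonneg _) (norm_grad_le_norm v) 2
  have h2 := pow_le_pow_left₀ (norm_nonneg _) (norm_tgrad_le_norm v) 2
  linarith

theorem norm_grad_le_sqrt (v : energySpace Γ) : ‖grad v‖ ≤ √(dirichlet univ univ v) := by
  rw [dirichlet_univ]
  exact Real.le_sqrt_of_sq_le (by nlinarith [sq_nonneg ‖tgrad v‖])

theorem norm_tgrad_le_sqrt (v : energySpace Γ) : ‖tgrad v‖ ≤ √(dirichlet univ univ v) := by
  rw [dirichlet_univ]
  exact Real.le_sqrt_of_sq_le (by nlinarith [sq_nonneg ‖grad v‖])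

theorem norm_le_sqrt_dirichlet (hc0 : 0 < c)
    (hc : ∀ v : energySpace Γ, ‖val v‖ ≤ c * ‖grad v‖ ∧ ‖trace v‖ ≤ c * ‖grad v‖)
    (v : energySpace Γ) : ‖v‖ ≤ (1 + c) * √(dirichlet univ univ v) := by
  have h0 := Real.sqrt_nonneg (dirichlet univ univ v)
  have h1 := norm_grad_le_sqrt v
  have h2 := norm_tgrad_le_sqrt v
  have h3 := mul_le_mul_of_nonneg_left h1 hc0.le
  have h4 := mul_nonneg hc0.le h0
  obtain ⟨h5, h6⟩ := hc v
  rw [norm_eq_max, add_mul, one_mul]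
  refine max_le (by linarith) (max_le (by linarith) (max_le (by linarith) (by linarith)))

theorem eq_zero_of_dirichlet_le_zero (hc0 : 0 < c)
    (hc : ∀ v : energySpace Γ, ‖val v‖ ≤ c * ‖grad v‖ ∧ ‖trace v‖ ≤ c * ‖grad v‖)
    {v : energySpace Γ} (h : dirichlet univ univ v ≤ 0) : v = 0 := by
  have := norm_le_sqrt_dirichlet hc0 hc v
  rw [le_antisymm h (dirichlet_nonneg _ _ _), Real.sqrt_zero, mul_zero] at this
  exact norm_le_zero_iff.1 this

theorem energyComplete_of_isClosed (hc0 : 0 < c)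
    (hc : ∀ v : energySpace Γ, ‖val v‖ ≤ c * ‖grad v‖ ∧ ‖trace v‖ ≤ c * ‖grad v‖)
    (hα : 0 < α) {F : energySpace Γ →ₗ[ℝ] energySpace Γ →ₗ[ℝ] ℝ}
    (h1 : ∀ v, α * dirichlet univ univ v ≤ F v v) (h2 : ∀ v, F v v ≤ β * dirichlet univ univ v)
    {W : Submodule ℝ (energySpace Γ)} (hW : IsClosed (W : Set (energySpace Γ))) :
    EnergyComplete F W := by
  intro u hu hcau
  have : CompleteSpace (energySpace Γ) := (isClosed_energySpace Γ).completeSpace_coe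
  have hcs : CauchySeq u := by
    refine Metric.cauchySeq_iff.2 fun ε hε => ?_
    obtain ⟨N, hN⟩ := hcau (α * (ε / (1 + c)) ^ 2) (by positivity)
    refine ⟨N, fun m hm n hn => ?_⟩
    have h3 := (h1 _).trans_lt (hN m hm n hn)
    have h4 := lt_of_mul_lt_mul_left h3 hα.le
    have h5 : √(dirichlet univ univ (u m - u n)) < ε / (1 + c) :=
      (Real.sqrt_lt' (by positivity)).2 h4
    rw [dist_eq_norm]
    refine (norm_le_sqrt_dirichlet hc0 hc _).trans_lt ?_
    rwa [lt_div_iff₀ (by positivity), mul_comm] at h5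
  obtain ⟨x, hx⟩ := cauchySeq_tendsto_of_complete hcs
  refine ⟨x, hW.mem_of_tendsto hx (Eventually.of_forall hu), ?_⟩
  have h3 : Tendsto (fun n => |β| * (2 * ‖u n - x‖ ^ 2)) atTop (𝓝 (|β| * (2 * 0 ^ 2))) :=
    (((tendsto_iff_norm_sub_tendsto_zero.1 hx).pow 2).const_mul 2).const_mul |β|
  simp only [ne_eq, OfNat.ofNat_ne_zero, not_false_eq_true, zero_pow, mul_zero] at h3
  refine squeeze_zero (fun n => (mul_nonneg hα.le (dirichlet_nonneg _ _ _)).trans (h1 _))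
    (fun n => (h2 _).trans ?_) h3
  exact mul_le_mul (le_abs_self β) (dirichlet_le_norm _) (dirichlet_nonneg _ _ _) (abs_nonneg _)

theorem isClosed_ae_eq_zero {E : Type*} [NormedAddCommGroup E] (μ : Measure Plane) (S : Set Plane) :
    IsClosed {f : Lp E 2 μ | ∀ᵐ x ∂μ, x ∉ S → f x = 0} := by
  refine IsSeqClosed.isClosed fun f g hf hg => ?_
  obtain ⟨ns, -, hns⟩ := exists_seq_tendsto_ae_of_tendsto_Lp hg
  have hf' : ∀ᵐ x ∂μ, ∀ n, x ∉ S → f n x = 0 := ae_all_iff.2 hf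
  change ∀ᵐ x ∂μ, x ∉ S → g x = 0
  filter_upwards [hns, hf'] with x h1 h2 hx
  refine tendsto_nhds_unique h1 ?_
  simp only [h2 _ hx]
  exact tendsto_const_nhds

theorem continuous_val : Continuous (val : energySpace Γ → Lp ℝ 2 (bulk Ω)) :=
  continuous_fst.comp continuous_subtype_val

theorem continuous_trace : Continuous (trace : energySpace Γ → Lp ℝ 2 Γ.length) :=
  continuous_fst.comp (continuous_snd.comp (continuous_snd.comp continuous_subtype_val))

theorem isClosed_supportedIn (S : Set Plane) :
    IsClosed (supportedIn Γ S : Set (energySpace Γ)) :=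
  ((isClosed_ae_eq_zero (bulk Ω) S).preimage continuous_val).inter
    ((isClosed_ae_eq_zero Γ.length S).preimage continuous_trace)

/-! ### The coarse space is finite-dimensional -/

theorem eq_zero_of_val_ae_eq_zero (hΩ : IsOpen Ω) (hc0 : 0 < c)
    (hc : ∀ v : energySpace Γ, ‖val v‖ ≤ c * ‖grad v‖ ∧ ‖trace v‖ ≤ c * ‖grad v‖)
    {v : energySpace Γ} (hv : ∀ᵐ x ∂(bulk Ω), val v x = 0) : v = 0 := by
  have h1 : ∀ᵐ x ∂(bulk Ω), grad v x = 0 := by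
    filter_upwards [ae_grad_eq_zero hΩ v isClosed_empty (hv.mono fun x hx _ => hx)] with x hx
    exact hx (notMem_empty x)
  have h2 : grad v = 0 := (Lp.eq_zero_iff_ae_eq_zero).2 h1
  have h3 : trace v = 0 := by
    have := (hc v).2
    rw [h2, norm_zero, mul_zero] at this
    exact norm_le_zero_iff.1 this
  have h4 : ∀ᵐ x ∂Γ.length, tgrad v x = 0 := by
    have h5 : ∀ᵐ x ∂Γ.length, x ∉ (∅ : Set Plane) → trace v x = 0 := by
      rw [h3]
      filter_upwards [Lp.coeFn_zero ℝ 2 Γ.length] with x hx _ using hx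
    filter_upwards [ae_tgrad_eq_zero v isClosed_empty h5] with x hx
    exact hx (notMem_empty x)
  have h5 : tgrad v = 0 := (Lp.eq_zero_iff_ae_eq_zero).2 h4
  refine eq_zero_of_dirichlet_le_zero hc0 hc ?_
  rw [dirichlet_univ, h2, h5]
  simp

/-- The pairs of a family of affine functions, one for each element, and a function in the energy
space that they describe. -/
def affinePairs (Γ : Interfaces Ω) (𝒯 : Triangulation Ω) :
    Submodule ℝ ((𝒯.tri → Plane × ℝ) × energySpace Γ) where
  carrier := {p | ∀ t : 𝒯.tri, ∀ᵐ x ∂(bulk Ω), x ∈ hull t.1 →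
    val p.2 x = inner ℝ (p.1 t).1 x + (p.1 t).2}
  add_mem' := by
    intro p q hp hq t
    filter_upwards [hp t, hq t, coeFn_val_add p.2 q.2] with x h1 h2 h3 hx
    rw [Prod.snd_add, h3, h1 hx, h2 hx, Prod.fst_add, Pi.add_apply, Prod.fst_add, Prod.snd_add,
      inner_add_left]
    ring
  zero_mem' := by
    intro t
    filter_upwards [coeFn_val_zero (Γ := Γ)] with x hx _
    change val (0 : energySpace Γ) x = inner ℝ (0 : Plane) x + 0
    rw [hx, inner_zero_left, add_zero]
  smul_mem' := by
    intro r p hp t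
    filter_upwards [hp t, coeFn_val_smul r p.2] with x h1 h3 hx
    rw [Prod.smul_snd, h3, h1 hx, Prod.smul_fst, Pi.smul_apply, Prod.smul_fst, Prod.smul_snd,
      real_inner_smul_left, smul_eq_mul]
    ring

theorem finiteDimensional_coarseSpace (hΩ : IsPolygonalDomain Ω) (Γ : Interfaces Ω)
    (𝒯 : Triangulation Ω) : FiniteDimensional ℝ (coarseSpace Γ 𝒯) := by
  obtain ⟨c, hc0, hc⟩ := exists_poincare (isBounded_closure hΩ) Γ
  have hinj : Function.Injective
      ((LinearMap.fst ℝ (𝒯.tri → Plane × ℝ) (energySpace Γ)).domRestrict (affinePairs Γ 𝒯)) := by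
    refine (injective_iff_map_eq_zero _).2 ?_
    rintro ⟨⟨q, v⟩, hp⟩ hq
    have hq' : q = 0 := hq
    subst hq'
    have hv : ∀ᵐ x ∂(bulk Ω), ∀ t : 𝒯.tri, x ∈ hull t.1 → val v x = 0 := by
      refine ae_all_iff.2 fun t => ?_
      filter_upwards [hp t] with x hx hxt
      simpa using hx hxt
    have : v = 0 := by
      refine eq_zero_of_val_ae_eq_zero hΩ.isOpen hc0 hc ?_
      filter_upwards [hv, ae_restrict_mem hΩ.isOpen.measurableSet] with x hx hxΩ
      obtain ⟨t, ht⟩ := 𝒯.exists_mem_hull (subset_closure hxΩ)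
      exact hx t ht
    subst this
    rfl
  have : FiniteDimensional ℝ (affinePairs Γ 𝒯) := FiniteDimensional.of_injective _ hinj
  have hle : coarseSpace Γ 𝒯 ≤ (affinePairs Γ 𝒯).map (LinearMap.snd ℝ _ _) := by
    rintro v ⟨p, ⟨-, -, hp⟩, hv⟩
    choose b d hbd using fun t : 𝒯.tri => hp t.1 t.2
    refine ⟨(fun t => (b t, d t), v), fun t => ?_, rfl⟩
    filter_upwards [hv] with x hx hxt
    rw [hx, hbd t x hxt]
  exact Submodule.finiteDimensional_of_le hle

end LOD

/-! ### Existence and uniqueness -/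

namespace LOD

variable {Ω : Set Plane} {Γ : Interfaces Ω} {𝒯 : Triangulation Ω} {γ α β c : ℝ}
  {A B : Plane → ℝ}

theorem existsUnique_riesz {V : Type*} [AddCommGroup V] [Module ℝ V] (F : V →ₗ[ℝ] V →ₗ[ℝ] ℝ)
    (W : Submodule ℝ V) (symm : ∀ v w, F v w = F w v) (nonneg : ∀ v, 0 ≤ F v v)
    (definite : ∀ v, F v v = 0 → v = 0) (complete : EnergyComplete F W)
    (L : V →ₗ[ℝ] ℝ) (b : ℝ) (hL : ∀ w ∈ W, |L w| ≤ b * √(F w w)) :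
    ∃! u, u ∈ W ∧ ∀ w ∈ W, F u w = L w := by
  obtain ⟨u, hu, hu'⟩ := exists_riesz F W symm nonneg (fun v _ => definite v) complete L b hL
  refine ⟨u, ⟨hu, hu'⟩, fun u₂ h₂ => sub_eq_zero.1 (definite _ ?_)⟩
  have hd := W.sub_mem h₂.1 hu
  have e : F (u₂ - u) = F u₂ - F u := map_sub F u₂ u
  rw [e, LinearMap.sub_apply, h₂.2 _ hd, hu' _ hd, sub_self]

theorem exists_linearMap_of_existsUnique {V : Type*} [AddCommGroup V] [Module ℝ V]
    (F a : V →ₗ[ℝ] V →ₗ[ℝ] ℝ) (W : Submodule ℝ V)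
    (hF : ∀ v, ∃! u, u ∈ W ∧ ∀ w ∈ W, F u w = a v w) :
    ∃ Q : V →ₗ[ℝ] V, ∀ v, Q v ∈ W ∧ ∀ w ∈ W, F (Q v) w = a v w := by
  choose q hq hq' using hF
  refine ⟨{ toFun := q, map_add' := fun v w => ?_, map_smul' := fun r v => ?_ }, hq⟩
  · refine (hq' (v + w) (q v + q w) ⟨W.add_mem (hq v).1 (hq w).1, fun z hz => ?_⟩).symm
    rw [map_add, map_add, LinearMap.add_apply, LinearMap.add_apply, (hq v).2 z hz, (hq w).2 z hz]
  · refine (hq' (r • v) (r • q v) ⟨W.smul_mem r (hq v).1, fun z hz => ?_⟩).symm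
    rw [map_smul, map_smul, LinearMap.smul_apply, LinearMap.smul_apply, (hq v).2 z hz]

theorem sqrt_form_add_le {V : Type*} [AddCommGroup V] [Module ℝ V] (F : V →ₗ[ℝ] V →ₗ[ℝ] ℝ)
    (symm : ∀ v w, F v w = F w v) (nonneg : ∀ v, 0 ≤ F v v) (v w : V) :
    √(F (v + w) (v + w)) ≤ √(F v v) + √(F w w) := by
  have h1 := (le_abs_self _).trans (abs_form_le F symm nonneg v w)
  refine Real.sqrt_le_iff.2 ⟨by positivity, ?_⟩
  have h2 := Real.sq_sqrt (nonneg v)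
  have h3 := Real.sq_sqrt (nonneg w)
  simp only [map_add, LinearMap.add_apply, symm w v]
  nlinarith

theorem LocalSetting.total_I_le {V ι : Type*} [AddCommGroup V] [Module ℝ V] [Fintype ι]
    (D : LocalSetting V ι) (v : V) :
    D.total (D.I v) (D.I v) ≤ D.K * (D.M * 4 ^ 2) * D.total v v := by
  classical
  rw [D.total_apply, D.total_apply, mul_assoc]
  refine (Finset.sum_le_sum fun t _ => D.I_bound v t).trans ?_
  rw [← Finset.mul_sum]
  refine mul_le_mul_of_nonneg_left ?_ D.K_nonneg
  exact sum_graphBall_le D.symm 2 _ (fun t => (D.card_le 2 t).trans_eq (by norm_num)) _ _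
    (fun _ _ _ _ => Finset.mem_univ _) (fun t => D.a t v v) fun t => D.a_nonneg t v

theorem load_eq_inner (f : Lp ℝ 2 (bulk Ω)) (fΓ : Lp ℝ 2 Γ.length) (v : energySpace Γ) :
    load f fΓ v = inner ℝ f (val v) + inner ℝ fΓ (trace v) := by
  rw [load, L2.inner_def, L2.inner_def]
  congr 1 <;> exact integral_congr_ae (ae_of_all _ fun x => by simp [mul_comm])

/-- The right-hand side as a linear functional. -/
noncomputable def loadMap (f : Lp ℝ 2 (bulk Ω)) (fΓ : Lp ℝ 2 Γ.length) :
    energySpace Γ →ₗ[ℝ] ℝ where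
  toFun := load f fΓ
  map_add' v w := by
    rw [load_eq_inner, load_eq_inner, load_eq_inner]
    change inner ℝ f (val v + val w) + inner ℝ fΓ (trace v + trace w) = _
    rw [inner_add_right, inner_add_right]
    ring
  map_smul' r v := by
    rw [load_eq_inner, load_eq_inner]
    change inner ℝ f (r • val v) + inner ℝ fΓ (r • trace v) = _
    rw [real_inner_smul_right, real_inner_smul_right, RingHom.id_apply, smul_eq_mul]
    ring

theorem abs_load_le (f : Lp ℝ 2 (bulk Ω)) (fΓ : Lp ℝ 2 Γ.length) {v : energySpace Γ} {m : ℝ}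
    (h1 : ‖val v‖ ≤ m) (h2 : ‖trace v‖ ≤ m) : |load f fΓ v| ≤ (‖f‖ + ‖fΓ‖) * m := by
  rw [load_eq_inner, add_mul]
  refine (abs_add_le _ _).trans (add_le_add ?_ ?_)
  · exact (abs_real_inner_le_norm _ _).trans (mul_le_mul_of_nonneg_left h1 (norm_nonneg _))
  · exact (abs_real_inner_le_norm _ _).trans (mul_le_mul_of_nonneg_left h2 (norm_nonneg _))

namespace MeshData

variable {P : Finset Plane → Set Plane} {I : energySpace Γ →ₗ[ℝ] coarseSpace Γ 𝒯} {C : ℝ}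

/-- The bilinear form of the problem. -/
noncomputable def energy (h : MeshData Γ 𝒯 P I A B α β γ C) :
    energySpace Γ →ₗ[ℝ] energySpace Γ →ₗ[ℝ] ℝ := formMap h.permeability univ univ

theorem energy_apply (h : MeshData Γ 𝒯 P I A B α β γ C) (v w : energySpace Γ) :
    h.energy v w = form A B v w := rfl

theorem energy_symm (h : MeshData Γ 𝒯 P I A B α β γ C) (v w : energySpace Γ) :
    h.energy v w = h.energy w v := formOn_comm _ _ _ _ v w

theorem le_energy (h : MeshData Γ 𝒯 P I A B α β γ C) (v : energySpace Γ) :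
    α * dirichlet univ univ v ≤ h.energy v v := h.permeability.le_form _ _ v

theorem energy_le (h : MeshData Γ 𝒯 P I A B α β γ C) (v : energySpace Γ) :
    h.energy v v ≤ β * dirichlet univ univ v := h.permeability.form_le _ _ v

theorem energy_nonneg (h : MeshData Γ 𝒯 P I A B α β γ C) (v : energySpace Γ) :
    0 ≤ h.energy v v := (mul_nonneg h.pos.le (dirichlet_nonneg _ _ v)).trans (h.le_energy v)

theorem total_eq_energy (h : MeshData Γ 𝒯 P I A B α β γ C) : h.localSetting.total = h.energy := by
  refine LinearMap.ext₂ fun v w => ?_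
  rw [LocalSetting.total_apply]
  exact sum_formOn h.permeability h.domain.isOpen h.distribution v w

theorem energy_interpolation_le (h : MeshData Γ 𝒯 P I A B α β γ C) (v : energySpace Γ) :
    h.energy (I v : energySpace Γ) (I v : energySpace Γ) ≤
      stab α β γ C * (16 * γ ^ 2 * 4 ^ 2) * h.energy v v := by
  have := h.localSetting.total_I_le v
  rwa [h.total_eq_energy] at this

theorem energy_definite (h : MeshData Γ 𝒯 P I A B α β γ C) (v : energySpace Γ)
    (hv : h.energy v v = 0) : v = 0 := by
  obtain ⟨c, hc0, hc⟩ := exists_poincare (isBounded_closure h.domain) Γ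
  refine eq_zero_of_dirichlet_le_zero hc0 hc ?_
  have := h.le_energy v
  rw [hv] at this
  exact nonpos_of_mul_nonpos_right this h.pos

theorem energyComplete (h : MeshData Γ 𝒯 P I A B α β γ C) {W : Submodule ℝ (energySpace Γ)}
    (hW : IsClosed (W : Set (energySpace Γ))) : EnergyComplete h.energy W := by
  obtain ⟨c, hc0, hc⟩ := exists_poincare (isBounded_closure h.domain) Γ
  exact energyComplete_of_isClosed hc0 hc h.pos h.le_energy h.energy_le hW

theorem existsUnique (h : MeshData Γ 𝒯 P I A B α β γ C) {W : Submodule ℝ (energySpace Γ)}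
    (hW : IsClosed (W : Set (energySpace Γ))) (L : energySpace Γ →ₗ[ℝ] ℝ) (b : ℝ)
    (hL : ∀ w, |L w| ≤ b * √(h.energy w w)) :
    ∃! u, u ∈ W ∧ ∀ w ∈ W, h.energy u w = L w :=
  existsUnique_riesz h.energy W h.energy_symm h.energy_nonneg h.energy_definite
    (h.energyComplete hW) L b fun w _ => hL w

theorem isClosed_ker (h : MeshData Γ 𝒯 P I A B α β γ C) :
    IsClosed (LinearMap.ker I : Set (energySpace Γ)) := by
  obtain ⟨c, hc0, hc⟩ := exists_poincare (isBounded_closure h.domain) Γ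
  set N := stab α β γ C * (16 * γ ^ 2 * 4 ^ 2)
  have hN : 0 ≤ N := mul_nonneg (stab_nonneg h.pos h.le) (by positivity)
  have hα := h.pos
  have hβ := hα.trans_le h.le
  have hcont : Continuous fun v => (I v : energySpace Γ) := by
    refine AddMonoidHomClass.continuous_of_bound ((coarseSpace Γ 𝒯).subtype ∘ₗ I)
      ((1 + c) * √(α⁻¹ * (N * (β * 2)))) fun v => ?_
    refine (norm_le_sqrt_dirichlet hc0 hc _).trans ?_
    rw [mul_assoc]
    refine mul_le_mul_of_nonneg_left ?_ (by positivity)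
    refine Real.sqrt_le_iff.2 ⟨by positivity, ?_⟩
    rw [mul_pow, Real.sq_sqrt (by positivity)]
    have h1 := (h.le_energy (I v : energySpace Γ)).trans (h.energy_interpolation_le v)
    have h2 := (h.energy_le v).trans (mul_le_mul_of_nonneg_left (dirichlet_le_norm v) hβ.le)
    have h3 := h1.trans (mul_le_mul_of_nonneg_left h2 hN)
    change dirichlet univ univ (I v : energySpace Γ) ≤ _
    have h4 : dirichlet univ univ (I v : energySpace Γ) ≤
        α⁻¹ * (N * (β * (2 * ‖v‖ ^ 2))) := by
      rw [inv_mul_eq_div, le_div_iff₀ h.pos, mul_comm]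
      exact h3
    refine h4.trans_eq ?_
    ring
  have e : (LinearMap.ker I : Set (energySpace Γ)) = (fun v => (I v : energySpace Γ)) ⁻¹' {0} := by
    ext v
    change I v = 0 ↔ (I v : energySpace Γ) = 0
    exact (ZeroMemClass.coe_eq_zero).symm
  rw [e]
  exact isClosed_singleton.preimage hcont

theorem isClosed_fineSpace (h : MeshData Γ 𝒯 P I A B α β γ C) (S : Set Plane) :
    IsClosed (fineSpace I S : Set (energySpace Γ)) :=
  h.isClosed_ker.inter (isClosed_supportedIn S)

theorem formOn_patch (h : MeshData Γ 𝒯 P I A B α β γ C) {k : ℕ} {T : 𝒯.tri}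
    {φ : energySpace Γ} (hφ : IsFine I (𝒯.patch k T.1) φ) (w : energySpace Γ) :
    formOn A B (𝒯.patch k T.1) (𝒯.patch k T.1) φ w = h.energy φ w := by
  have hcl := isClosed_patch 𝒯 k T
  rw [energy_apply, form, formOn, formOn, setIntegral_univ, setIntegral_univ]
  congr 1
  · refine setIntegral_eq_integral_of_ae_compl_eq_zero ?_
    filter_upwards [ae_grad_eq_zero h.domain.isOpen φ hcl hφ.2.1] with x hx hxs
    simp [hx hxs]
  · refine setIntegral_eq_integral_of_ae_compl_eq_zero ?_
    filter_upwards [ae_tgrad_eq_zero φ hcl hφ.2.2] with x hx hxs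
    simp [hx hxs]

theorem isCorrector_iff (h : MeshData Γ 𝒯 P I A B α β γ C) {k : ℕ} {T : 𝒯.tri}
    {v φ : energySpace Γ} : IsCorrector A B P I k v T.1 φ ↔
      φ ∈ fineSpace I (𝒯.patch k T.1) ∧ ∀ w ∈ fineSpace I (𝒯.patch k T.1),
        h.energy φ w = formMap h.permeability (hull T.1) (P T.1) v w := by
  refine and_congr_right fun hφ => forall₂_congr fun w hw => ?_
  rw [h.formOn_patch hφ]
  rfl

theorem abs_formMap_le (h : MeshData Γ 𝒯 P I A B α β γ C) (T : 𝒯.tri) (v w : energySpace Γ) :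
    |formMap h.permeability (hull T.1) (P T.1) v w| ≤
      √(formMap h.permeability (hull T.1) (P T.1) v v) * √(h.energy w w) := by
  have nonneg := h.localSetting.a_nonneg
  refine (abs_form_le _ (fun v w => formOn_comm _ _ _ _ v w) (nonneg T) v w).trans ?_
  refine mul_le_mul_of_nonneg_left (Real.sqrt_le_sqrt ?_) (Real.sqrt_nonneg _)
  rw [← h.total_eq_energy, LocalSetting.total_apply]
  exact Finset.single_le_sum (f := fun t => h.localSetting.a t w w) (fun t _ => nonneg t w)
    (Finset.mem_univ T)

theorem existsUnique_isCorrector (h : MeshData Γ 𝒯 P I A B α β γ C) (k : ℕ) (v : energySpace Γ)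
    (T : 𝒯.tri) : ∃! φ, IsCorrector A B P I k v T.1 φ := by
  have := h.existsUnique (h.isClosed_fineSpace (𝒯.patch k T.1))
    (formMap h.permeability (hull T.1) (P T.1) v) _ (h.abs_formMap_le T v)
  simpa only [h.isCorrector_iff] using this

/-- The corrector on the whole kernel of the interpolation. -/
theorem exists_idealCorrector (h : MeshData Γ 𝒯 P I A B α β γ C) (v : energySpace Γ)
    (T : 𝒯.tri) : ∃ φ, I φ = 0 ∧ ∀ w, I w = 0 →
      h.energy φ w = formMap h.permeability (hull T.1) (P T.1) v w := by
  obtain ⟨φ, hφ, -⟩ := h.existsUnique h.isClosed_ker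
    (formMap h.permeability (hull T.1) (P T.1) v) _ (h.abs_formMap_le T v)
  exact ⟨φ, hφ.1, hφ.2⟩

theorem abs_load_le_energy (h : MeshData Γ 𝒯 P I A B α β γ C) (hc0 : 0 < c)
    (hc : ∀ v : energySpace Γ, ‖val v‖ ≤ c * ‖grad v‖ ∧ ‖trace v‖ ≤ c * ‖grad v‖)
    (f : Lp ℝ 2 (bulk Ω)) (fΓ : Lp ℝ 2 Γ.length) (v : energySpace Γ) :
    |load f fΓ v| ≤ (‖f‖ + ‖fΓ‖) * (c * √α⁻¹) * √(h.energy v v) := by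
  have h1 : ‖grad v‖ ≤ √α⁻¹ * √(h.energy v v) := by
    refine (norm_grad_le_sqrt v).trans ?_
    rw [← Real.sqrt_mul (inv_nonneg.2 h.pos.le)]
    refine Real.sqrt_le_sqrt ?_
    rw [inv_mul_eq_div, le_div_iff₀ h.pos, mul_comm]
    exact h.le_energy v
  have h2 := mul_le_mul_of_nonneg_left h1 hc0.le
  refine (abs_load_le f fΓ ((hc v).1.trans h2) ((hc v).2.trans h2)).trans_eq ?_
  ring

theorem existsUnique_isWeakSolution (h : MeshData Γ 𝒯 P I A B α β γ C)
    (f : Lp ℝ 2 (bulk Ω)) (fΓ : Lp ℝ 2 Γ.length) : ∃! u, IsWeakSolution A B f fΓ u := by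
  obtain ⟨c, hc0, hc⟩ := exists_poincare (isBounded_closure h.domain) Γ
  obtain ⟨u, hu, hu'⟩ := h.existsUnique (W := ⊤) isClosed_univ (loadMap f fΓ) _
    (h.abs_load_le_energy hc0 hc f fΓ)
  exact ⟨u, fun w => hu.2 w trivial, fun u₂ h₂ => hu' u₂ ⟨trivial, fun w _ => h₂ w⟩⟩

/-- The localized corrector, as a linear operator. -/
theorem exists_correctorMap (h : MeshData Γ 𝒯 P I A B α β γ C) (k : ℕ) (T : 𝒯.tri) :
    ∃ Q : energySpace Γ →ₗ[ℝ] energySpace Γ, ∀ v, IsCorrector A B P I k v T.1 (Q v) := by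
  obtain ⟨Q, hQ⟩ := exists_linearMap_of_existsUnique h.energy
    (formMap h.permeability (hull T.1) (P T.1)) (fineSpace I (𝒯.patch k T.1))
    fun v => h.existsUnique (h.isClosed_fineSpace (𝒯.patch k T.1)) _ _ (h.abs_formMap_le T v)
  exact ⟨Q, fun v => h.isCorrector_iff.2 (hQ v)⟩

theorem exists_multiscale_eq (h : MeshData Γ 𝒯 P I A B α β γ C) (k : ℕ) :
    ∃ W : Submodule ℝ (energySpace Γ), IsClosed (W : Set (energySpace Γ)) ∧
      multiscaleSpace A B P I k = W := by
  choose Q hQ using h.exists_correctorMap k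
  have := finiteDimensional_coarseSpace h.domain Γ 𝒯
  let R : energySpace Γ →ₗ[ℝ] energySpace Γ := ∑ T, Q T - LinearMap.id
  have hR : ∀ v, R v = ∑ T, Q T v - v := fun v => by
    simp only [R, LinearMap.sub_apply, LinearMap.sum_apply, LinearMap.id_apply]
  refine ⟨(coarseSpace Γ 𝒯).map R, Submodule.closed_of_finiteDimensional _, ?_⟩
  ext z
  constructor
  · rintro ⟨v, hv, φ, hφ, rfl⟩
    refine ⟨v, hv, ?_⟩
    rw [hR]
    congr 1
    rw [← Finset.sum_coe_sort 𝒯.tri φ]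
    exact Finset.sum_congr rfl fun T _ =>
      (h.existsUnique_isCorrector k v T).unique (hQ T v) (hφ T.1 T.2)
  · rintro ⟨v, hv, rfl⟩
    classical
    refine ⟨v, hv, fun T => if hT : T ∈ 𝒯.tri then Q ⟨T, hT⟩ v else 0, fun T hT => ?_, ?_⟩
    · beta_reduce
      rw [dif_pos hT]
      exact hQ ⟨T, hT⟩ v
    · rw [hR]
      congr 1
      rw [← Finset.sum_coe_sort 𝒯.tri]
      exact Finset.sum_congr rfl fun T _ => by rw [dif_pos T.2]

theorem existsUnique_isMultiscaleSolution (h : MeshData Γ 𝒯 P I A B α β γ C) (k : ℕ)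
    (f : Lp ℝ 2 (bulk Ω)) (fΓ : Lp ℝ 2 Γ.length) :
    ∃! u, IsMultiscaleSolution A B P I k f fΓ u := by
  obtain ⟨c, hc0, hc⟩ := exists_poincare (isBounded_closure h.domain) Γ
  obtain ⟨W, hW, e⟩ := h.exists_multiscale_eq k
  have := h.existsUnique hW (loadMap f fΓ) _ (h.abs_load_le_energy hc0 hc f fΓ)
  simp only [IsMultiscaleSolution, e]
  exact this

end MeshData

end LOD

/-! ### The error estimate -/

namespace LOD

variable {Ω : Set Plane} {Γ : Interfaces Ω} {𝒯 : Triangulation Ω} {γ α β c : ℝ}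
  {A B : Plane → ℝ}

/-- A polynomial factor is absorbed by an exponential one, at the price of a smaller rate. -/
theorem exists_decay {ρ Q : ℝ} (h0 : 0 < ρ) (h1 : ρ < 1) (hQ : 0 ≤ Q) :
    ∃ C > 0, ∃ d > 0, ∀ k : ℕ, 1 ≤ k →
      √(Q * ((k + 10 : ℕ) + 2) ^ 2 * ρ ^ ((k - 9) / 13)) ≤ C * (√k * Real.exp (-d * k)) := by
  set b := -Real.log ρ / 13 with hb
  have hlog : Real.log ρ < 0 := Real.log_neg h0 h1
  have hb0 : 0 < b := by rw [hb]; linarith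
  refine ⟨(√Q + 1) * Real.exp (13 * b) * (13 * (4 / b)), by positivity, b / 4, by positivity,
    fun k hk => ?_⟩
  have hk' : (1 : ℝ) ≤ k := by exact_mod_cast hk
  have hpow : ρ ^ ((k - 9) / 13) ≤ (Real.exp (13 * b) * Real.exp (-(b / 2) * k)) ^ 2 := by
    rw [← Real.exp_log (pow_pos h0 _), Real.log_pow, ← Real.exp_add, ← Real.exp_nat_mul]
    refine Real.exp_le_exp.2 ?_
    have hn : (k : ℝ) ≤ 13 * ((k - 9) / 13 : ℕ) + 26 := by
      exact_mod_cast (by omega : k ≤ 13 * ((k - 9) / 13) + 26)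
    have e : Real.log ρ = -(13 * b) := by rw [hb]; ring
    rw [e]
    push_cast
    nlinarith
  have hlin : (k : ℝ) * Real.exp (-(b / 4) * k) ≤ 4 / b := by
    have h2 := Real.add_one_le_exp (b / 4 * k)
    rw [neg_mul, Real.exp_neg, ← div_eq_mul_inv, div_le_div_iff₀ (Real.exp_pos _) hb0]
    nlinarith
  have hs : 1 ≤ √(k : ℝ) := Real.one_le_sqrt.2 hk'
  have hexp : Real.exp (-(b / 2) * k) = Real.exp (-(b / 4) * k) * Real.exp (-(b / 4) * k) := by
    rw [← Real.exp_add]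
    ring_nf
  calc √(Q * ((k + 10 : ℕ) + 2) ^ 2 * ρ ^ ((k - 9) / 13))
      ≤ √(Q * ((k + 10 : ℕ) + 2) ^ 2 * (Real.exp (13 * b) * Real.exp (-(b / 2) * k)) ^ 2) :=
        Real.sqrt_le_sqrt (mul_le_mul_of_nonneg_left hpow (by positivity))
    _ = √Q * (((k + 10 : ℕ) + 2) * (Real.exp (13 * b) * Real.exp (-(b / 2) * k))) := by
        rw [mul_assoc, ← mul_pow, Real.sqrt_mul hQ, Real.sqrt_sq (by positivity)]
    _ ≤ (√Q + 1) * ((13 * k) * (Real.exp (13 * b) * Real.exp (-(b / 2) * k))) := by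
        gcongr
        · linarith
        · push_cast
          linarith
    _ = (√Q + 1) * Real.exp (13 * b) * (13 * (k * Real.exp (-(b / 4) * k))) *
          (1 * Real.exp (-(b / 4) * k)) := by rw [hexp]; ring
    _ ≤ (√Q + 1) * Real.exp (13 * b) * (13 * (4 / b)) * (√k * Real.exp (-(b / 4) * k)) := by
        gcongr

/-- The factor by which the energy in a ring of elements bounds the energy inside the ring, in
terms of the stability constant `K` and the overlap constant `M`. -/
noncomputable def ringFactor (K M : ℝ) : ℝ := 1 + (2 * K + 2 * K * (K * (M * 4 ^ 2))) * (M * 6 ^ 2)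

theorem one_le_ringFactor {K M : ℝ} (hK : 0 ≤ K) (hM : 0 ≤ M) : 1 ≤ ringFactor K M := by
  unfold ringFactor
  have : 0 ≤ (2 * K + 2 * K * (K * (M * 4 ^ 2))) * (M * 6 ^ 2) := by positivity
  linarith

theorem map_sub_sub_sum_eq_zero {V W ι : Type*} [AddCommGroup V] [Module ℝ V] [AddCommGroup W]
    [Module ℝ W] [Fintype ι] (I : V →ₗ[ℝ] W) {u v : V} (hv : I v = I u) {φ : ι → V}
    (hφ : ∀ T, I (φ T) = 0) : I (u - (v - ∑ T, φ T)) = 0 := by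
  simp [hv, hφ]

namespace MeshData

variable {P : Finset Plane → Set Plane} {I : energySpace Γ →ₗ[ℝ] coarseSpace Γ 𝒯} {C : ℝ}

/-- On the kernel of the interpolation the right-hand side is of the order of the mesh size. -/
theorem abs_load_le_of_ker (h : MeshData Γ 𝒯 P I A B α β γ C) (f : Lp ℝ 2 (bulk Ω))
    (fΓ : Lp ℝ 2 Γ.length) {z : energySpace Γ} (hz : I z = 0) :
    |load f fΓ z| ≤ (‖f‖ + ‖fΓ‖) *
      (√(2 * C ^ 2 * (16 * γ ^ 2 * 4 ^ 2) * α⁻¹) * 𝒯.meshSize * √(h.energy z z)) := by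
  classical
  have hz' : (I z : energySpace Γ) = 0 := congrArg Subtype.val hz
  have hH := 𝒯.meshSize_pos h.domain
  have hα := h.pos
  have h1 : ‖val z‖ ^ 2 + ‖trace z‖ ^ 2 ≤ 2 * (C * 𝒯.meshSize) ^ 2 * (16 * γ ^ 2 * 4 ^ 2 *
      dirichlet univ univ z) := by
    rw [← sum_mass h.domain.isOpen h.distribution, ← sum_dirichlet h.domain.isOpen h.distribution]
    have h2 : ∀ t : 𝒯.tri, mass (hull t.1) (P t.1) z ≤ 2 * (C * 𝒯.meshSize) ^ 2 *
        ∑ s ∈ graphBall 𝒯.Meets 2 t, dirichlet (hull s.1) (P s.1) z := fun t => by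
      have := h.interpolation.mass_sub_le h.distribution t z
      rwa [hz', sub_zero] at this
    refine (Finset.sum_le_sum fun t _ => h2 t).trans ?_
    rw [← Finset.mul_sum]
    refine mul_le_mul_of_nonneg_left ?_ (by positivity)
    exact sum_graphBall_le Triangulation.Meets.symm 2 _
      (fun t => (h.regular.card_graphBall_le h.domain 2 t).trans_eq (by norm_num)) _ _
      (fun _ _ _ _ => Finset.mem_univ _) (fun t : 𝒯.tri => dirichlet (hull t.1) (P t.1) z)
      fun t => dirichlet_nonneg _ _ _
  have h2 : dirichlet univ univ z ≤ α⁻¹ * h.energy z z := by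
    rw [inv_mul_eq_div, le_div_iff₀ h.pos, mul_comm]
    exact h.le_energy z
  have h3 : ‖val z‖ ^ 2 + ‖trace z‖ ^ 2 ≤
      (√(2 * C ^ 2 * (16 * γ ^ 2 * 4 ^ 2) * α⁻¹) * 𝒯.meshSize * √(h.energy z z)) ^ 2 := by
    rw [mul_pow, mul_pow, Real.sq_sqrt (by positivity), Real.sq_sqrt (h.energy_nonneg z)]
    refine (h1.trans (mul_le_mul_of_nonneg_left (mul_le_mul_of_nonneg_left h2 (by positivity))
      (by positivity))).trans_eq ?_
    ring
  refine abs_load_le f fΓ ?_ ?_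
  · exact abs_le_of_sq_le_sq' (by nlinarith [sq_nonneg ‖trace z‖]) (by positivity) |>.2
  · exact abs_le_of_sq_le_sq' (by nlinarith [sq_nonneg ‖val z‖]) (by positivity) |>.2

theorem sqrt_energy_le_of_abs_load_le (h : MeshData Γ 𝒯 P I A B α β γ C) {z : energySpace Γ}
    {m x : ℝ} (hm : 0 ≤ m) (hx : |x| ≤ m * √(h.energy z z)) (he : h.energy z z = x) :
    √(h.energy z z) ≤ m := by
  rw [← he] at hx
  have h1 := (le_abs_self _).trans hx
  by_contra! hlt
  have h2 := Real.mul_self_sqrt (h.energy_nonneg z)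
  nlinarith

set_option maxHeartbeats 2000000 in
/-- The ideal method, whose correctors are not localized, has an error of the order of the mesh
size: the error lies in the kernel of the interpolation, to which the approximation is
orthogonal. -/
theorem ideal_error_le (h : MeshData Γ 𝒯 P I A B α β γ C) {f : Lp ℝ 2 (bulk Ω)}
    {fΓ : Lp ℝ 2 Γ.length} {u v : energySpace Γ} (hu : IsWeakSolution A B f fΓ u)
    (hv : I v = I u) {φ : 𝒯.tri → energySpace Γ} (hφ : ∀ T, I (φ T) = 0)
    (hφ' : ∀ T w, I w = 0 →
      h.energy (φ T) w = formMap h.permeability (hull T.1) (P T.1) v w) :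
    √(h.energy (u - (v - ∑ T, φ T)) (u - (v - ∑ T, φ T))) ≤
      (‖f‖ + ‖fΓ‖) * (√(2 * C ^ 2 * (16 * γ ^ 2 * 4 ^ 2) * α⁻¹) * 𝒯.meshSize) := by
  have hH := 𝒯.meshSize_pos h.domain
  set x := v - ∑ T, φ T with hx
  have hIz : I (u - x) = 0 :=
    map_sub_sub_sum_eq_zero (V := energySpace Γ) (W := coarseSpace Γ 𝒯) I hv hφ
  have horth : ∀ w, I w = 0 → h.energy x w = 0 := fun w hw => by
    rw [hx, map_sub, map_sum, LinearMap.sub_apply, LinearMap.sum_apply,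
      Finset.sum_congr rfl fun T _ => hφ' T w hw, sub_eq_zero]
    exact (sum_formOn h.permeability h.domain.isOpen h.distribution v w).symm
  have hzz : h.energy (u - x) (u - x) = load f fΓ (u - x) := by
    have e : h.energy (u - x) (u - x) = h.energy u (u - x) - h.energy x (u - x) := by
      rw [map_sub h.energy, LinearMap.sub_apply]
    rw [e, horth _ hIz, sub_zero]
    exact hu _
  exact h.sqrt_energy_le_of_abs_load_le (by positivity)
    ((h.abs_load_le_of_ker f fΓ hIz).trans_eq (by ring)) hzz

set_option maxHeartbeats 2000000 in
theorem localization_error_le (h : MeshData Γ 𝒯 P I A B α β γ C) (k : ℕ) {v : energySpace Γ}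
    {φ ψ : 𝒯.tri → energySpace Γ} (hφ : ∀ T, I (φ T) = 0)
    (hφ' : ∀ T w, I w = 0 →
      h.energy (φ T) w = formMap h.permeability (hull T.1) (P T.1) v w)
    (hψ : ∀ T : 𝒯.tri, IsCorrector A B P I k v T.1 (ψ T)) :
    √(h.energy (∑ T, φ T - ∑ T, ψ T) (∑ T, φ T - ∑ T, ψ T)) ≤
      √(2 * ringFactor (stab α β γ C) (16 * γ ^ 2) ^ 2 * (16 * γ ^ 2) * ((k + 10 : ℕ) + 2) ^ 2 *
        (ringFactor (stab α β γ C) (16 * γ ^ 2) /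
          (1 + ringFactor (stab α β γ C) (16 * γ ^ 2))) ^ ((k - 9) / 13)) *
        √(h.energy v v) := by
  obtain ⟨T₀, hT₀⟩ := 𝒯.tri_nonempty h.domain
  have hψ' := fun T => h.isCorrector_iff.1 (hψ T)
  have hr := one_le_ringFactor (M := 16 * γ ^ 2)
    (stab_nonneg (γ := γ) (C := C) h.pos h.le) (by positivity)
  have b := h.localSetting.sum_localization_error ⟨T₀, hT₀⟩ v k φ ψ
    (fun T => congrArg Subtype.val (hφ T))
    (fun T w hw => by rw [h.total_eq_energy]; exact hφ' T w (Subtype.ext hw))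
    (fun T => (hψ' T).1) (fun T w hw => by rw [h.total_eq_energy]; exact (hψ' T).2 w hw)
  rw [h.total_eq_energy] at b
  have b' : h.energy (∑ T, φ T - ∑ T, ψ T) (∑ T, φ T - ∑ T, ψ T) ≤
      2 * ringFactor (stab α β γ C) (16 * γ ^ 2) ^ 2 * (16 * γ ^ 2 * ((k + 10 : ℕ) + 2) ^ 2) *
        (ringFactor (stab α β γ C) (16 * γ ^ 2) /
          (1 + ringFactor (stab α β γ C) (16 * γ ^ 2))) ^ ((k - 9) / 13) * h.energy v v := b
  rw [← mul_assoc (2 * ringFactor (stab α β γ C) (16 * γ ^ 2) ^ 2)] at b'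
  have hr0 := zero_le_one.trans hr
  have b'' := Real.sqrt_le_sqrt b'
  rwa [Real.sqrt_mul (by positivity)] at b''

theorem sum_sub_mem_multiscaleSpace (k : ℕ) {v : energySpace Γ}
    (hv : v ∈ coarseSpace Γ 𝒯) {ψ : 𝒯.tri → energySpace Γ}
    (hψ : ∀ T : 𝒯.tri, IsCorrector A B P I k v T.1 (ψ T)) :
    ∑ T, ψ T - v ∈ multiscaleSpace A B P I k := by
  classical
  refine ⟨v, hv, fun T => if hT : T ∈ 𝒯.tri then ψ ⟨T, hT⟩ else 0, fun T hT => ?_, ?_⟩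
  · beta_reduce
    rw [dif_pos hT]
    exact hψ ⟨T, hT⟩
  · congr 1
    rw [← Finset.sum_coe_sort 𝒯.tri]
    exact Finset.sum_congr rfl fun T _ => by rw [dif_pos T.2]

/-- The Galerkin solution is the best approximation in the energy norm. -/
theorem galerkin_error_le (h : MeshData Γ 𝒯 P I A B α β γ C) (k : ℕ) {f : Lp ℝ 2 (bulk Ω)}
    {fΓ : Lp ℝ 2 Γ.length} {u uk w : energySpace Γ} (hu : IsWeakSolution A B f fΓ u)
    (huk : IsMultiscaleSolution A B P I k f fΓ uk) (hw : -w ∈ multiscaleSpace A B P I k) :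
    h.energy (u - uk) (u - uk) ≤ h.energy (u - w) (u - w) := by
  obtain ⟨W, -, hW⟩ := h.exists_multiscale_eq k
  have hmem : ∀ w, w ∈ multiscaleSpace A B P I k ↔ w ∈ W := fun w => by rw [hW]; rfl
  have hd := W.sub_mem ((hmem _).1 huk.1) (neg_mem_iff.1 ((hmem _).1 hw))
  refine galerkin_le h.energy h.energy_symm h.energy_nonneg u uk _ ?_
  have e : h.energy (u - uk) (uk - w) = h.energy u (uk - w) - h.energy uk (uk - w) := by
    rw [map_sub h.energy, LinearMap.sub_apply]
  rw [e]
  exact sub_eq_zero.2 ((hu _).trans (huk.2 _ ((hmem _).2 hd)).symm)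

set_option maxHeartbeats 2000000 in
/-- The error of the Galerkin method in the localized space: the error of the ideal method, which
is of the order of the mesh size, and the localization error. -/
theorem energy_error_le (h : MeshData Γ 𝒯 P I A B α β γ C) (hc0 : 0 < c)
    (hc : ∀ v : energySpace Γ, ‖val v‖ ≤ c * ‖grad v‖ ∧ ‖trace v‖ ≤ c * ‖grad v‖) (k : ℕ)
    {f : Lp ℝ 2 (bulk Ω)} {fΓ : Lp ℝ 2 Γ.length} {u uk : energySpace Γ}
    (hu : IsWeakSolution A B f fΓ u) (huk : IsMultiscaleSolution A B P I k f fΓ uk) :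
    energyNorm A B (u - uk) ≤
      (√(2 * C ^ 2 * (16 * γ ^ 2 * 4 ^ 2) * α⁻¹) * 𝒯.meshSize +
        √(2 * ringFactor (stab α β γ C) (16 * γ ^ 2) ^ 2 * (16 * γ ^ 2) * ((k + 10 : ℕ) + 2) ^ 2 *
          (ringFactor (stab α β γ C) (16 * γ ^ 2) /
            (1 + ringFactor (stab α β γ C) (16 * γ ^ 2))) ^ ((k - 9) / 13)) *
        (√(stab α β γ C * (16 * γ ^ 2 * 4 ^ 2)) * (c * √α⁻¹))) * (‖f‖ + ‖fΓ‖) := by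
  have hstab := stab_nonneg (γ := γ) (C := C) h.pos h.le
  obtain ⟨v, hvH, hIv, hv⟩ : ∃ v ∈ coarseSpace Γ 𝒯, I v = I u ∧ h.energy v v ≤
      stab α β γ C * (16 * γ ^ 2 * 4 ^ 2) * h.energy u u :=
    ⟨I u, (I u).2, h.interpolation.idempotent u, h.energy_interpolation_le u⟩
  choose φ hφ hφ' using h.exists_idealCorrector v
  choose ψ hψ using fun T => (h.existsUnique_isCorrector k v T).exists
  have b1 := h.ideal_error_le hu hIv hφ hφ'
  have b2 := h.localization_error_le k hφ hφ' hψ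
  have b3 : √(h.energy u u) ≤ (‖f‖ + ‖fΓ‖) * (c * √α⁻¹) :=
    h.sqrt_energy_le_of_abs_load_le (by positivity) (h.abs_load_le_energy hc0 hc f fΓ u) (hu u)
  have b4 : √(h.energy v v) ≤ √(stab α β γ C * (16 * γ ^ 2 * 4 ^ 2)) *
      ((‖f‖ + ‖fΓ‖) * (c * √α⁻¹)) := by
    refine (Real.sqrt_le_sqrt hv).trans ?_
    rw [Real.sqrt_mul (by positivity)]
    exact mul_le_mul_of_nonneg_left b3 (Real.sqrt_nonneg _)
  have b5 := h.galerkin_error_le k (w := v - ∑ T, ψ T) hu huk (by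
    rw [neg_sub]
    exact sum_sub_mem_multiscaleSpace k hvH hψ)
  have e : u - (v - ∑ T, ψ T) = (u - (v - ∑ T, φ T)) + -(∑ T, φ T - ∑ T, ψ T) := by abel
  have b6 : √(h.energy (u - uk) (u - uk)) ≤
      √(h.energy (u - (v - ∑ T, φ T)) (u - (v - ∑ T, φ T))) +
      √(h.energy (∑ T, φ T - ∑ T, ψ T) (∑ T, φ T - ∑ T, ψ T)) := by
    refine (Real.sqrt_le_sqrt b5).trans ?_
    rw [e]
    refine (sqrt_form_add_le h.energy h.energy_symm h.energy_nonneg _ _).trans_eq ?_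
    rw [map_neg h.energy, LinearMap.neg_apply, map_neg, neg_neg]
  have b8 := b2.trans (mul_le_mul_of_nonneg_left b4 (Real.sqrt_nonneg _))
  refine (b6.trans (add_le_add b1 b8)).trans_eq ?_
  ring

end MeshData

end LOD

theorem theorem4 {Ω : Set LOD.Plane} (hΩ : LOD.IsPolygonalDomain Ω) (Γ : LOD.Interfaces Ω)
    (α β γ C₀ : ℝ) (hα : 0 < α) (hαβ : α ≤ β) :
    ∃ C > 0, ∃ c > 0, ∀ (𝒯 : LOD.Triangulation Ω), 𝒯.IsRegular γ →
      ∀ (P : Finset LOD.Plane → Set LOD.Plane), LOD.IsDistribution Γ 𝒯 P →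
      ∀ (I : LOD.energySpace Γ →ₗ[ℝ] LOD.coarseSpace Γ 𝒯), LOD.IsInterpolation 𝒯 C₀ I →
      ∀ (A B : LOD.Plane → ℝ), LOD.IsPermeability Γ A B α β →
      ∀ (k : ℕ), 7 ≤ k →
        (∀ v ∈ LOD.coarseSpace Γ 𝒯, ∀ T ∈ 𝒯.tri, ∃! φ, LOD.IsCorrector A B P I k v T φ) ∧
        ∀ (f : Lp ℝ 2 (LOD.bulk Ω)) (fΓ : Lp ℝ 2 Γ.length),
          (∃! u, LOD.IsWeakSolution A B f fΓ u) ∧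
          (∃! uk, LOD.IsMultiscaleSolution A B P I k f fΓ uk) ∧
          ∀ u uk : LOD.energySpace Γ, LOD.IsWeakSolution A B f fΓ u →
            LOD.IsMultiscaleSolution A B P I k f fΓ uk →
            LOD.energyNorm A B (u - uk) ≤
              C * (𝒯.meshSize + Real.sqrt k * Real.exp (-c * k)) * (‖f‖ + ‖fΓ‖) := by
  obtain ⟨c, hc0, hc⟩ := LOD.exists_poincare (LOD.isBounded_closure hΩ) Γ
  set K := LOD.MeshData.stab α β γ C₀
  have hK : 0 ≤ K := LOD.MeshData.stab_nonneg hα hαβ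
  set r := LOD.ringFactor K (16 * γ ^ 2)
  have hr : 1 ≤ r := LOD.one_le_ringFactor hK (by positivity)
  obtain ⟨C, hC, d, hd, hdecay⟩ := LOD.exists_decay (ρ := r / (1 + r))
    (Q := 2 * r ^ 2 * (16 * γ ^ 2)) (by positivity)
    ((div_lt_one (by positivity)).2 (by linarith)) (by positivity)
  set p := √(2 * C₀ ^ 2 * (16 * γ ^ 2 * 4 ^ 2) * α⁻¹)
  set q := √(K * (16 * γ ^ 2 * 4 ^ 2)) * (c * √α⁻¹)
  have hp : 0 ≤ p := Real.sqrt_nonneg _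
  have hq : 0 ≤ q := by positivity
  refine ⟨p + C * q + 1, by positivity, d, hd, fun 𝒯 h𝒯 P hP I hI A B hAB k hk => ?_⟩
  have h : LOD.MeshData Γ 𝒯 P I A B α β γ C₀ := ⟨hΩ, hα, hαβ, h𝒯, hP, hI, hAB⟩
  refine ⟨fun v _ T hT => h.existsUnique_isCorrector k v ⟨T, hT⟩, fun f fΓ =>
    ⟨h.existsUnique_isWeakSolution f fΓ, h.existsUnique_isMultiscaleSolution k f fΓ,
      fun u uk hu huk => ?_⟩⟩
  refine (h.energy_error_le hc0 hc k hu huk).trans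
    (mul_le_mul_of_nonneg_right ?_ (by positivity))
  have h1 := mul_le_mul_of_nonneg_right (hdecay k (by omega)) hq
  have hH := (𝒯.meshSize_pos hΩ).le
  have hE : 0 ≤ √(k : ℝ) * Real.exp (-d * k) := by positivity
  calc _ ≤ p * 𝒯.meshSize + C * (√(k : ℝ) * Real.exp (-d * k)) * q := by gcongr
    _ ≤ p * 𝒯.meshSize + C * (√(k : ℝ) * Real.exp (-d * k)) * q +
        ((C * q + 1) * 𝒯.meshSize + (p + 1) * (√(k : ℝ) * Real.exp (-d * k))) :=
      le_add_of_nonneg_right (by positivity)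
    _ = _ := by ring
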